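/- Let $d,n\ge 1$, let $\mathcal X\subset\mathbb R^d$ be compact, let $\mu$ be a finite Borel measure on $\mathcal X$ (for instance a probability distribution, or Lebesgue measure), let $f_\star$ be continuous on $\mathcal X$, and write $\mathcal E(f)=\int_{\mathcal X}(f-f_\star)^2\,d\mu$ for the excess risk. Fix training data $(x_i,y_i)$, $i=1,\dots,n$, with pairwise distinct $x_i\in\mathcal X$ and $y_i\in\mathbb R$. For a two-layer ReLU network with $2m$ neurons and parameters $\theta=(a_r,w_r,b_r,b)_{r\le 2m}$ put $$f^m_\theta(x)=\frac1{\sqrt m}\sum_{r=1}^{2m}a_r\max\{\langle w_r,x\rangle+b_r,0\}+b .$$ At initialization $a_r,\,b_r$ and the coordinates of $w_r$, $r\le m$, are independent $\mathcal N(0,1)$ variables, $a_{r+m}=-a_r$, $w_{r+m}=w_r$, $b_{r+m}=b_r$ and $b=0$. A gradient flow is a curve $\theta:[0,\infty)\to\mathbb R^{(d+2)2m+1}$, absolutely continuous on bounded intervals, with $\dot\theta(t)=-\frac1n\sum_i (f^m_{\theta(t)}(x_i)-y_i)\nabla_\theta f^m_{\theta(t)}(x_i)$, the gradient of $\frac1{2n}\sum_i(y_i-f^m_\theta(x_i))^2$,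 for almost every $t\ge 0$; wherever a pre-activation vanishes at a sample point, any value in $[0,1]$ is allowed for the derivative of ReLU. Let $\psi(x,x')=\arccos\frac{\langle x,x'\rangle+1}{\sqrt{(\|x\|^2+1)(\|x'\|^2+1)}}$, let $$K_d(x,x')=\frac2\pi(\pi-\psi(x,x'))(\langle x,x'\rangle+1)+\frac1\pi\sqrt{\|x-x'\|^2+\|x\|^2\|x'\|^2-\langle x,x'\rangle^2}+1$$ be the neural tangent kernel, and let $$f^{\mathrm{NTK}}_t(x)=K_d(x,X)K_d(X,X)^{-1}\bigl(I-e^{-\frac tn K_d(X,X)}\bigr)y$$ be the NTK gradient-flow regression function. Then there is a sequence $\delta_m\to0$ such that for every $\varepsilon>0$ and all sufficiently large $m$, with probability at least $1-\delta_m$ over the initialization, a gradient flow started at the initial parameters exists and every such gradient flow satisfies $$\sup_{t\ge0}\bigl|\mathcal E(f^m_{\theta(t)})-\mathcal E(f^{\mathrm{NTK}}_t)\bigr|\le\varepsilon .$$ (If the event is not measurable, this means that it contains a measurable event of probability at least $1-\delta_m$.) -/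

import Mathlib

open MeasureTheory ProbabilityTheory Filter Topology
open scoped NNReal ENNReal Matrix

noncomputable section

/-! ### Two-layer ReLU networks -/

/-- Parameters `(a, w, b, c)` of a two-layer network with `M` hidden neurons on `ℝ^d`: outer weights
`a r`, inner weights `w r`, inner biases `b r`, and the outer bias `c`. -/
abbrev Params (M d : ℕ) : Type :=
  (Fin M → ℝ) × (Fin M → EuclideanSpace ℝ (Fin d)) × (Fin M → ℝ) × ℝ

/-- The pre-activation `⟨w_r, x⟩ + b_r` of the `r`-th neuron. -/
def preact {M d : ℕ} (θ : Params M d) (r : Fin M) (x : EuclideanSpace ℝ (Fin d)) : ℝ :=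
  inner ℝ (θ.2.1 r) x + θ.2.2.1 r

/-- The ReLU function `z ↦ max z 0`. -/
def relu (z : ℝ) : ℝ := max z 0

/-- The network function
`f_θ(x) = √(2 / M) * ∑ r, a_r * relu (⟨w_r, x⟩ + b_r) + c`. -/
def network {M d : ℕ} (θ : Params M d) (x : EuclideanSpace ℝ (Fin d)) : ℝ :=
  √(2 / (M : ℝ)) * ∑ r, θ.1 r * relu (preact θ r x) + θ.2.2.2

/-- The empirical squared loss `1 / (2 n) * ∑ i, (y_i - f_θ(x_i))^2`. -/
def empiricalLoss {n M d : ℕ} (x : Fin n → EuclideanSpace ℝ (Fin d)) (y : Fin n → ℝ)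
    (θ : Params M d) : ℝ :=
  1 / (2 * (n : ℝ)) * ∑ i, (y i - network θ (x i)) ^ 2

/-! ### Gradient flow of the empirical loss -/

/-- The (Clarke) subdifferential of ReLU: `{0}` for `z < 0`, `{1}` for `z > 0`, and `[0, 1]` at the
kink `z = 0`. -/
def reluSubdiff (z : ℝ) : Set ℝ :=
  {s | 0 ≤ s ∧ s ≤ 1 ∧ (z < 0 → s = 0) ∧ (0 < z → s = 1)}

/-- The gradient `∇_θ f_θ(x)`, with `s r` used as the value of the derivative of ReLU at the
pre-activation of the `r`-th neuron. -/
def networkGradient {M d : ℕ} (θ : Params M d) (x : EuclideanSpace ℝ (Fin d)) (s : Fin M → ℝ) :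
    Params M d :=
  (fun r => √(2 / (M : ℝ)) * relu (preact θ r x),
   fun r => (√(2 / (M : ℝ)) * θ.1 r * s r) • x,
   fun r => √(2 / (M : ℝ)) * θ.1 r * s r,
   1)

/-- The gradient `∇_θ` of the empirical loss, i.e. `1 / n * ∑ i, (f_θ(x_i) - y_i) ∇_θ f_θ(x_i)`, with
`s i r` used as the value of the derivative of ReLU at the pre-activation of the `r`-th neuron at
the `i`-th sample point. -/
def lossGradient {n M d : ℕ} (x : Fin n → EuclideanSpace ℝ (Fin d)) (y : Fin n → ℝ)
    (θ : Params M d) (s : Fin n → Fin M → ℝ) : Params M d :=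
  (1 / (n : ℝ)) • ∑ i, (network θ (x i) - y i) • networkGradient θ (x i) (s i)

/-- The Euclidean inner product of the parameter space. -/
def paramInner {M d : ℕ} (θ η : Params M d) : ℝ :=
  ∑ r, θ.1 r * η.1 r + ∑ r, inner ℝ (θ.2.1 r) (η.2.1 r) + ∑ r, θ.2.2.1 r * η.2.2.1 r
    + θ.2.2.2 * η.2.2.2

/-- Away from the kink of ReLU, the elements of `reluSubdiff` are its derivative. -/
theorem hasDerivAt_relu {z s : ℝ} (hz : z ≠ 0) (hs : s ∈ reluSubdiff z) : HasDerivAt relu s z := by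
  rcases lt_or_gt_of_ne hz with h | h
  · rw [hs.2.2.1 h]
    refine (hasDerivAt_const z (0 : ℝ)).congr_of_eventuallyEq ?_
    filter_upwards [gt_mem_nhds h] with w hw using max_eq_right hw.le
  · rw [hs.2.2.2 h]
    refine (hasDerivAt_id z).congr_of_eventuallyEq ?_
    filter_upwards [lt_mem_nhds h] with w hw using max_eq_left hw.le

/-- Away from the kinks of ReLU, `networkGradient` is the gradient of the network function in the
parameters. -/
theorem hasDerivAt_network {M d : ℕ} (θ η : Params M d) (x : EuclideanSpace ℝ (Fin d))
    (s : Fin M → ℝ) (hne : ∀ r, preact θ r x ≠ 0) (hs : ∀ r, s r ∈ reluSubdiff (preact θ r x)) :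
    HasDerivAt (fun τ : ℝ => network (θ + τ • η) x) (paramInner (networkGradient θ x s) η) 0 := by
  have hpre : ∀ r, HasDerivAt (fun τ : ℝ => preact (θ + τ • η) r x) (preact η r x) 0 := by
    intro r
    have h : (fun τ : ℝ => preact (θ + τ • η) r x)
        = fun τ => preact θ r x + τ * preact η r x := by
      ext τ
      simp [preact, inner_add_left, inner_smul_left]
      ring
    rw [h]
    simpa using ((hasDerivAt_id (0 : ℝ)).mul_const (preact η r x)).const_add (preact θ r x)
  have hrelu : ∀ r, HasDerivAt (fun τ : ℝ => relu (preact (θ + τ • η) r x))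
      (s r * preact η r x) 0 := by
    intro r
    have h := hasDerivAt_relu (hne r) (hs r)
    rw [show preact θ r x = preact (θ + (0 : ℝ) • η) r x by simp] at h
    exact h.comp (0 : ℝ) (hpre r)
  have ha : ∀ r, HasDerivAt (fun τ : ℝ => (θ + τ • η).1 r) (η.1 r) 0 := by
    intro r
    simpa using ((hasDerivAt_id (0 : ℝ)).mul_const (η.1 r)).const_add (θ.1 r)
  have hc : HasDerivAt (fun τ : ℝ => (θ + τ • η).2.2.2) η.2.2.2 0 := by
    simpa using ((hasDerivAt_id (0 : ℝ)).mul_const η.2.2.2).const_add θ.2.2.2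
  have hsum := ((HasDerivAt.fun_sum (u := Finset.univ)
    fun r _ => (ha r).mul (hrelu r)).const_mul √(2 / (M : ℝ))).add hc
  refine hsum.congr_deriv ?_
  simp only [paramInner, networkGradient, preact, inner_smul_left, zero_smul, add_zero,
    Finset.mul_sum, ← Finset.sum_add_distrib, one_mul, RCLike.conj_to_real]
  congr 1
  refine Finset.sum_congr rfl fun r _ => ?_
  rw [real_inner_comm (η.2.1 r) x]
  ring

/-- Away from the kinks of ReLU, `lossGradient` is the gradient of the empirical loss. -/
theorem hasDerivAt_empiricalLoss {n M d : ℕ} (x : Fin n → EuclideanSpace ℝ (Fin d))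
    (y : Fin n → ℝ) (θ η : Params M d) (s : Fin n → Fin M → ℝ)
    (hne : ∀ i r, preact θ r (x i) ≠ 0)
    (hs : ∀ i r, s i r ∈ reluSubdiff (preact θ r (x i))) :
    HasDerivAt (fun τ : ℝ => empiricalLoss x y (θ + τ • η))
      (paramInner (lossGradient x y θ s) η) 0 := by
  have hlin : ∀ (c : ℝ) (a b : Params M d),
      paramInner (c • a + b) η = c * paramInner a η + paramInner b η := by
    intro c a b
    simp [paramInner, inner_add_left, inner_smul_left, add_mul, mul_assoc, Finset.sum_add_distrib,
      ← Finset.mul_sum]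
    ring
  have hzero : paramInner (0 : Params M d) η = 0 := by simp [paramInner]
  have hsum : ∀ S : Finset (Fin n), paramInner (∑ i ∈ S,
      (network θ (x i) - y i) • networkGradient θ (x i) (s i)) η
      = ∑ i ∈ S, (network θ (x i) - y i) * paramInner (networkGradient θ (x i) (s i)) η := by
    intro S
    induction S using Finset.induction_on with
    | empty => simpa using hzero
    | insert i S hi ih => rw [Finset.sum_insert hi, Finset.sum_insert hi, hlin, ih]
  have hval : paramInner (lossGradient x y θ s) η = 1 / (n : ℝ) *
      ∑ i, (network θ (x i) - y i) * paramInner (networkGradient θ (x i) (s i)) η := by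
    have h := hlin (1 / (n : ℝ))
      (∑ i, (network θ (x i) - y i) • networkGradient θ (x i) (s i)) 0
    rw [add_zero, hzero, add_zero, hsum] at h
    exact h
  have hD := (HasDerivAt.fun_sum (u := Finset.univ) fun i _ =>
    ((hasDerivAt_network θ η (x i) (s i) (hne i) (hs i)).const_sub (y i)).pow 2).const_mul
      (1 / (2 * (n : ℝ)))
  refine hD.congr_deriv ?_
  rw [hval, Finset.mul_sum, Finset.mul_sum]
  refine Finset.sum_congr rfl fun i _ => ?_
  simp only [zero_smul, add_zero, one_div, mul_inv]
  norm_num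
  ring

/-- `θ` is a gradient flow on `[0, ∞)` of the empirical loss: it is absolutely continuous on every
`[0, T]` and for almost every `t ≥ 0` it satisfies `θ' (t) = - ∇_θ (empirical loss) (θ t)`. As ReLU
is not differentiable at `0`, any value in its subdifferential is allowed there as the derivative;
in particular every solution for the convention that the derivative of ReLU at `0` is `1` (or is
`0`) is included. -/
def IsGradientFlow {n M d : ℕ} (x : Fin n → EuclideanSpace ℝ (Fin d)) (y : Fin n → ℝ)
    (θ : ℝ → Params M d) : Prop :=
  (∀ T : ℝ, 0 ≤ T → AbsolutelyContinuousOnInterval θ 0 T) ∧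
    ∀ᵐ t ∂(volume.restrict (Set.Ici (0 : ℝ))), ∃ s : Fin n → Fin M → ℝ,
      (∀ i r, s i r ∈ reluSubdiff (preact (θ t) r (x i))) ∧
        HasDerivAt θ (-lossGradient x y (θ t) s) t

/-! ### Random initialization -/

/-- The independent draws `(a_r, w_r, b_r)`, `r = 1, …, m`, that determine the initialization of a
network of width `2 m`. -/
abbrev InitDraw (m d : ℕ) : Type :=
  (Fin m → ℝ) × (Fin m → Fin d → ℝ) × (Fin m → ℝ)

/-- All the entries of the draw are independent standard Gaussian variables. -/
def initLaw (m d : ℕ) : Measure (InitDraw m d) :=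
  (Measure.pi fun _ : Fin m => gaussianReal 0 1).prod
    ((Measure.pi fun _ : Fin m => Measure.pi fun _ : Fin d => gaussianReal 0 1).prod
      (Measure.pi fun _ : Fin m => gaussianReal 0 1))

/-- The antisymmetric initialization of a network of width `2 m`:
`a_{r+m} = -a_r`, `w_{r+m} = w_r`, `b_{r+m} = b_r` for `r = 1, …, m`, and the outer bias is `0`. -/
def initParams {m d : ℕ} (g : InitDraw m d) : Params (m + m) d :=
  (Fin.append g.1 (fun r => -g.1 r),
   Fin.append (fun r => WithLp.toLp 2 (g.2.1 r)) (fun r => WithLp.toLp 2 (g.2.1 r)),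
   Fin.append g.2.2 g.2.2,
   0)

/-! ### The neural tangent kernel and its regression function -/

/-- The angle `ψ(x, x')` between `(x, 1)` and `(x', 1)`. -/
def ntkAngle {d : ℕ} (x x' : EuclideanSpace ℝ (Fin d)) : ℝ :=
  Real.arccos ((inner ℝ x x' + 1) / √((‖x‖ ^ 2 + 1) * (‖x'‖ ^ 2 + 1)))

/-- The neural tangent kernel `K_d` of two-layer ReLU networks on `ℝ^d`. -/
def ntk {d : ℕ} (x x' : EuclideanSpace ℝ (Fin d)) : ℝ :=
  2 / Real.pi * (Real.pi - ntkAngle x x') * (inner ℝ x x' + 1)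
    + 1 / Real.pi * √(‖x - x'‖ ^ 2 + ‖x‖ ^ 2 * ‖x'‖ ^ 2 - (inner ℝ x x') ^ 2) + 1

/-- The Gram matrix `K_d(X, X)`. -/
def ntkGram {n d : ℕ} (x : Fin n → EuclideanSpace ℝ (Fin d)) : Matrix (Fin n) (Fin n) ℝ :=
  Matrix.of fun i j => ntk (x i) (x j)

/-- The NTK regression function
`f_t(z) = K_d(z, X) K_d(X, X)⁻¹ (I - exp (-(t / n) K_d(X, X))) y`, i.e. the solution of the gradient
flow `d/dt f_t(z) = -(1 / n) K_d(z, X) (f_t(X) - y)` with `f_0 = 0`. -/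
def ntkRegression {n d : ℕ} (x : Fin n → EuclideanSpace ℝ (Fin d)) (y : Fin n → ℝ) (t : ℝ)
    (z : EuclideanSpace ℝ (Fin d)) : ℝ :=
  (fun i => ntk z (x i)) ⬝ᵥ
    (((ntkGram x)⁻¹ * (1 - NormedSpace.exp (-(t / (n : ℝ)) • ntkGram x))) *ᵥ y)

/-! ### Excess risk -/

/-- The excess risk `∫ (f - f⋆)^2 dμ` over the domain `𝒳`. -/
def excessRisk {d : ℕ} (𝒳 : Set (EuclideanSpace ℝ (Fin d)))
    (μ : Measure (EuclideanSpace ℝ (Fin d))) (fstar f : EuclideanSpace ℝ (Fin d) → ℝ) : ℝ :=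
  ∫ z in 𝒳, (f z - fstar z) ^ 2 ∂μ

/-- The population risk `E (f(z) - Y)^2` for `z ∼ μ` on `𝒳` and `Y = f⋆(z) + ε` with independent
noise `ε ∼ N(0, v)`. -/
def populationRisk {d : ℕ} (𝒳 : Set (EuclideanSpace ℝ (Fin d)))
    (μ : Measure (EuclideanSpace ℝ (Fin d))) (v : ℝ≥0)
    (fstar f : EuclideanSpace ℝ (Fin d) → ℝ) : ℝ :=
  ∫ p, (f p.1 - (fstar p.1 + p.2)) ^ 2 ∂((μ.restrict 𝒳).prod (gaussianReal 0 v))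

/-- The excess risk is the difference of the population risks of `f` and `f⋆`. -/
theorem excessRisk_eq_populationRisk_sub {d : ℕ} {𝒳 : Set (EuclideanSpace ℝ (Fin d))}
    (h𝒳 : IsCompact 𝒳) (μ : Measure (EuclideanSpace ℝ (Fin d))) [IsFiniteMeasure μ] (v : ℝ≥0)
    {fstar f : EuclideanSpace ℝ (Fin d) → ℝ} (hfstar : ContinuousOn fstar 𝒳)
    (hf : ContinuousOn f 𝒳) :
    excessRisk 𝒳 μ fstar f
      = populationRisk 𝒳 μ v fstar f - populationRisk 𝒳 μ v fstar fstar := by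
  have hmeas : MeasurableSet 𝒳 := h𝒳.measurableSet
  have hg : ContinuousOn (fun z => f z - fstar z) 𝒳 := hf.sub hfstar
  have hg1 : Integrable (fun z => f z - fstar z) (μ.restrict 𝒳) :=
    hg.integrableOn_compact h𝒳
  have hg2 : Integrable (fun z => (f z - fstar z) ^ 2) (μ.restrict 𝒳) :=
    (hg.pow 2).integrableOn_compact h𝒳
  have he1 : Integrable (fun e : ℝ => e) (gaussianReal 0 v) :=
    (memLp_id_gaussianReal 1).integrable le_rfl
  have he2 : Integrable (fun e : ℝ => e ^ 2) (gaussianReal 0 v) :=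
    (memLp_id_gaussianReal 2).integrable_sq
  have hA : Integrable (fun p : EuclideanSpace ℝ (Fin d) × ℝ => (f p.1 - fstar p.1) ^ 2)
      ((μ.restrict 𝒳).prod (gaussianReal 0 v)) := hg2.comp_fst _
  have hB : Integrable (fun p : EuclideanSpace ℝ (Fin d) × ℝ => (f p.1 - fstar p.1) * p.2)
      ((μ.restrict 𝒳).prod (gaussianReal 0 v)) := hg1.mul_prod he1
  have hC : Integrable (fun p : EuclideanSpace ℝ (Fin d) × ℝ => p.2 ^ 2)
      ((μ.restrict 𝒳).prod (gaussianReal 0 v)) := he2.comp_snd _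
  have h1 : populationRisk 𝒳 μ v fstar f
      = ∫ p : EuclideanSpace ℝ (Fin d) × ℝ, ((f p.1 - fstar p.1) ^ 2
          - 2 * ((f p.1 - fstar p.1) * p.2) + p.2 ^ 2)
        ∂((μ.restrict 𝒳).prod (gaussianReal 0 v)) := by
    unfold populationRisk
    congr 1
    ext p
    ring
  have h2 : populationRisk 𝒳 μ v fstar fstar
      = ∫ p : EuclideanSpace ℝ (Fin d) × ℝ, p.2 ^ 2
        ∂((μ.restrict 𝒳).prod (gaussianReal 0 v)) := by
    unfold populationRisk
    congr 1
    ext p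
    ring
  have hAB : Integrable (fun p : EuclideanSpace ℝ (Fin d) × ℝ => (f p.1 - fstar p.1) ^ 2
      - 2 * ((f p.1 - fstar p.1) * p.2)) ((μ.restrict 𝒳).prod (gaussianReal 0 v)) :=
    hA.sub (hB.const_mul 2)
  rw [h1, h2, integral_add hAB hC, integral_sub hA (hB.const_mul 2),
    integral_const_mul, integral_prod_mul (fun z => f z - fstar z) (fun e : ℝ => e),
    integral_id_gaussianReal, integral_fun_fst (fun z => (f z - fstar z) ^ 2)]
  simp [excessRisk]

end

open MeasureTheory ProbabilityTheory Filter Topology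
open scoped NNReal ENNReal Matrix

/-! ### Calculus along absolutely continuous curves -/

namespace AbsolutelyContinuousOnInterval

/-! Write r_j for the residual f(x_j) - y_j. Along a gradient flow the value of the network at any
point z satisfies d/dt f(z) = -(1/n) ∑_j H_t(z, x_j) r_j, where H_t is the inner product of the
parameter gradients of f. The antisymmetric initialization makes f vanish at time 0, so with the
kernel K_d in place of H_t the flow would be exactly kernel regression. The point is that H_t stays
close to K_d for all times.

At initialization H_0 is essentially an average of m independent neuron kernels with mean K_d, by
Gaussian integrals in the plane (`integral_neuronKernel`). If every neuron moves by at most β times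
its own size, its contribution to H changes by O(β), except when its initial pre-activation at one
of the two points is itself of order β, so that the ReLU derivative may flip (`abs_neuron_sub_le`).
As β tends to 0 such neurons become negligible, because a pre-activation vanishes with probability
zero. Hence the error tends to 0 in mean square at each point. Uniformity in z is not needed: the
squared error is integrated against μ plus a unit mass at every sample point, and Markov's
inequality gives an event of high probability (`tendsto_initLaw_totalKernelError`).

The parameters move little by a bootstrap. The Gram matrix of K_d is positive definite, because
ridge functions of distinct points are linearly independent (`exists_ntk_coercive`). While the time
integral of ∑|r_j| stays within a fixed budget, a neuron moves by O(m^{-1/2}) relative to its size,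
so H is close to K_d on the sample, the residuals decay exponentially, and the integral is in fact
smaller than the budget by 1. By continuity the budget is never reached
(`IsGradientFlow.integral_fitError_le`). The same decay makes all later errors uniform in time.

At a test point z let α = K_d(z, X) K_d(X, X)⁻¹. In the derivative of f(z) - ∑_j α_j r_j the limit
kernel cancels and only kernel errors remain, while r stays close to the residual of kernel
regression. So |f_t(z) - f^NTK_t(z)| is at most c₁ √(T(z)) + c₂ with T the squared kernel error at
z, and integration compares the risks (`abs_excessRisk_sub_le`).

Two points concern nonsmoothness. The chain rule holds at almost every time for every choice of the
ReLU derivative at a kink, because the pre-activation is stationary there whenever both functions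
are differentiable (`hasDerivAt_relu_comp`). Flows exist as limits of Euler polygons, which stay
bounded on bounded time intervals by Euler's identity for the partially homogeneous network
(`exists_isGradientFlow`). -/

theorem of_dist_le {X Y : Type*} [PseudoMetricSpace X] [PseudoMetricSpace Y] {f : ℝ → X} {g : ℝ → Y}
    {a b : ℝ} (C : ℝ) (hf : AbsolutelyContinuousOnInterval f a b)
    (h : ∀ s ∈ Set.uIcc a b, ∀ t ∈ Set.uIcc a b, dist (g s) (g t) ≤ C * dist (f s) (f t)) :
    AbsolutelyContinuousOnInterval g a b := by
  have h0 := Tendsto.const_mul C hf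
  rw [mul_zero] at h0
  refine tendsto_of_tendsto_of_tendsto_of_le_of_le' tendsto_const_nhds h0 ?_ ?_
  · exact Eventually.of_forall fun E => Finset.sum_nonneg fun _ _ => dist_nonneg
  · have hmem : ∀ᶠ E in totalLengthFilter ⊓ 𝓟 (disjWithin a b), E ∈ disjWithin a b :=
      mem_inf_of_right (mem_principal_self _)
    filter_upwards [hmem] with E hE
    rw [Finset.mul_sum]
    exact Finset.sum_le_sum fun i hi => h _ (hE.1 i hi).1 _ (hE.1 i hi).2

theorem of_lipschitz_comp {X Y : Type*} [PseudoMetricSpace X] [PseudoMetricSpace Y] {f : ℝ → X}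
    {φ : X → Y} {K : ℝ≥0} {a b : ℝ} (hf : AbsolutelyContinuousOnInterval f a b)
    (hφ : LipschitzWith K φ) : AbsolutelyContinuousOnInterval (fun t => φ (f t)) a b :=
  hf.of_dist_le K fun _ _ _ _ => hφ.dist_le_mul _ _

theorem const {X : Type*} [PseudoMetricSpace X] (c : X) (a b : ℝ) :
    AbsolutelyContinuousOnInterval (fun _ => c) a b :=
  ((LipschitzWith.const (α := ℝ) c).lipschitzOnWith (s := Set.uIcc a b)).absolutelyContinuousOnInterval

theorem finset_sum {ι : Type*} (S : Finset ι) {f : ι → ℝ → ℝ} {a b : ℝ}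
    (h : ∀ i ∈ S, AbsolutelyContinuousOnInterval (f i) a b) :
    AbsolutelyContinuousOnInterval (fun t => ∑ i ∈ S, f i t) a b := by
  classical
  induction S using Finset.induction_on with
  | empty => simpa using const (0 : ℝ) a b
  | insert i S hi ih =>
    simp only [Finset.sum_insert hi]
    exact (h i (Finset.mem_insert_self i S)).fun_add
      (ih fun j hj => h j (Finset.mem_insert_of_mem hj))

/-- An absolutely continuous function is the integral of its almost everywhere derivative. This is
the form in which every differential inequality below is integrated, as a flow is differentiable
only at almost every time. -/
theorem sub_le_integral {f g : ℝ → ℝ} {a b : ℝ} (hab : a ≤ b)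
    (hf : AbsolutelyContinuousOnInterval f a b) (hg : ContinuousOn g (Set.Icc a b))
    (h : ∀ᵐ t, t ∈ Set.Icc a b → ∃ f', HasDerivAt f f' t ∧ f' ≤ g t) :
    f b - f a ≤ ∫ t in a..b, g t := by
  rw [← hf.integral_deriv_eq_sub]
  refine intervalIntegral.integral_mono_ae_restrict hab hf.intervalIntegrable_deriv
    (hg.intervalIntegrable_of_Icc hab) ?_
  rw [EventuallyLE, ae_restrict_iff' measurableSet_Icc]
  filter_upwards [h] with t ht htm
  obtain ⟨f', hf', hle⟩ := ht htm
  rwa [hf'.deriv]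

theorem abs_sub_le_integral {f g : ℝ → ℝ} {a b : ℝ} (hab : a ≤ b)
    (hf : AbsolutelyContinuousOnInterval f a b) (hg : ContinuousOn g (Set.Icc a b))
    (h : ∀ᵐ t, t ∈ Set.Icc a b → ∃ f', HasDerivAt f f' t ∧ |f'| ≤ g t) :
    |f b - f a| ≤ ∫ t in a..b, g t := by
  rw [abs_le]
  constructor
  · have := hf.fun_neg.sub_le_integral hab hg (by
      filter_upwards [h] with t ht htm
      obtain ⟨f', hf', hle⟩ := ht htm
      exact ⟨-f', hf'.neg, (neg_le_abs f').trans hle⟩)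
    linarith
  · exact hf.sub_le_integral hab hg (by
      filter_upwards [h] with t ht htm
      obtain ⟨f', hf', hle⟩ := ht htm
      exact ⟨f', hf', (le_abs_self f').trans hle⟩)

theorem le_of_deriv_nonpos {f : ℝ → ℝ} {a b : ℝ} (hab : a ≤ b)
    (hf : AbsolutelyContinuousOnInterval f a b)
    (h : ∀ᵐ t, t ∈ Set.Icc a b → ∃ f', HasDerivAt f f' t ∧ f' ≤ 0) : f b ≤ f a := by
  have := hf.sub_le_integral (g := fun _ => 0) hab continuousOn_const h
  simpa using this

end AbsolutelyContinuousOnInterval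

/-! ### ReLU and its chain rule at the kink -/

theorem lipschitzWith_relu : LipschitzWith 1 relu :=
  LipschitzWith.id.max_const 0

theorem relu_nonneg (z : ℝ) : 0 ≤ relu z := le_max_right _ _

theorem relu_le_abs (z : ℝ) : relu z ≤ |z| := max_le (le_abs_self z) (abs_nonneg z)

theorem mul_eq_relu_of_mem_reluSubdiff {z s : ℝ} (hs : s ∈ reluSubdiff z) : s * z = relu z := by
  obtain ⟨_, _, h1, h2⟩ := hs
  rcases lt_trichotomy z 0 with h | h | h
  · rw [h1 h, relu, max_eq_right h.le, zero_mul]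
  · simp [h, relu]
  · rw [h2 h, relu, max_eq_left h.le, one_mul]

/-- At a point where the composition of ReLU with a differentiable function is differentiable, the
chain rule holds for every element of the subdifferential of ReLU. -/
theorem hasDerivAt_relu_comp {p : ℝ → ℝ} {p' s t : ℝ} (hp : HasDerivAt p p' t)
    (hd : DifferentiableAt ℝ (fun τ => relu (p τ)) t) (hs : s ∈ reluSubdiff (p t)) :
    HasDerivAt (fun τ => relu (p τ)) (s * p') t := by
  -- If `p t = 0`, then both `relu ∘ p` and `relu ∘ p - p` are nonnegative and vanish at `t`. Both
  -- have a local minimum there, so both derivatives are zero and hence `p' = 0`; the value of `s`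
  -- is then irrelevant.
  by_cases h0 : p t = 0
  · have h1 : deriv (fun τ => relu (p τ)) t = 0 := by
      refine IsLocalMin.deriv_eq_zero (Eventually.of_forall fun τ => ?_)
      simp [h0, relu]
    have h2 : deriv (fun τ => relu (p τ)) t - p' = 0 := by
      rw [← (hd.hasDerivAt.sub hp).deriv]
      refine IsLocalMin.deriv_eq_zero (Eventually.of_forall fun τ => ?_)
      simp [h0, relu]
    have h3 : p' = 0 := by linarith
    have := hd.hasDerivAt
    rwa [h1, ← mul_zero s, ← h3] at this
  · exact (hasDerivAt_relu h0 hs).comp t hp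

/-! ### The network along an absolutely continuous curve of parameters -/

section NetworkAlongCurve

variable {M d : ℕ} {θ : ℝ → Params M d} {a b : ℝ}

theorem AbsolutelyContinuousOnInterval.outer (hθ : AbsolutelyContinuousOnInterval θ a b)
    (r : Fin M) : AbsolutelyContinuousOnInterval (fun t => (θ t).1 r) a b :=
  hθ.of_dist_le 1 fun s _ t _ => by
    rw [one_mul]
    exact (dist_le_pi_dist (θ s).1 (θ t).1 r).trans (le_max_left _ _)

theorem AbsolutelyContinuousOnInterval.hidden (hθ : AbsolutelyContinuousOnInterval θ a b) :
    AbsolutelyContinuousOnInterval (fun t => (θ t).2) a b :=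
  hθ.of_dist_le 1 fun s _ t _ => by
    rw [one_mul]
    exact le_max_right _ _

theorem AbsolutelyContinuousOnInterval.inner_weight (hθ : AbsolutelyContinuousOnInterval θ a b)
    (r : Fin M) (v : EuclideanSpace ℝ (Fin d)) :
    AbsolutelyContinuousOnInterval (fun t => inner ℝ ((θ t).2.1 r) v) a b := by
  have h1 : AbsolutelyContinuousOnInterval (fun t => (θ t).2.1 r) a b :=
    hθ.hidden.of_dist_le 1 fun s _ t _ => by
      rw [one_mul]
      exact (dist_le_pi_dist (θ s).2.1 (θ t).2.1 r).trans (le_max_left _ _)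
  refine h1.of_dist_le ‖v‖ fun s _ t _ => ?_
  rw [Real.dist_eq, ← inner_sub_left, mul_comm, dist_eq_norm]
  exact abs_real_inner_le_norm _ _

theorem AbsolutelyContinuousOnInterval.biases (hθ : AbsolutelyContinuousOnInterval θ a b) :
    AbsolutelyContinuousOnInterval (fun t => (θ t).2.2) a b :=
  hθ.hidden.of_dist_le 1 fun s _ t _ => by
    rw [one_mul]
    exact le_max_right _ _

theorem AbsolutelyContinuousOnInterval.bias (hθ : AbsolutelyContinuousOnInterval θ a b)
    (r : Fin M) : AbsolutelyContinuousOnInterval (fun t => (θ t).2.2.1 r) a b :=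
  hθ.biases.of_dist_le 1 fun s _ t _ => by
    rw [one_mul]
    exact (dist_le_pi_dist (θ s).2.2.1 (θ t).2.2.1 r).trans (le_max_left _ _)

theorem AbsolutelyContinuousOnInterval.outerBias (hθ : AbsolutelyContinuousOnInterval θ a b) :
    AbsolutelyContinuousOnInterval (fun t => (θ t).2.2.2) a b :=
  hθ.biases.of_dist_le 1 fun s _ t _ => by
    rw [one_mul]
    exact le_max_right _ _

theorem AbsolutelyContinuousOnInterval.preact (hθ : AbsolutelyContinuousOnInterval θ a b)
    (r : Fin M) (z : EuclideanSpace ℝ (Fin d)) :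
    AbsolutelyContinuousOnInterval (fun t => preact (θ t) r z) a b :=
  (hθ.inner_weight r z).fun_add (hθ.bias r)

theorem AbsolutelyContinuousOnInterval.relu_preact (hθ : AbsolutelyContinuousOnInterval θ a b)
    (r : Fin M) (z : EuclideanSpace ℝ (Fin d)) :
    AbsolutelyContinuousOnInterval (fun t => relu (_root_.preact (θ t) r z)) a b :=
  (hθ.preact r z).of_lipschitz_comp lipschitzWith_relu

theorem AbsolutelyContinuousOnInterval.network (hθ : AbsolutelyContinuousOnInterval θ a b)
    (z : EuclideanSpace ℝ (Fin d)) :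
    AbsolutelyContinuousOnInterval (fun t => network (θ t) z) a b :=
  ((finset_sum Finset.univ fun r _ => (hθ.outer r).fun_mul (hθ.relu_preact r z)).const_mul
    √(2 / (M : ℝ))).fun_add hθ.outerBias

variable {η : Params M d} {t : ℝ}

theorem hasDerivAt_outer (h : HasDerivAt θ η t) (r : Fin M) :
    HasDerivAt (fun t => (θ t).1 r) (η.1 r) t :=
  (((ContinuousLinearMap.proj (R := ℝ) (φ := fun _ : Fin M => ℝ) r).comp
    (ContinuousLinearMap.fst ℝ (Fin M → ℝ)
      ((Fin M → EuclideanSpace ℝ (Fin d)) × (Fin M → ℝ) × ℝ))).hasFDerivAt.comp_hasDerivAt t h :)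

theorem hasDerivAt_snd (h : HasDerivAt θ η t) : HasDerivAt (fun t => (θ t).2) η.2 t :=
  ((ContinuousLinearMap.snd ℝ (Fin M → ℝ)
      ((Fin M → EuclideanSpace ℝ (Fin d)) × (Fin M → ℝ) × ℝ)).hasFDerivAt.comp_hasDerivAt t h :)

theorem hasDerivAt_snd_snd (h : HasDerivAt θ η t) : HasDerivAt (fun t => (θ t).2.2) η.2.2 t :=
  ((ContinuousLinearMap.snd ℝ (Fin M → EuclideanSpace ℝ (Fin d))
    ((Fin M → ℝ) × ℝ)).hasFDerivAt.comp_hasDerivAt t (hasDerivAt_snd h) :)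

theorem hasDerivAt_weight (h : HasDerivAt θ η t) (r : Fin M) :
    HasDerivAt (fun t => (θ t).2.1 r) (η.2.1 r) t :=
  (((ContinuousLinearMap.proj (R := ℝ) (φ := fun _ : Fin M => EuclideanSpace ℝ (Fin d)) r).comp
    (ContinuousLinearMap.fst ℝ (Fin M → EuclideanSpace ℝ (Fin d))
      ((Fin M → ℝ) × ℝ))).hasFDerivAt.comp_hasDerivAt t (hasDerivAt_snd h) :)

theorem hasDerivAt_bias (h : HasDerivAt θ η t) (r : Fin M) :
    HasDerivAt (fun t => (θ t).2.2.1 r) (η.2.2.1 r) t :=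
  (((ContinuousLinearMap.proj (R := ℝ) (φ := fun _ : Fin M => ℝ) r).comp
    (ContinuousLinearMap.fst ℝ (Fin M → ℝ) ℝ)).hasFDerivAt.comp_hasDerivAt t
      (hasDerivAt_snd_snd h) :)

theorem hasDerivAt_outerBias (h : HasDerivAt θ η t) :
    HasDerivAt (fun t => (θ t).2.2.2) η.2.2.2 t :=
  ((ContinuousLinearMap.snd ℝ (Fin M → ℝ) ℝ).hasFDerivAt.comp_hasDerivAt t
    (hasDerivAt_snd_snd h) :)

theorem hasDerivAt_inner_weight (h : HasDerivAt θ η t) (r : Fin M)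
    (v : EuclideanSpace ℝ (Fin d)) :
    HasDerivAt (fun t => inner ℝ ((θ t).2.1 r) v) (inner ℝ (η.2.1 r) v) t := by
  simpa using (hasDerivAt_weight h r).inner ℝ (hasDerivAt_const t v)

theorem hasDerivAt_preact (h : HasDerivAt θ η t) (r : Fin M) (z : EuclideanSpace ℝ (Fin d)) :
    HasDerivAt (fun t => preact (θ t) r z) (preact η r z) t :=
  (hasDerivAt_inner_weight h r z).add (hasDerivAt_bias h r)

/-- Chain rule for the network function along an absolutely continuous curve of parameters: at
almost every time it holds for all choices of the derivative of ReLU at its kinks. -/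
theorem ae_hasDerivAt_network (hθ : AbsolutelyContinuousOnInterval θ a b)
    (z : EuclideanSpace ℝ (Fin d)) :
    ∀ᵐ t, t ∈ Set.uIcc a b → ∀ η, HasDerivAt θ η t → ∀ s : Fin M → ℝ,
      (∀ r, s r ∈ reluSubdiff (preact (θ t) r z)) →
      HasDerivAt (fun τ => network (θ τ) z) (paramInner (networkGradient (θ t) z s) η) t := by
  have hae : ∀ᵐ t, ∀ r : Fin M, t ∈ Set.uIcc a b →
      DifferentiableAt ℝ (fun τ => relu (preact (θ τ) r z)) t :=
    ae_all_iff.2 fun r => (hθ.relu_preact r z).ae_differentiableAt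
  filter_upwards [hae] with t ht htm η hη s hs
  have hsum := ((HasDerivAt.fun_sum (u := Finset.univ) fun r _ => (hasDerivAt_outer hη r).mul
    (hasDerivAt_relu_comp (hasDerivAt_preact hη r z) (ht r htm) (hs r))).const_mul √(2 / (M : ℝ))).add
    (hasDerivAt_outerBias hη)
  refine hsum.congr_deriv ?_
  simp only [paramInner, networkGradient, _root_.preact, inner_smul_left,
    Finset.mul_sum, ← Finset.sum_add_distrib, one_mul, RCLike.conj_to_real]
  congr 1
  refine Finset.sum_congr rfl fun r _ => ?_
  rw [real_inner_comm (η.2.1 r) z]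
  ring

end NetworkAlongCurve

/-! ### Existence of solutions of differential inclusions -/

section Inclusion

variable {E : Type*} [NormedAddCommGroup E] [NormedSpace ℝ E]

theorem euler_sub_eq_sum {e v : ℕ → E} {c : ℝ} (hstep : ∀ j, e (j + 1) = e j + c • v j)
    {i j : ℕ} (hij : i ≤ j) : e j - e i = c • ∑ l ∈ Finset.Ico i j, v l := by
  induction j, hij using Nat.le_induction with
  | base => simp
  | succ j hij ih =>
    rw [Finset.sum_Ico_succ_top hij, smul_add, ← ih, hstep]
    abel

theorem euler_norm_sub_le {e v : ℕ → E} {c B : ℝ} (hc : 0 ≤ c)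
    (hstep : ∀ j, e (j + 1) = e j + c • v j) {i j : ℕ} (hij : i ≤ j)
    (hv : ∀ l < j, ‖v l‖ ≤ B) : ‖e j - e i‖ ≤ B * (c * ((j : ℝ) - i)) := by
  rw [euler_sub_eq_sum hstep hij, norm_smul, Real.norm_of_nonneg hc]
  have h : ‖∑ l ∈ Finset.Ico i j, v l‖ ≤ (Finset.Ico i j).card • B :=
    (norm_sum_le_of_le _ fun l hl => hv l (Finset.mem_Ico.1 hl).2).trans_eq (Finset.sum_const B)
  rw [Nat.card_Ico, nsmul_eq_mul, Nat.cast_sub hij] at h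
  calc c * ‖∑ l ∈ Finset.Ico i j, v l‖ ≤ c * (((j : ℝ) - i) * B) := by gcongr
    _ = _ := by ring

/-- If Euler polygons with step sizes `1 / (k + 1)` stay bounded on bounded time intervals, then a
solution of the differential inclusion exists. -/
theorem exists_solution_of_euler [FiniteDimensional ℝ E] (F : E → Set E)
    (hconv : ∀ p, Convex ℝ (F p)) (hclosed : ∀ p, IsClosed (F p))
    (husc : ∀ p, ∀ ε : ℝ, 0 < ε → ∀ᶠ q in 𝓝 p, F q ⊆ Metric.cthickening ε (F p))
    (p₀ : E) (e v : ℕ → ℕ → E) (h0 : ∀ k, e k 0 = p₀)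
    (hstep : ∀ k j, e k (j + 1) = e k j + (1 / ((k : ℝ) + 1)) • v k j)
    (hbdd : ∀ T : ℕ, ∃ B : ℝ, ∀ᶠ k : ℕ in atTop, ∀ j : ℕ, j ≤ T * (k + 1) →
      ‖e k j‖ ≤ B ∧ ‖v k j‖ ≤ B ∧ v k j ∈ F (e k j)) :
    ∃ θ : ℝ → E, θ 0 = p₀ ∧ (∀ T : ℝ, 0 ≤ T → AbsolutelyContinuousOnInterval θ 0 T) ∧
      ∀ᵐ t ∂(volume.restrict (Set.Ici (0 : ℝ))), ∃ w ∈ F (θ t), HasDerivAt θ w t := by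
  have : ProperSpace E := FiniteDimensional.proper ℝ E
  -- Limits along a nonprincipal ultrafilter replace the extraction of a convergent subsequence:
  -- bounded sequences converge along it at all times simultaneously.
  set U : Ultrafilter ℕ := hyperfilter ℕ
  have hU : (U : Filter ℕ) ≤ atTop := by
    rw [← Nat.cofinite_eq_atTop]; exact hyperfilter_le_cofinite
  -- The number of Euler steps of size 1/(k+1) completed by time `t`.
  let J : ℕ → ℝ → ℕ := fun k t => ⌊t * ((k : ℝ) + 1)⌋₊
  have hk : ∀ k : ℕ, (0 : ℝ) < (k : ℝ) + 1 := fun k => by positivity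
  have hJle : ∀ (T : ℕ) (t : ℝ), t ≤ T → ∀ k, J k t ≤ T * (k + 1) := by
    intro T t ht k
    refine Nat.floor_le_of_le ?_
    push_cast
    exact mul_le_mul_of_nonneg_right ht (hk k).le
  have hJmono : ∀ k, Monotone (J k) := fun k s t hst =>
    Nat.floor_mono (mul_le_mul_of_nonneg_right hst (hk k).le)
  have hJlim : ∀ t : ℝ, 0 ≤ t →
      Tendsto (fun k : ℕ => 1 / ((k : ℝ) + 1) * (J k t : ℝ)) atTop (𝓝 t) := by
    intro t ht
    have h1 : Tendsto (fun k : ℕ => (k : ℝ) + 1) atTop atTop :=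
      tendsto_atTop_add_const_right _ _ tendsto_natCast_atTop_atTop
    refine ((tendsto_nat_floor_mul_div_atTop ht).comp h1).congr fun k => ?_
    simp [J, div_eq_inv_mul]
  -- the pointwise limit of the piecewise constant curves
  have hlim : ∀ t : ℝ, ∃ p : E, Tendsto (fun k => e k (J k t)) U (𝓝 p) := by
    intro t
    obtain ⟨B, hB⟩ := hbdd ⌈t⌉₊
    have hmem : Metric.closedBall (0 : E) B ∈ U.map (fun k => e k (J k t)) := by
      rw [Ultrafilter.mem_map]
      filter_upwards [hU hB] with k hk'
      simpa using (hk' (J k t) (hJle _ t (Nat.le_ceil t) k)).1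
    obtain ⟨p, -, hp⟩ := (isCompact_closedBall (0 : E) B).ultrafilter_le_nhds _
      (le_principal_iff.2 hmem)
    exact ⟨p, hp⟩
  choose θ hθ using hlim
  have hinc : ∀ s t : ℝ, 0 ≤ s → 0 ≤ t →
      Tendsto (fun k : ℕ => 1 / ((k : ℝ) + 1) * ((J k t : ℝ) - J k s)) U (𝓝 (t - s)) := by
    intro s t hs ht
    refine (((hJlim t ht).sub (hJlim s hs)).mono_left hU).congr fun k => ?_
    ring
  have hlip : ∀ (T : ℕ) (B : ℝ), (∀ᶠ k : ℕ in atTop, ∀ j : ℕ, j ≤ T * (k + 1) →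
      ‖e k j‖ ≤ B ∧ ‖v k j‖ ≤ B ∧ v k j ∈ F (e k j)) →
      ∀ s t : ℝ, 0 ≤ s → s ≤ t → t ≤ T → ‖θ t - θ s‖ ≤ B * (t - s) := by
    intro T B hB s t hs hst htT
    refine le_of_tendsto_of_tendsto ((hθ t).sub (hθ s)).norm
      ((hinc s t hs (hs.trans hst)).const_mul B) ?_
    filter_upwards [hU hB] with k hk'
    exact euler_norm_sub_le (one_div_nonneg.2 (hk k).le) (hstep k) (hJmono k hst)
      fun l hl => (hk' l (hl.le.trans (hJle T t htT k))).2.1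
  have hac : ∀ T : ℝ, 0 ≤ T → AbsolutelyContinuousOnInterval θ 0 T := by
    intro T hT
    obtain ⟨B, hB⟩ := hbdd ⌈T⌉₊
    have hL := hlip _ B hB
    refine LipschitzOnWith.absolutelyContinuousOnInterval (K := B.toNNReal) ?_
    rw [Set.uIcc_of_le hT]
    have key : ∀ s ∈ Set.Icc 0 T, ∀ t ∈ Set.Icc 0 T, s ≤ t →
        dist (θ s) (θ t) ≤ B.toNNReal * dist s t := by
      intro s hs t ht hst
      rw [dist_comm, dist_eq_norm, Real.dist_eq, abs_sub_comm, abs_of_nonneg (sub_nonneg.2 hst)]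
      exact (hL s t hs.1 hst (ht.2.trans (Nat.le_ceil T))).trans
        (mul_le_mul_of_nonneg_right (Real.le_coe_toNNReal B) (sub_nonneg.2 hst))
    refine LipschitzOnWith.of_dist_le_mul fun s hs t ht => ?_
    rcases le_total s t with hst | hst
    · exact key s hs t ht hst
    · rw [dist_comm, dist_comm s]; exact key t ht s hs hst
  refine ⟨θ, ?_, hac, ?_⟩
  · refine tendsto_nhds_unique (hθ 0) ?_
    simp [J, h0]
  have hdiff : ∀ᵐ t, ∀ T : ℕ, t ∈ Set.uIcc 0 (T : ℝ) → DifferentiableAt ℝ θ t :=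
    ae_all_iff.2 fun T => (hac T T.cast_nonneg).boundedVariationOn.ae_differentiableAt_of_mem_uIcc
  rw [ae_restrict_iff' measurableSet_Ici]
  filter_upwards [hdiff] with t ht (ht0 : 0 ≤ t)
  have hdt : DifferentiableAt ℝ θ t := ht ⌈t⌉₊ (by
    rw [Set.uIcc_of_le (Nat.cast_nonneg _)]; exact ⟨ht0, Nat.le_ceil t⟩)
  refine ⟨deriv θ t, ?_, hdt.hasDerivAt⟩
  -- It suffices that the derivative lies in every closed thickening of `F (θ t)`. Such a thickening
  -- is closed and convex, so it passes to limits of averages of velocities.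
  rw [← (hclosed (θ t)).closure_eq, Metric.closure_eq_iInter_cthickening]
  simp only [Set.mem_iInter]
  intro ε hε
  obtain ⟨B, hB⟩ := hbdd (⌈t⌉₊ + 1)
  obtain ⟨δ, hδ, hδF⟩ := Metric.eventually_nhds_iff.1 (husc (θ t) ε hε)
  have hClosed : IsClosed (Metric.cthickening ε (F (θ t))) := Metric.isClosed_cthickening
  have hConv : Convex ℝ (Metric.cthickening ε (F (θ t))) := (hconv (θ t)).cthickening ε
  refine hClosed.mem_of_tendsto hdt.hasDerivAt.tendsto_slope_zero_right ?_
  have hsmall : Tendsto (fun h : ℝ => B * h) (𝓝[>] 0) (𝓝 0) := by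
    have : Tendsto (fun h : ℝ => B * h) (𝓝 0) (𝓝 (B * 0)) := tendsto_id.const_mul B
    rw [mul_zero] at this
    exact this.mono_left nhdsWithin_le_nhds
  have h1 : ∀ᶠ h : ℝ in 𝓝[>] 0, h < 1 := mem_nhdsWithin_of_mem_nhds (gt_mem_nhds one_pos)
  filter_upwards [hsmall.eventually_lt_const (half_pos hδ), h1, self_mem_nhdsWithin]
    with h hh h1 (hpos : 0 < h)
  have hinch := hinc t (t + h) ht0 (by linarith)
  rw [add_sub_cancel_left] at hinch
  have hthT : t + h ≤ ((⌈t⌉₊ + 1 : ℕ) : ℝ) := by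
    push_cast; linarith [Nat.le_ceil t]
  -- For fixed `h` the difference quotient of `θ` is the ultrafilter limit of those of the polygons.
  -- Each of these is the mean of the velocities used between `t` and `t + h`, at points within `δ`
  -- of `θ t`.
  refine hClosed.mem_of_tendsto ((hinch.inv₀ hpos.ne').smul ((hθ (t + h)).sub (hθ t))) ?_
  have hnear : ∀ᶠ k in (U : Filter ℕ), dist (e k (J k t)) (θ t) < δ / 2 :=
    (hθ t).eventually (Metric.ball_mem_nhds _ (half_pos hδ))
  filter_upwards [hU hB, hnear, hinch.eventually_const_lt hpos,
    (hinch.const_mul B).eventually_lt_const hh] with k hkB hkn hkpos hkB2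
  have hJ : J k t ≤ J k (t + h) := hJmono k (by linarith)
  rw [euler_sub_eq_sum (hstep k) hJ, smul_smul, mul_inv, mul_right_comm,
    inv_mul_cancel₀ (one_div_pos.2 (hk k)).ne', one_mul, Finset.smul_sum]
  have hcard : ((J k (t + h) : ℝ) - J k t) = ((Finset.Ico (J k t) (J k (t + h))).card : ℝ) := by
    rw [Nat.card_Ico, Nat.cast_sub hJ]
  have hNpos : 0 < ((J k (t + h) : ℝ) - J k t) := pos_of_mul_pos_right hkpos
    (one_div_nonneg.2 (hk k).le)
  refine hConv.sum_mem (fun _ _ => (inv_pos.2 hNpos).le) ?_ ?_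
  · rw [Finset.sum_const, nsmul_eq_mul, ← hcard, mul_inv_cancel₀ hNpos.ne']
  · intro l hl
    obtain ⟨hl1, hl2⟩ := Finset.mem_Ico.1 hl
    have hlT := hl2.le.trans (hJle _ _ hthT k)
    refine hδF ?_ (hkB l hlT).2.2
    have hB0 : 0 ≤ B := (norm_nonneg _).trans (hkB l hlT).1
    have h3 : ‖e k l - e k (J k t)‖ ≤ B * (1 / ((k : ℝ) + 1) * ((l : ℝ) - J k t)) :=
      euler_norm_sub_le (one_div_nonneg.2 (hk k).le) (hstep k) hl1
        fun i hi => (hkB i (hi.le.trans hlT)).2.1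
    have h4 : B * (1 / ((k : ℝ) + 1) * ((l : ℝ) - J k t))
        ≤ B * (1 / ((k : ℝ) + 1) * ((J k (t + h) : ℝ) - J k t)) := by
      have : (l : ℝ) ≤ J k (t + h) := by exact_mod_cast hl2.le
      have := (hk k).le
      gcongr
    calc dist (e k l) (θ t) ≤ dist (e k l) (e k (J k t)) + dist (e k (J k t)) (θ t) :=
          dist_triangle _ _ _
      _ < δ / 2 + δ / 2 := by
          rw [dist_eq_norm (e k l)]
          exact add_lt_add (h3.trans_lt (h4.trans_lt hkB2)) hkn
      _ = δ := add_halves δ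

end Inclusion

/-! ### Existence of gradient flows -/

section Existence

variable {n M d : ℕ}

theorem convex_reluSubdiff (z : ℝ) : Convex ℝ (reluSubdiff z) := by
  intro s hs t ht a b ha hb hab
  obtain ⟨s0, s1, s2, s3⟩ := hs
  obtain ⟨t0, t1, t2, t3⟩ := ht
  simp only [smul_eq_mul]
  refine ⟨by positivity, ?_, fun h => ?_, fun h => ?_⟩
  · calc a * s + b * t ≤ a * 1 + b * 1 := by gcongr
      _ = 1 := by linarith
  · rw [s2 h, t2 h]; ring
  · rw [s3 h, t3 h]; linarith

theorem reluSubdiff_subset_Icc (z : ℝ) : reluSubdiff z ⊆ Set.Icc 0 1 := fun _ hs => ⟨hs.1, hs.2.1⟩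

theorem isCompact_reluSubdiff (z : ℝ) : IsCompact (reluSubdiff z) := by
  rcases lt_trichotomy z 0 with h | h | h
  · have : reluSubdiff z = {0} := by
      ext s
      simp only [reluSubdiff, Set.mem_ofPred_eq, Set.mem_singleton_iff]
      constructor
      · exact fun hs => hs.2.2.1 h
      · rintro rfl
        exact ⟨le_rfl, zero_le_one, fun _ => rfl, fun h' => absurd h' h.le.not_gt⟩
    rw [this]; exact isCompact_singleton
  · have : reluSubdiff z = Set.Icc 0 1 := by
      ext s
      simp [reluSubdiff, h]
    rw [this]; exact isCompact_Icc
  · have : reluSubdiff z = {1} := by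
      ext s
      simp only [reluSubdiff, Set.mem_ofPred_eq, Set.mem_singleton_iff]
      constructor
      · exact fun hs => hs.2.2.2 h
      · rintro rfl
        exact ⟨zero_le_one, le_rfl, fun h' => absurd h' h.le.not_gt, fun _ => rfl⟩
    rw [this]; exact isCompact_singleton

theorem indicator_mem_reluSubdiff (z : ℝ) : (if 0 < z then 1 else 0 : ℝ) ∈ reluSubdiff z := by
  unfold reluSubdiff
  split_ifs with h
  · exact ⟨zero_le_one, le_rfl, fun h' => absurd h' h.le.not_gt, fun _ => rfl⟩
  · exact ⟨le_rfl, zero_le_one, fun _ => rfl, fun h' => absurd h' h⟩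

theorem continuous_preact (r : Fin M) (z : EuclideanSpace ℝ (Fin d)) :
    Continuous fun θ : Params M d => preact θ r z := by
  unfold preact
  fun_prop

theorem continuous_relu : Continuous relu := lipschitzWith_relu.continuous

/-- Away from the kink the sign persists nearby, and at the kink the subdifferential is all of [0,
1]. So semicontinuity is an honest inclusion here, without thickening. -/
theorem eventually_reluSubdiff_subset {X : Type*} [TopologicalSpace X] {p : X → ℝ}
    (hp : Continuous p) (x : X) : ∀ᶠ y in 𝓝 x, reluSubdiff (p y) ⊆ reluSubdiff (p x) := by
  rcases lt_trichotomy (p x) 0 with h | h | h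
  · filter_upwards [hp.continuousAt.eventually_lt_const h] with y hy s hs
    exact ⟨hs.1, hs.2.1, fun _ => hs.2.2.1 hy, fun h' => absurd h' h.le.not_gt⟩
  · refine Eventually.of_forall fun y s hs => ⟨hs.1, hs.2.1, fun h' => ?_, fun h' => ?_⟩
    · exact absurd h h'.ne
    · exact absurd h h'.ne'
  · filter_upwards [hp.continuousAt.eventually_const_lt h] with y hy s hs
    exact ⟨hs.1, hs.2.1, fun h' => absurd h' h.le.not_gt, fun _ => hs.2.2.2 hy⟩

theorem continuous_network (z : EuclideanSpace ℝ (Fin d)) :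
    Continuous fun θ : Params M d => network θ z := by
  unfold network
  have h := fun r : Fin M => continuous_relu.comp (continuous_preact (d := d) r z)
  simp only [Function.comp_def] at h
  fun_prop

theorem continuous_lossGradient (x : Fin n → EuclideanSpace ℝ (Fin d)) (y : Fin n → ℝ) :
    Continuous fun p : Params M d × (Fin n → Fin M → ℝ) => lossGradient x y p.1 p.2 := by
  have h1 : ∀ (r : Fin M) (z : EuclideanSpace ℝ (Fin d)),
      Continuous fun p : Params M d × (Fin n → Fin M → ℝ) => relu (preact p.1 r z) :=
    fun r z => (continuous_relu.comp (continuous_preact r z)).comp continuous_fst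
  have h2 : ∀ z, Continuous fun p : Params M d × (Fin n → Fin M → ℝ) => network p.1 z :=
    fun z => (continuous_network z).comp continuous_fst
  unfold lossGradient networkGradient
  fun_prop

/-- The set of all the values of the gradient of the empirical loss. -/
def lossGradientSet (x : Fin n → EuclideanSpace ℝ (Fin d)) (y : Fin n → ℝ) (θ : Params M d) :
    Set (Params M d) :=
  (fun s => -lossGradient x y θ s) ''
    Set.pi Set.univ fun i => Set.pi Set.univ fun r => reluSubdiff (preact θ r (x i))

/-- The gradient is affine, not linear, in the choice of ReLU derivatives: the outer weight and
outer bias components do not depend on it, whence `a + b = 1`. -/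
theorem lossGradient_convex_comb (x : Fin n → EuclideanSpace ℝ (Fin d)) (y : Fin n → ℝ)
    (θ : Params M d) (s t : Fin n → Fin M → ℝ) {a b : ℝ} (hab : a + b = 1) :
    lossGradient x y θ (a • s + b • t) = a • lossGradient x y θ s + b • lossGradient x y θ t := by
  have key : ∀ i, networkGradient θ (x i) ((a • s + b • t) i)
      = a • networkGradient θ (x i) (s i) + b • networkGradient θ (x i) (t i) := by
    intro i
    have hb : b = 1 - a := by linarith
    subst hb
    refine Prod.ext ?_ (Prod.ext ?_ (Prod.ext ?_ ?_))
    · funext r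
      simp only [networkGradient, Prod.fst_add, Prod.smul_fst, Pi.add_apply, Pi.smul_apply,
        smul_eq_mul]
      ring
    · funext r
      simp only [networkGradient, Prod.fst_add, Prod.snd_add, Prod.smul_fst, Prod.smul_snd,
        Pi.add_apply, Pi.smul_apply, smul_eq_mul, smul_smul, ← add_smul]
      congr 1
      ring
    · funext r
      simp only [networkGradient, Prod.fst_add, Prod.snd_add, Prod.smul_fst, Prod.smul_snd,
        Pi.add_apply, Pi.smul_apply, smul_eq_mul]
      ring
    · simp [networkGradient]
  simp only [lossGradient, key, smul_add, Finset.sum_add_distrib, Finset.smul_sum]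
  congr 1 <;>
  · refine Finset.sum_congr rfl fun i _ => ?_
    simp only [smul_smul]
    congr 1
    ring

theorem convex_lossGradientSet (x : Fin n → EuclideanSpace ℝ (Fin d)) (y : Fin n → ℝ)
    (θ : Params M d) : Convex ℝ (lossGradientSet x y θ) := by
  rintro _ ⟨s, hs, rfl⟩ _ ⟨t, ht, rfl⟩ a b ha hb hab
  refine ⟨a • s + b • t, ?_, ?_⟩
  · exact (convex_pi fun i _ => convex_pi fun r _ => convex_reluSubdiff _) hs ht ha hb hab
  · simp only [lossGradient_convex_comb x y θ s t hab, smul_neg, neg_add]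

theorem isCompact_lossGradientSet (x : Fin n → EuclideanSpace ℝ (Fin d)) (y : Fin n → ℝ)
    (θ : Params M d) : IsCompact (lossGradientSet x y θ) :=
  (isCompact_univ_pi fun _ => isCompact_univ_pi fun _ => isCompact_reluSubdiff _).image
    ((continuous_lossGradient x y).comp (Continuous.prodMk_right θ)).neg

theorem IsCompact.eventually_forall_dist_lt {X Y Z : Type*} [TopologicalSpace X]
    [TopologicalSpace Y] [PseudoMetricSpace Z] {K : Set Y} (hK : IsCompact K) {f : X → Y → Z}
    (hf : Continuous fun p : X × Y => f p.1 p.2) (x : X) {ε : ℝ} (hε : 0 < ε) :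
    ∀ᶠ x' in 𝓝 x, ∀ s ∈ K, dist (f x' s) (f x s) < ε := by
  refine hK.eventually_forall_of_forall_eventually fun s _ => ?_
  have hc : Continuous fun p : X × Y => dist (f p.1 p.2) (f x p.2) :=
    hf.dist (hf.comp (continuous_const.prodMk continuous_snd))
  refine hc.continuousAt.eventually_lt_const ?_
  simpa using hε

theorem isCompact_pi_Icc : IsCompact
    (Set.pi Set.univ fun _ : Fin n => Set.pi Set.univ fun _ : Fin M => Set.Icc (0 : ℝ) 1) :=
  isCompact_univ_pi fun _ => isCompact_univ_pi fun _ => isCompact_Icc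

/-- A choice of derivatives admissible at a nearby parameter is admissible at `θ` as well. Keeping
the choice and moving only the parameter changes the gradient by less than `ε`, uniformly over the
compact cube of choices. -/
theorem eventually_lossGradientSet_subset (x : Fin n → EuclideanSpace ℝ (Fin d)) (y : Fin n → ℝ)
    (θ : Params M d) {ε : ℝ} (hε : 0 < ε) :
    ∀ᶠ η in 𝓝 θ, lossGradientSet x y η ⊆ Metric.cthickening ε (lossGradientSet x y θ) := by
  have h1 : ∀ᶠ η in 𝓝 θ, ∀ (i : Fin n) (r : Fin M),
      reluSubdiff (preact η r (x i)) ⊆ reluSubdiff (preact θ r (x i)) :=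
    eventually_all.2 fun i => eventually_all.2 fun r =>
      eventually_reluSubdiff_subset (continuous_preact r (x i)) θ
  have h2 : ∀ᶠ η in 𝓝 θ, ∀ s ∈ Set.pi Set.univ fun _ : Fin n =>
      Set.pi Set.univ fun _ : Fin M => Set.Icc (0 : ℝ) 1,
      dist (lossGradient x y η s) (lossGradient x y θ s) < ε := by
    exact isCompact_pi_Icc.eventually_forall_dist_lt (continuous_lossGradient x y) θ hε
  filter_upwards [h1, h2] with η hη1 hη2
  rintro _ ⟨s, hs, rfl⟩
  refine Metric.mem_cthickening_of_dist_le _ (-lossGradient x y θ s) ε _ ⟨s, ?_, rfl⟩ ?_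
  · exact fun i _ r _ => hη1 i r (hs i trivial r trivial)
  · rw [dist_neg_neg]
    exact (hη2 s fun i _ r _ => reluSubdiff_subset_Icc _ (hs i trivial r trivial)).le

theorem paramInner_add_smul (θ η : Params M d) (c : ℝ) :
    paramInner (θ + c • η) (θ + c • η)
      = paramInner θ θ + 2 * c * paramInner θ η + c ^ 2 * paramInner η η := by
  have h : ∀ (u v : EuclideanSpace ℝ (Fin d)), inner ℝ (u + c • v) (u + c • v)
      = inner ℝ u u + 2 * c * inner ℝ u v + c ^ 2 * inner ℝ v v := by
    intro u v
    rw [inner_add_left, inner_add_right, inner_add_right, real_inner_smul_left,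
      real_inner_smul_left, real_inner_smul_right, real_inner_smul_right, real_inner_comm u v]
    ring
  simp only [paramInner, Prod.fst_add, Prod.snd_add, Prod.smul_fst, Prod.smul_snd,
    Pi.add_apply, Pi.smul_apply, smul_eq_mul, h, Finset.sum_add_distrib, Finset.mul_sum, mul_add]
  have e1 : ∑ r, (θ.1 r + c * η.1 r) * (θ.1 r + c * η.1 r) = ∑ r, θ.1 r * θ.1 r
      + ∑ r, 2 * c * (θ.1 r * η.1 r) + ∑ r, c ^ 2 * (η.1 r * η.1 r) := by
    simp only [← Finset.sum_add_distrib]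
    exact Finset.sum_congr rfl fun r _ => by ring
  have e2 : ∑ r, (θ.2.2.1 r + c * η.2.2.1 r) * (θ.2.2.1 r + c * η.2.2.1 r)
      = ∑ r, θ.2.2.1 r * θ.2.2.1 r
      + ∑ r, 2 * c * (θ.2.2.1 r * η.2.2.1 r) + ∑ r, c ^ 2 * (η.2.2.1 r * η.2.2.1 r) := by
    simp only [← Finset.sum_add_distrib]
    exact Finset.sum_congr rfl fun r _ => by ring
  simp only [mul_add, Finset.sum_add_distrib] at e1 e2 ⊢
  linarith

theorem paramInner_self_nonneg (θ : Params M d) : 0 ≤ paramInner θ θ := by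
  unfold paramInner
  have h1 : 0 ≤ ∑ r, θ.1 r * θ.1 r := Finset.sum_nonneg fun r _ => mul_self_nonneg _
  have h2 : 0 ≤ ∑ r, inner ℝ (θ.2.1 r) (θ.2.1 r) := Finset.sum_nonneg fun r _ =>
    real_inner_self_nonneg
  have h3 : 0 ≤ ∑ r, θ.2.2.1 r * θ.2.2.1 r := Finset.sum_nonneg fun r _ => mul_self_nonneg _
  have h4 := mul_self_nonneg θ.2.2.2
  linarith

/-- The product type carries the sup norm, whereas energy estimates are natural for the Euclidean
inner product; this turns the latter into boundedness. -/
theorem norm_sq_le_paramInner (θ : Params M d) : ‖θ‖ ^ 2 ≤ paramInner θ θ := by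
  have h1 : 0 ≤ ∑ r, θ.1 r * θ.1 r := Finset.sum_nonneg fun r _ => mul_self_nonneg _
  have h2 : 0 ≤ ∑ r, inner ℝ (θ.2.1 r) (θ.2.1 r) := Finset.sum_nonneg fun r _ =>
    real_inner_self_nonneg
  have h3 : 0 ≤ ∑ r, θ.2.2.1 r * θ.2.2.1 r := Finset.sum_nonneg fun r _ => mul_self_nonneg _
  have h4 := mul_self_nonneg θ.2.2.2
  have hle : ‖θ‖ ≤ √(paramInner θ θ) := by
    refine norm_prod_le_iff.2 ⟨?_, norm_prod_le_iff.2 ⟨?_, norm_prod_le_iff.2 ⟨?_, ?_⟩⟩⟩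
    · refine (pi_norm_le_iff_of_nonneg (Real.sqrt_nonneg _)).2 fun r => ?_
      refine Real.le_sqrt_of_sq_le ?_
      have := Finset.single_le_sum (f := fun r => θ.1 r * θ.1 r)
        (fun r _ => mul_self_nonneg _) (Finset.mem_univ r)
      rw [Real.norm_eq_abs, sq_abs, sq]
      unfold paramInner
      linarith
    · refine (pi_norm_le_iff_of_nonneg (Real.sqrt_nonneg _)).2 fun r => ?_
      refine Real.le_sqrt_of_sq_le ?_
      have := Finset.single_le_sum (f := fun r => inner ℝ (θ.2.1 r) (θ.2.1 r))
        (fun r _ => real_inner_self_nonneg) (Finset.mem_univ r)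
      rw [← real_inner_self_eq_norm_sq]
      unfold paramInner
      linarith
    · refine (pi_norm_le_iff_of_nonneg (Real.sqrt_nonneg _)).2 fun r => ?_
      refine Real.le_sqrt_of_sq_le ?_
      have := Finset.single_le_sum (f := fun r => θ.2.2.1 r * θ.2.2.1 r)
        (fun r _ => mul_self_nonneg _) (Finset.mem_univ r)
      rw [Real.norm_eq_abs, sq_abs, sq]
      unfold paramInner
      linarith
    · refine Real.le_sqrt_of_sq_le ?_
      rw [Real.norm_eq_abs, sq_abs, sq]
      unfold paramInner
      linarith
  calc ‖θ‖ ^ 2 ≤ √(paramInner θ θ) ^ 2 := by gcongr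
    _ = _ := Real.sq_sqrt (paramInner_self_nonneg θ)

theorem paramInner_zero_right (θ : Params M d) : paramInner θ 0 = 0 := by
  simp [paramInner]

theorem paramInner_add_right (θ η ζ : Params M d) :
    paramInner θ (η + ζ) = paramInner θ η + paramInner θ ζ := by
  simp only [paramInner, Prod.fst_add, Prod.snd_add, Pi.add_apply, mul_add, inner_add_right,
    Finset.sum_add_distrib]
  ring

theorem paramInner_smul_right (θ η : Params M d) (c : ℝ) :
    paramInner θ (c • η) = c * paramInner θ η := by
  simp only [paramInner, Prod.smul_fst, Prod.smul_snd, Pi.smul_apply, smul_eq_mul,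
    real_inner_smul_right, mul_add, Finset.mul_sum]
  simp only [mul_left_comm]

theorem paramInner_sum_right {ι : Type*} (S : Finset ι) (θ : Params M d) (η : ι → Params M d) :
    paramInner θ (∑ i ∈ S, η i) = ∑ i ∈ S, paramInner θ (η i) := by
  classical
  induction S using Finset.induction_on with
  | empty => simpa using paramInner_zero_right θ
  | insert i S hi ih => rw [Finset.sum_insert hi, Finset.sum_insert hi, paramInner_add_right, ih]

theorem paramInner_neg_lossGradient (x : Fin n → EuclideanSpace ℝ (Fin d)) (y : Fin n → ℝ)
    (θ ζ : Params M d) (s : Fin n → Fin M → ℝ) :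
    paramInner ζ (-lossGradient x y θ s) = -(1 / (n : ℝ)) * ∑ i, (network θ (x i) - y i) *
      paramInner ζ (networkGradient θ (x i) (s i)) := by
  rw [← neg_one_smul ℝ, paramInner_smul_right, lossGradient, paramInner_smul_right,
    paramInner_sum_right]
  simp only [paramInner_smul_right]
  ring

/-- Euler's identity for the partially homogeneous network function. -/
theorem paramInner_networkGradient_self (θ : Params M d) (z : EuclideanSpace ℝ (Fin d))
    {s : Fin M → ℝ} (hs : ∀ r, s r ∈ reluSubdiff (preact θ r z)) :
    paramInner θ (networkGradient θ z s) = 2 * network θ z - θ.2.2.2 := by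
  have h : ∀ r, inner ℝ (θ.2.1 r) ((√(2 / (M : ℝ)) * θ.1 r * s r) • z)
      + θ.2.2.1 r * (√(2 / (M : ℝ)) * θ.1 r * s r)
      = √(2 / (M : ℝ)) * (θ.1 r * relu (preact θ r z)) := by
    intro r
    rw [← mul_eq_relu_of_mem_reluSubdiff (hs r), real_inner_smul_right]
    unfold preact
    ring
  simp only [paramInner, networkGradient, network]
  rw [add_assoc (∑ r, θ.1 r * _), ← Finset.sum_add_distrib]
  simp only [h, ← Finset.mul_sum]
  have h2 : ∑ r, θ.1 r * (√(2 / (M : ℝ)) * relu (preact θ r z))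
      = √(2 / (M : ℝ)) * ∑ r, θ.1 r * relu (preact θ r z) := by
    rw [Finset.mul_sum]
    exact Finset.sum_congr rfl fun r _ => by ring
  rw [h2]
  ring

/-- A bound on the growth of the squared Euclidean norm along the flow, which excludes blow-up in
finite time. By Euler's identity each sample contributes -(f - y)(2f - c) with c the outer bias, and
the term -2f² absorbs the mixed terms, leaving only c² and y². -/
theorem paramInner_self_lossGradient_le (x : Fin n → EuclideanSpace ℝ (Fin d)) (y : Fin n → ℝ)
    (θ : Params M d) {s : Fin n → Fin M → ℝ}
    (hs : ∀ i r, s i r ∈ reluSubdiff (preact θ r (x i))) :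
    2 * paramInner θ (-lossGradient x y θ s)
      ≤ 2 * (1 / (n : ℝ)) * (n + ∑ i, y i ^ 2) * (1 + paramInner θ θ) := by
  rw [paramInner_neg_lossGradient]
  have hc : θ.2.2.2 ^ 2 ≤ paramInner θ θ := by
    have h1 : 0 ≤ ∑ r, θ.1 r * θ.1 r := Finset.sum_nonneg fun r _ => mul_self_nonneg _
    have h2 : 0 ≤ ∑ r, inner ℝ (θ.2.1 r) (θ.2.1 r) := Finset.sum_nonneg fun r _ =>
      real_inner_self_nonneg
    have h3 : 0 ≤ ∑ r, θ.2.2.1 r * θ.2.2.1 r := Finset.sum_nonneg fun r _ => mul_self_nonneg _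
    unfold paramInner
    nlinarith
  have hP := paramInner_self_nonneg θ
  have hY : 0 ≤ ∑ i, y i ^ 2 := Finset.sum_nonneg fun i _ => sq_nonneg _
  have hterm : ∑ i, -((network θ (x i) - y i) * paramInner θ (networkGradient θ (x i) (s i)))
      ≤ ∑ i, (paramInner θ θ + y i ^ 2) := by
    refine Finset.sum_le_sum fun i _ => ?_
    rw [paramInner_networkGradient_self θ (x i) (hs i)]
    nlinarith [sq_nonneg (4 * network θ (x i) - θ.2.2.2 - 2 * y i), sq_nonneg (θ.2.2.2 + 2 * y i)]
  rw [Finset.sum_neg_distrib, Finset.sum_add_distrib, Finset.sum_const, Finset.card_univ,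
    Fintype.card_fin, nsmul_eq_mul] at hterm
  have hn : (0 : ℝ) ≤ 1 / n := by positivity
  have hfin : (n : ℝ) * paramInner θ θ + ∑ i, y i ^ 2
      ≤ (n + ∑ i, y i ^ 2) * (1 + paramInner θ θ) := by
    have : (0 : ℝ) ≤ n := n.cast_nonneg
    nlinarith [mul_nonneg hY hP]
  have := mul_le_mul_of_nonneg_left (hterm.trans hfin) hn
  linarith

/-- Euler polygons for one selection of the gradient satisfy a discrete Grönwall inequality for 1 +
|θ|², so they stay bounded on bounded time intervals. -/
theorem exists_isGradientFlow (x : Fin n → EuclideanSpace ℝ (Fin d)) (y : Fin n → ℝ)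
    (θ₀ : Params M d) : ∃ θ : ℝ → Params M d, θ 0 = θ₀ ∧ IsGradientFlow x y θ := by
  let g : Params M d → Params M d := fun θ =>
    -lossGradient x y θ fun i r => if 0 < preact θ r (x i) then 1 else 0
  have hgmem : ∀ θ, g θ ∈ lossGradientSet x y θ := fun θ =>
    ⟨_, fun i _ r _ => indicator_mem_reluSubdiff _, rfl⟩
  -- The velocity is replaced by zero when its squared norm exceeds k + 1. This makes the second
  -- order term of a step of length 1/(k+1) at most 1/(k+1) before any bound on the polygon is
  -- known.
  let w : ℕ → Params M d → Params M d := fun k θ =>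
    if paramInner (g θ) (g θ) ≤ (k : ℝ) + 1 then g θ else 0
  let e : ℕ → ℕ → Params M d := fun k j =>
    Nat.rec θ₀ (fun _ p => p + (1 / ((k : ℝ) + 1)) • w k p) j
  have hstep : ∀ k j, e k (j + 1) = e k j + (1 / ((k : ℝ) + 1)) • w k (e k j) := fun k j => rfl
  -- The first summand is the growth rate from `paramInner_self_lossGradient_le`; the additional 1
  -- absorbs the second order term of an Euler step.
  set C : ℝ := 2 * (1 / (n : ℝ)) * (n + ∑ i, y i ^ 2) + 1 with hC
  have hY : 0 ≤ ∑ i, y i ^ 2 := Finset.sum_nonneg fun i _ => sq_nonneg _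
  have hC0 : 0 ≤ C := by positivity
  have hgrow : ∀ k j, 1 + paramInner (e k j) (e k j)
      ≤ (1 + paramInner θ₀ θ₀) * Real.exp (C * (1 / ((k : ℝ) + 1) * j)) := by
    intro k j
    have hk : (0 : ℝ) < (k : ℝ) + 1 := by positivity
    induction j with
    | zero => simp [e]
    | succ j ih =>
      have hN := paramInner_self_nonneg (e k j)
      have h1 : 2 * paramInner (e k j) (w k (e k j)) ≤ (C - 1) * (1 + paramInner (e k j) (e k j)) := by
        simp only [w]
        split_ifs
        · have := paramInner_self_lossGradient_le x y (e k j)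
            (s := fun i r => if 0 < preact (e k j) r (x i) then 1 else 0)
            (fun i r => indicator_mem_reluSubdiff _)
          rw [hC, add_sub_cancel_right]
          exact this
        · rw [paramInner_zero_right, mul_zero, hC, add_sub_cancel_right]
          positivity
      have h2 : paramInner (w k (e k j)) (w k (e k j)) ≤ (k : ℝ) + 1 := by
        simp only [w]
        split_ifs with h
        · exact h
        · rw [paramInner_zero_right]; exact hk.le
      have h3 : 1 + paramInner (e k (j + 1)) (e k (j + 1))
          ≤ (1 + paramInner (e k j) (e k j)) * (1 + C * (1 / ((k : ℝ) + 1))) := by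
        rw [hstep, paramInner_add_smul]
        set h : ℝ := 1 / ((k : ℝ) + 1) with hh
        have hpos : 0 < h := one_div_pos.2 hk
        have h4 : h ^ 2 * paramInner (w k (e k j)) (w k (e k j)) ≤ h := by
          calc _ ≤ h ^ 2 * ((k : ℝ) + 1) := by gcongr
            _ = h := by rw [hh]; field_simp
        nlinarith
      have h5 : 1 + C * (1 / ((k : ℝ) + 1)) ≤ Real.exp (C * (1 / ((k : ℝ) + 1))) := by
        rw [add_comm]; exact Real.add_one_le_exp _
      calc _ ≤ _ := h3
        _ ≤ ((1 + paramInner θ₀ θ₀) * Real.exp (C * (1 / ((k : ℝ) + 1) * j)))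
            * Real.exp (C * (1 / ((k : ℝ) + 1))) := by
          have := paramInner_self_nonneg θ₀
          gcongr
        _ = _ := by
          rw [mul_assoc, ← Real.exp_add]
          push_cast
          ring_nf
  have hbound : ∀ R : ℝ, ∃ B : ℝ, ∀ θ : Params M d, ‖θ‖ ≤ R → ‖g θ‖ ≤ B ∧
      paramInner (g θ) (g θ) ≤ B := by
    intro R
    have : ProperSpace (Params M d) := FiniteDimensional.proper ℝ _
    have hK := (isCompact_closedBall (0 : Params M d) R).prod (isCompact_pi_Icc (n := n) (M := M))
    have hG := (continuous_lossGradient (M := M) x y).neg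
    obtain ⟨B1, hB1⟩ := hK.exists_bound_of_continuousOn hG.continuousOn
    have hq : Continuous fun η : Params M d => paramInner η η := by
      unfold paramInner; fun_prop
    obtain ⟨B2, hB2⟩ := hK.exists_bound_of_continuousOn (hq.comp hG).continuousOn
    refine ⟨max B1 B2, fun θ hθ => ?_⟩
    have hmem : (θ, fun (i : Fin n) (r : Fin M) => if 0 < preact θ r (x i) then (1 : ℝ) else 0) ∈
        Metric.closedBall (0 : Params M d) R ×ˢ (Set.pi Set.univ fun _ : Fin n =>
          Set.pi Set.univ fun _ : Fin M => Set.Icc (0 : ℝ) 1) :=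
      ⟨by simpa using hθ, fun i _ r _ => reluSubdiff_subset_Icc _ (indicator_mem_reluSubdiff _)⟩
    exact ⟨(hB1 _ hmem).trans (le_max_left _ _),
      ((le_abs_self _).trans (hB2 _ hmem)).trans (le_max_right _ _)⟩
  obtain ⟨θ, hθ0, hac, hd⟩ := exists_solution_of_euler (lossGradientSet x y)
    (convex_lossGradientSet x y) (fun p => (isCompact_lossGradientSet x y p).isClosed)
    (fun p ε hε => eventually_lossGradientSet_subset x y p hε) θ₀ e (fun k j => w k (e k j))
    (fun k => rfl) hstep (by
      intro T
      set N : ℝ := (1 + paramInner θ₀ θ₀) * Real.exp (C * T) with hN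
      have hnorm : ∀ k j : ℕ, j ≤ T * (k + 1) → ‖e k j‖ ≤ N := by
        intro k j hj
        have hk : (0 : ℝ) < (k : ℝ) + 1 := by positivity
        have h1 : 1 / ((k : ℝ) + 1) * j ≤ T := by
          rw [one_div, inv_mul_le_iff₀ hk, mul_comm]
          exact_mod_cast hj
        have h2 : 1 + paramInner (e k j) (e k j) ≤ N := (hgrow k j).trans (by
          have := paramInner_self_nonneg θ₀
          rw [hN]; gcongr)
        have h3 := norm_sq_le_paramInner (e k j)
        nlinarith [sq_nonneg (‖e k j‖ - 1), norm_nonneg (e k j)]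
      obtain ⟨B, hB⟩ := hbound N
      refine ⟨max N B, ?_⟩
      -- Up to time `T` the polygons stay in the ball of radius `N`, where the squared norm of `g`
      -- is at most `B`. So the truncation is inactive once k ≥ B, and the velocities lie in the
      -- gradient set.
      filter_upwards [eventually_ge_atTop ⌈B⌉₊] with k hk j hj
      have hb := hB _ (hnorm k j hj)
      have hle : paramInner (g (e k j)) (g (e k j)) ≤ (k : ℝ) + 1 := by
        have : B ≤ k := (Nat.le_ceil B).trans (by exact_mod_cast hk)
        linarith [hb.2]
      have hw : w k (e k j) = g (e k j) := if_pos hle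
      rw [hw]
      exact ⟨(hnorm k j hj).trans (le_max_left _ _), hb.1.trans (le_max_right _ _), hgmem _⟩)
  refine ⟨θ, hθ0, hac, ?_⟩
  filter_upwards [hd] with t ht
  obtain ⟨_, ⟨s, hs, rfl⟩, h⟩ := ht
  exact ⟨s, fun i r => hs i trivial r trivial, h⟩

end Existence

/-! ### Gaussian integrals in the plane -/

section GaussianPlane

theorem integral_pow_mul_exp_neg_half_sq (k : ℕ) :
    ∫ r in Set.Ioi (0 : ℝ), r ^ k * Real.exp (-(1 / 2) * r ^ 2)
      = (1 / 2 : ℝ) ^ (-((k : ℝ) + 1) / 2) * (1 / 2) * Real.Gamma (((k : ℝ) + 1) / 2) := by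
  have hk : (-1 : ℝ) < k := by have : (0 : ℝ) ≤ k := k.cast_nonneg; linarith
  rw [← integral_rpow_mul_exp_neg_mul_rpow (p := 2) (q := k) (b := 1 / 2) two_pos hk (by norm_num)]
  simp only [Real.rpow_natCast, Real.rpow_two]

theorem integral_pow_one_mul_exp : ∫ r in Set.Ioi (0 : ℝ), r ^ 1 * Real.exp (-(1 / 2) * r ^ 2) = 1 := by
  rw [integral_pow_mul_exp_neg_half_sq 1]
  norm_num [Real.rpow_neg_one]

theorem integral_pow_three_mul_exp :
    ∫ r in Set.Ioi (0 : ℝ), r ^ 3 * Real.exp (-(1 / 2) * r ^ 2) = 2 := by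
  rw [integral_pow_mul_exp_neg_half_sq 3]
  norm_num

theorem integral_gaussianReal_prod (f : ℝ × ℝ → ℝ) :
    ∫ p, f p ∂((gaussianReal 0 1).prod (gaussianReal 0 1))
      = ∫ p : ℝ × ℝ, (2 * Real.pi)⁻¹ * Real.exp (-(1 / 2) * (p.1 ^ 2 + p.2 ^ 2)) * f p := by
  have h1 : (gaussianReal 0 1) = volume.withDensity (gaussianPDF 0 1) :=
    gaussianReal_of_var_ne_zero 0 one_ne_zero
  have hm : Measurable fun p : ℝ × ℝ => gaussianPDFReal 0 1 p.1 * gaussianPDFReal 0 1 p.2 :=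
    ((measurable_gaussianPDFReal 0 1).comp measurable_fst).mul
      ((measurable_gaussianPDFReal 0 1).comp measurable_snd)
  have h2 : (gaussianReal 0 1).prod (gaussianReal 0 1) = (volume : Measure (ℝ × ℝ)).withDensity
      fun p => ENNReal.ofReal (gaussianPDFReal 0 1 p.1 * gaussianPDFReal 0 1 p.2) := by
    rw [h1, prod_withDensity (measurable_gaussianPDF 0 1) (measurable_gaussianPDF 0 1)]
    congr 1
    funext p
    rw [gaussianPDF, gaussianPDF, ENNReal.ofReal_mul (gaussianPDFReal_nonneg _ _ _)]
  rw [h2, integral_withDensity_eq_integral_toReal_smul hm.ennreal_ofReal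
    (Eventually.of_forall fun _ => ENNReal.ofReal_lt_top)]
  refine integral_congr_ae (Eventually.of_forall fun p => ?_)
  simp only
  rw [ENNReal.toReal_ofReal (mul_nonneg (gaussianPDFReal_nonneg _ _ _)
    (gaussianPDFReal_nonneg _ _ _)), smul_eq_mul]
  congr 1
  simp only [gaussianPDFReal, NNReal.coe_one, mul_one, sub_zero]
  rw [mul_mul_mul_comm, ← Real.exp_add, ← mul_inv, Real.mul_self_sqrt (by positivity)]
  congr 2
  ring

/-- A positively homogeneous integrand separates in polar coordinates; the extra power of r is the
Jacobian. -/
theorem integral_gaussianReal_prod_polar {f : ℝ × ℝ → ℝ} {h : ℝ → ℝ} {k : ℕ}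
    (hf : ∀ r φ : ℝ, 0 < r → f (r * Real.cos φ, r * Real.sin φ) = r ^ k * h φ) :
    ∫ p, f p ∂((gaussianReal 0 1).prod (gaussianReal 0 1))
      = (∫ r in Set.Ioi (0 : ℝ), r ^ (k + 1) * Real.exp (-(1 / 2) * r ^ 2)) *
        ((2 * Real.pi)⁻¹ * ∫ φ in Set.Ioo (-Real.pi) Real.pi, h φ) := by
  rw [integral_gaussianReal_prod, ← integral_comp_polarCoord_symm, ← integral_const_mul,
    ← setIntegral_prod_mul]
  refine setIntegral_congr_fun polarCoord.open_target.measurableSet fun p hp => ?_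
  have hr : 0 < p.1 := hp.1
  simp only [polarCoord_symm_apply, smul_eq_mul, hf _ _ hr]
  have : (p.1 * Real.cos p.2) ^ 2 + (p.1 * Real.sin p.2) ^ 2 = p.1 ^ 2 := by
    rw [mul_pow, mul_pow, ← mul_add, Real.cos_sq_add_sin_sq, mul_one]
  rw [this]
  ring

variable {ψ : ℝ}

theorem cos_pos_and_cos_sub_pos_iff (h0 : 0 ≤ ψ) (h1 : ψ ≤ Real.pi) {φ : ℝ}
    (hφ : φ ∈ Set.Ioo (-Real.pi) Real.pi) :
    (0 < Real.cos φ ∧ 0 < Real.cos (φ - ψ))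
      ↔ φ ∈ Set.Ioo (ψ - Real.pi / 2) (Real.pi / 2) := by
  constructor
  · rintro ⟨h2, h3⟩
    have ha : φ < Real.pi / 2 := by
      by_contra! h
      exact absurd h2 (Real.cos_nonpos_of_pi_div_two_le_of_le h (by linarith [hφ.2])).not_gt
    have hb : -(Real.pi / 2) < φ := by
      by_contra! h
      rw [← Real.cos_neg] at h2
      exact absurd h2 (Real.cos_nonpos_of_pi_div_two_le_of_le (by linarith)
        (by linarith [hφ.1])).not_gt
    refine ⟨?_, ha⟩
    by_contra! h
    rw [← Real.cos_neg] at h3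
    exact absurd h3 (Real.cos_nonpos_of_pi_div_two_le_of_le (by linarith) (by linarith)).not_gt
  · rintro ⟨h2, h3⟩
    exact ⟨Real.cos_pos_of_mem_Ioo ⟨by linarith, h3⟩,
      Real.cos_pos_of_mem_Ioo ⟨by linarith, by linarith⟩⟩

theorem Ioo_subset_of_angle (h0 : 0 ≤ ψ) :
    Set.Ioo (ψ - Real.pi / 2) (Real.pi / 2) ⊆ Set.Ioo (-Real.pi) Real.pi := by
  intro φ hφ
  have := Real.pi_pos
  exact ⟨by linarith [hφ.1], by linarith [hφ.2]⟩

theorem integral_indicator_cos (h0 : 0 ≤ ψ) (h1 : ψ ≤ Real.pi) :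
    ∫ φ in Set.Ioo (-Real.pi) Real.pi, (if 0 < Real.cos φ then (1 : ℝ) else 0) *
      (if 0 < Real.cos (φ - ψ) then (1 : ℝ) else 0) = Real.pi - ψ := by
  have h : Set.EqOn (fun φ => (if 0 < Real.cos φ then (1 : ℝ) else 0) *
      (if 0 < Real.cos (φ - ψ) then (1 : ℝ) else 0))
      ((Set.Ioo (ψ - Real.pi / 2) (Real.pi / 2)).indicator fun _ => (1 : ℝ))
      (Set.Ioo (-Real.pi) Real.pi) := by
    intro φ hφ
    have := cos_pos_and_cos_sub_pos_iff h0 h1 hφ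
    simp only [Set.indicator_apply, ← this]
    split_ifs <;> simp_all
  rw [setIntegral_congr_fun measurableSet_Ioo h, setIntegral_indicator measurableSet_Ioo,
    Set.inter_eq_right.2 (Ioo_subset_of_angle h0), setIntegral_const, Real.volume_real_Ioo_of_le
      (by linarith), smul_eq_mul]
  ring

theorem integral_relu_cos (h0 : 0 ≤ ψ) (h1 : ψ ≤ Real.pi) :
    ∫ φ in Set.Ioo (-Real.pi) Real.pi, relu (Real.cos φ) * relu (Real.cos (φ - ψ))
      = 1 / 2 * ((Real.pi - ψ) * Real.cos ψ + Real.sin ψ) := by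
  have h : Set.EqOn (fun φ => relu (Real.cos φ) * relu (Real.cos (φ - ψ)))
      ((Set.Ioo (ψ - Real.pi / 2) (Real.pi / 2)).indicator
        fun φ => Real.cos φ * Real.cos (φ - ψ)) (Set.Ioo (-Real.pi) Real.pi) := by
    intro φ hφ
    have := cos_pos_and_cos_sub_pos_iff h0 h1 hφ
    simp only [Set.indicator_apply, ← this]
    split_ifs with h
    · rw [relu, relu, max_eq_left h.1.le, max_eq_left h.2.le]
    · rcases not_and_or.1 h with h | h
      · rw [relu, max_eq_right (not_lt.1 h), zero_mul]
      · rw [relu, relu, max_eq_right (not_lt.1 h), mul_zero]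
  rw [setIntegral_congr_fun measurableSet_Ioo h, setIntegral_indicator measurableSet_Ioo,
    Set.inter_eq_right.2 (Ioo_subset_of_angle h0), ← integral_Ioc_eq_integral_Ioo,
    ← intervalIntegral.integral_of_le (by linarith)]
  -- The antiderivative comes from the product formula 2 cos φ cos(φ - ψ) = cos ψ + cos(2φ - ψ).
  have hd : ∀ φ ∈ Set.uIcc (ψ - Real.pi / 2) (Real.pi / 2),
      HasDerivAt (fun φ => 1 / 2 * (φ * Real.cos ψ + 1 / 2 * Real.sin (2 * φ - ψ)))
        (Real.cos φ * Real.cos (φ - ψ)) φ := by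
    intro φ _
    have h2 : HasDerivAt (fun φ : ℝ => 2 * φ - ψ) 2 φ := by
      simpa using ((hasDerivAt_id φ).const_mul 2).sub_const ψ
    have h3 := (((hasDerivAt_id φ).mul_const (Real.cos ψ)).add
      (h2.sin.const_mul (1 / 2))).const_mul (1 / 2)
    refine h3.congr_deriv ?_
    rw [show 2 * φ - ψ = φ + (φ - ψ) by ring, Real.cos_add,
      show Real.cos ψ = Real.cos (φ - (φ - ψ)) by ring_nf, Real.cos_sub φ (φ - ψ)]
    ring
  rw [intervalIntegral.integral_eq_sub_of_hasDerivAt hd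
    (Continuous.intervalIntegrable (by fun_prop) _ _)]
  have e1 : Real.sin (2 * (Real.pi / 2) - ψ) = Real.sin ψ := by
    rw [show 2 * (Real.pi / 2) - ψ = Real.pi - ψ by ring, Real.sin_pi_sub]
  have e2 : Real.sin (2 * (ψ - Real.pi / 2) - ψ) = -Real.sin ψ := by
    rw [show 2 * (ψ - Real.pi / 2) - ψ = ψ - Real.pi by ring, Real.sin_sub_pi]
  rw [e1, e2]
  ring

theorem relu_mul_of_pos {c : ℝ} (hc : 0 < c) (z : ℝ) : relu (c * z) = c * relu z := by
  rw [relu, relu, mul_max_of_nonneg _ _ hc.le, mul_zero]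

theorem integral_gaussian_indicator (h0 : 0 ≤ ψ) (h1 : ψ ≤ Real.pi) :
    ∫ p : ℝ × ℝ, (if 0 < p.1 then (1 : ℝ) else 0) *
      (if 0 < Real.cos ψ * p.1 + Real.sin ψ * p.2 then (1 : ℝ) else 0)
      ∂((gaussianReal 0 1).prod (gaussianReal 0 1)) = (Real.pi - ψ) / (2 * Real.pi) := by
  rw [integral_gaussianReal_prod_polar (k := 0) (h := fun φ =>
    (if 0 < Real.cos φ then (1 : ℝ) else 0) * (if 0 < Real.cos (φ - ψ) then (1 : ℝ) else 0)),
    zero_add, integral_pow_one_mul_exp, integral_indicator_cos h0 h1]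
  · ring
  · intro r φ hr
    have e : Real.cos ψ * (r * Real.cos φ) + Real.sin ψ * (r * Real.sin φ)
        = r * Real.cos (φ - ψ) := by rw [Real.cos_sub]; ring
    simp only [e, mul_pos_iff_of_pos_left hr, pow_zero, one_mul]

theorem integral_gaussian_relu (h0 : 0 ≤ ψ) (h1 : ψ ≤ Real.pi) :
    ∫ p : ℝ × ℝ, relu p.1 * relu (Real.cos ψ * p.1 + Real.sin ψ * p.2)
      ∂((gaussianReal 0 1).prod (gaussianReal 0 1))
      = ((Real.pi - ψ) * Real.cos ψ + Real.sin ψ) / (2 * Real.pi) := by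
  rw [integral_gaussianReal_prod_polar (k := 2) (h := fun φ =>
    relu (Real.cos φ) * relu (Real.cos (φ - ψ))),
    integral_pow_three_mul_exp, integral_relu_cos h0 h1]
  · field_simp
  · intro r φ hr
    have e : Real.cos ψ * (r * Real.cos φ) + Real.sin ψ * (r * Real.sin φ)
        = r * Real.cos (φ - ψ) := by rw [Real.cos_sub]; ring
    simp only [e, relu_mul_of_pos hr]
    ring

end GaussianPlane

/-! ### The law of a single neuron and the neural tangent kernel as an expectation -/

/-- The random parameters `(w, b)` of a hidden neuron. -/
abbrev HiddenDraw (d : ℕ) : Type := (Fin d → ℝ) × ℝ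

/-- The random parameters `(a, w, b)` of a single neuron. -/
abbrev NeuronDraw (d : ℕ) : Type := ℝ × HiddenDraw d

/-- The law of `(w, b)`. -/
noncomputable def hiddenLaw (d : ℕ) : Measure (HiddenDraw d) :=
  (Measure.pi fun _ : Fin d => gaussianReal 0 1).prod (gaussianReal 0 1)

/-- The law of `(a, w, b)`. -/
noncomputable def neuronLaw (d : ℕ) : Measure (NeuronDraw d) := (gaussianReal 0 1).prod (hiddenLaw d)

instance (d : ℕ) : IsProbabilityMeasure (hiddenLaw d) := by unfold hiddenLaw; infer_instance

instance (d : ℕ) : IsProbabilityMeasure (neuronLaw d) := by unfold neuronLaw; infer_instance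

/-- The pre-activation of a random neuron. -/
noncomputable def drawPreact {d : ℕ} (h : HiddenDraw d) (z : EuclideanSpace ℝ (Fin d)) : ℝ :=
  inner ℝ (WithLp.toLp 2 h.1) z + h.2

section Law

variable {d : ℕ}

theorem charFunDual_gaussianReal_std (L : StrongDual ℝ ℝ) :
    charFunDual (gaussianReal 0 1) L = Complex.exp (-(((L 1) ^ 2 / 2 : ℝ) : ℂ)) := by
  have h1 : (L : ℝ → ℝ) = fun v => L 1 * v := by
    funext v
    conv_lhs => rw [show v = v • (1 : ℝ) by simp]
    rw [map_smul, smul_eq_mul, mul_comm]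
  have h2 := charFun_gaussianReal (μ := 0) (v := 1) (L 1)
  rw [charFun_apply_real] at h2
  rw [charFunDual_apply, h1]
  simp only [Complex.ofReal_mul] at h2 ⊢
  rw [h2]
  simp

theorem charFunDual_hiddenLaw (L : StrongDual ℝ (HiddenDraw d)) :
    charFunDual (hiddenLaw d) L
      = Complex.exp (-((((∑ i, (L (Pi.single i 1, 0)) ^ 2 + (L (0, 1)) ^ 2) / 2 : ℝ)) : ℂ)) := by
  rw [hiddenLaw, charFunDual_prod, charFunDual_pi]
  simp only [charFunDual_gaussianReal_std]
  rw [← Complex.exp_sum, ← Complex.exp_add]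
  congr 1
  simp [add_div, Finset.sum_div, Finset.sum_neg_distrib]
  ring

theorem charFunDual_gaussianReal_prod (L : StrongDual ℝ (ℝ × ℝ)) :
    charFunDual ((gaussianReal 0 1).prod (gaussianReal 0 1)) L
      = Complex.exp (-((((L (1, 0)) ^ 2 + (L (0, 1)) ^ 2) / 2 : ℝ) : ℂ)) := by
  rw [charFunDual_prod]
  simp only [charFunDual_gaussianReal_std]
  rw [← Complex.exp_add]
  congr 1
  simp [add_div]
  ring

/-- The pair of the pre-activations at two points, as a linear map. -/
noncomputable def drawPreactPair (z z' : EuclideanSpace ℝ (Fin d)) : HiddenDraw d →L[ℝ] ℝ × ℝ :=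
  LinearMap.toContinuousLinearMap
    { toFun := fun h => (drawPreact h z, drawPreact h z')
      map_add' := fun g h => by
        simp only [drawPreact, Prod.fst_add, Prod.snd_add, WithLp.toLp_add, inner_add_left,
          Prod.mk_add_mk]
        congr 1 <;> ring
      map_smul' := fun c h => by
        simp only [drawPreact, Prod.smul_fst, Prod.smul_snd, WithLp.toLp_smul,
          real_inner_smul_left, smul_eq_mul, RingHom.id_apply, Prod.smul_mk]
        congr 1 <;> ring }

@[simp]
theorem drawPreactPair_apply (z z' : EuclideanSpace ℝ (Fin d)) (h : HiddenDraw d) :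
    drawPreactPair z z' h = (drawPreact h z, drawPreact h z') := rfl

/-- The linear map of the plane with the given norms and angle. -/
noncomputable def planeMap (ρ ρ' ψ : ℝ) : ℝ × ℝ →L[ℝ] ℝ × ℝ :=
  LinearMap.toContinuousLinearMap
    { toFun := fun p => (ρ * p.1, ρ' * (Real.cos ψ * p.1 + Real.sin ψ * p.2))
      map_add' := fun g h => by
        simp only [Prod.fst_add, Prod.snd_add, Prod.mk_add_mk]
        congr 1 <;> ring
      map_smul' := fun c h => by
        simp only [Prod.smul_fst, Prod.smul_snd, smul_eq_mul, RingHom.id_apply, Prod.smul_mk]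
        congr 1 <;> ring }

@[simp]
theorem planeMap_apply (ρ ρ' ψ : ℝ) (p : ℝ × ℝ) :
    planeMap ρ ρ' ψ p = (ρ * p.1, ρ' * (Real.cos ψ * p.1 + Real.sin ψ * p.2)) := rfl

theorem dual_prod_apply (L : StrongDual ℝ (ℝ × ℝ)) (a b : ℝ) :
    L (a, b) = a * L (1, 0) + b * L (0, 1) := by
  have : ((a, b) : ℝ × ℝ) = a • (1, 0) + b • (0, 1) := by simp
  rw [this, map_add, map_smul, map_smul, smul_eq_mul, smul_eq_mul]

theorem one_add_inner_sq_le (z z' : EuclideanSpace ℝ (Fin d)) :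
    |inner ℝ z z' + 1| ≤ √((‖z‖ ^ 2 + 1) * (‖z'‖ ^ 2 + 1)) := by
  refine Real.le_sqrt_of_sq_le ?_
  rw [sq_abs]
  have h := abs_real_inner_le_norm z z'
  have h1 : (inner ℝ z z') ^ 2 ≤ ‖z‖ ^ 2 * ‖z'‖ ^ 2 := by
    rw [← mul_pow, ← sq_abs]; gcongr
  nlinarith [le_abs_self (inner ℝ z z'), sq_nonneg (‖z‖ - ‖z'‖)]

theorem cos_ntkAngle (z z' : EuclideanSpace ℝ (Fin d)) :
    √(‖z‖ ^ 2 + 1) * √(‖z'‖ ^ 2 + 1) * Real.cos (ntkAngle z z') = inner ℝ z z' + 1 := by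
  have hpos : 0 < √((‖z‖ ^ 2 + 1) * (‖z'‖ ^ 2 + 1)) := Real.sqrt_pos.2 (by positivity)
  have h := abs_le.1 (one_add_inner_sq_le z z')
  rw [ntkAngle, Real.cos_arccos, ← Real.sqrt_mul (by positivity), mul_div_cancel₀ _ hpos.ne']
  · rw [le_div_iff₀ hpos]; linarith [h.1]
  · rw [div_le_iff₀ hpos]; linarith [h.2]

/-- Lagrange's identity for the vectors (z, 1) and (z', 1): the product of the squared norms minus
the squared inner product is the expression under the root. -/
theorem sin_ntkAngle (z z' : EuclideanSpace ℝ (Fin d)) :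
    √(‖z‖ ^ 2 + 1) * √(‖z'‖ ^ 2 + 1) * Real.sin (ntkAngle z z')
      = √(‖z - z'‖ ^ 2 + ‖z‖ ^ 2 * ‖z'‖ ^ 2 - (inner ℝ z z') ^ 2) := by
  have hs : 0 ≤ Real.sin (ntkAngle z z') :=
    Real.sin_nonneg_of_nonneg_of_le_pi (Real.arccos_nonneg _) (Real.arccos_le_pi _)
  have h1 : √(‖z‖ ^ 2 + 1) ^ 2 = ‖z‖ ^ 2 + 1 := Real.sq_sqrt (by positivity)
  have h2 : √(‖z'‖ ^ 2 + 1) ^ 2 = ‖z'‖ ^ 2 + 1 := Real.sq_sqrt (by positivity)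
  have h3 := cos_ntkAngle z z'
  have h4 := Real.sin_sq (ntkAngle z z')
  have e : ‖z - z'‖ ^ 2 + ‖z‖ ^ 2 * ‖z'‖ ^ 2 - (inner ℝ z z') ^ 2
      = (√(‖z‖ ^ 2 + 1) * √(‖z'‖ ^ 2 + 1) * Real.sin (ntkAngle z z')) ^ 2 := by
    rw [mul_pow, h4, mul_sub, mul_one, ← mul_pow _ (Real.cos _), h3, mul_pow, h1, h2,
      norm_sub_sq_real]
    ring
  rw [e, Real.sqrt_sq (by positivity)]

/-- Both laws are centred Gaussian with covariance matrix the Gram matrix of (z, 1) and (z', 1), so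
their characteristic functions agree. It reduces expectations over a neuron to integrals over a
standard Gaussian plane, where the two pre-activations make the angle `ntkAngle z z'`. -/
theorem map_drawPreactPair (z z' : EuclideanSpace ℝ (Fin d)) :
    (hiddenLaw d).map (drawPreactPair z z')
      = ((gaussianReal 0 1).prod (gaussianReal 0 1)).map
        (planeMap √(‖z‖ ^ 2 + 1) √(‖z'‖ ^ 2 + 1) (ntkAngle z z')) := by
  have : IsProbabilityMeasure ((hiddenLaw d).map (drawPreactPair z z')) :=
    Measure.isProbabilityMeasure_map (by fun_prop)
  have : IsProbabilityMeasure (((gaussianReal 0 1).prod (gaussianReal 0 1)).map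
      (planeMap √(‖z‖ ^ 2 + 1) √(‖z'‖ ^ 2 + 1) (ntkAngle z z'))) :=
    Measure.isProbabilityMeasure_map (by fun_prop)
  refine Measure.ext_of_charFunDual ?_
  ext L
  rw [charFunDual_map, charFunDual_map, charFunDual_hiddenLaw, charFunDual_gaussianReal_prod]
  congr 3
  simp only [ContinuousLinearMap.comp_apply, drawPreactPair_apply, planeMap_apply]
  rw [dual_prod_apply L (drawPreact _ _), dual_prod_apply L (√_ * _), dual_prod_apply L (√_ * _)]
  simp only [dual_prod_apply L (drawPreact _ _) (drawPreact _ _)]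
  set s := L (1, 0)
  set t := L (0, 1)
  have e1 : ∀ (i : Fin d) (u : EuclideanSpace ℝ (Fin d)),
      drawPreact ((Pi.single i 1, 0) : HiddenDraw d) u = u i := by
    intro i u
    simp [drawPreact, PiLp.inner_apply]
  have e2 : ∀ u : EuclideanSpace ℝ (Fin d), drawPreact ((0, 1) : HiddenDraw d) u = 1 := by
    intro u
    simp [drawPreact]
  simp only [e1, e2]
  have e3 : ∑ i, (z i * s + z' i * t) ^ 2
      = s ^ 2 * ‖z‖ ^ 2 + 2 * s * t * inner ℝ z z' + t ^ 2 * ‖z'‖ ^ 2 := by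
    rw [EuclideanSpace.real_norm_sq_eq, EuclideanSpace.real_norm_sq_eq, PiLp.inner_apply,
      Finset.mul_sum, Finset.mul_sum, Finset.mul_sum, ← Finset.sum_add_distrib,
      ← Finset.sum_add_distrib]
    refine Finset.sum_congr rfl fun i _ => ?_
    simp only [RCLike.inner_apply, conj_trivial]
    ring
  rw [e3]
  have h1 : √(‖z‖ ^ 2 + 1) ^ 2 = ‖z‖ ^ 2 + 1 := Real.sq_sqrt (by positivity)
  have h2 : √(‖z'‖ ^ 2 + 1) ^ 2 = ‖z'‖ ^ 2 + 1 := Real.sq_sqrt (by positivity)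
  have h3 := cos_ntkAngle z z'
  have h4 := Real.sin_sq_add_cos_sq (ntkAngle z z')
  -- Equality of the two quadratic forms in `s`, `t`: the squared norms and the cosine identity give
  -- the coefficients, and sin² + cos² = 1 collects the variance of the second coordinate.
  linear_combination (-s ^ 2 * h1 - t ^ 2 * h2 - 2 * s * t * h3
    - t ^ 2 * √(‖z'‖ ^ 2 + 1) ^ 2 * h4) / 2

theorem integral_hiddenLaw_comp {f : ℝ × ℝ → ℝ} (hf : Measurable f)
    (z z' : EuclideanSpace ℝ (Fin d)) :
    ∫ h, f (drawPreact h z, drawPreact h z') ∂(hiddenLaw d)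
      = ∫ p : ℝ × ℝ, f (√(‖z‖ ^ 2 + 1) * p.1, √(‖z'‖ ^ 2 + 1) *
          (Real.cos (ntkAngle z z') * p.1 + Real.sin (ntkAngle z z') * p.2))
        ∂((gaussianReal 0 1).prod (gaussianReal 0 1)) := by
  have h1 := integral_map (μ := hiddenLaw d) (φ := drawPreactPair z z') (by fun_prop)
    hf.aestronglyMeasurable
  have h2 := integral_map (μ := (gaussianReal 0 1).prod (gaussianReal 0 1))
    (φ := planeMap √(‖z‖ ^ 2 + 1) √(‖z'‖ ^ 2 + 1) (ntkAngle z z')) (by fun_prop)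
    hf.aestronglyMeasurable
  rw [map_drawPreactPair, h2] at h1
  exact h1.symm

theorem integral_hiddenLaw_indicator (z z' : EuclideanSpace ℝ (Fin d)) :
    ∫ h, (if 0 < drawPreact h z then (1 : ℝ) else 0) * (if 0 < drawPreact h z' then (1 : ℝ) else 0)
      ∂(hiddenLaw d) = (Real.pi - ntkAngle z z') / (2 * Real.pi) := by
  have hm : Measurable fun p : ℝ × ℝ =>
      (if 0 < p.1 then (1 : ℝ) else 0) * (if 0 < p.2 then (1 : ℝ) else 0) :=
    (Measurable.ite (measurableSet_lt measurable_const measurable_fst) measurable_const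
      measurable_const).mul (Measurable.ite (measurableSet_lt measurable_const measurable_snd)
      measurable_const measurable_const)
  rw [integral_hiddenLaw_comp hm, ← integral_gaussian_indicator (ψ := ntkAngle z z')
    (Real.arccos_nonneg _) (Real.arccos_le_pi _)]
  have h1 : 0 < √(‖z‖ ^ 2 + 1) := Real.sqrt_pos.2 (by positivity)
  have h2 : 0 < √(‖z'‖ ^ 2 + 1) := Real.sqrt_pos.2 (by positivity)
  simp only [mul_pos_iff_of_pos_left h1, mul_pos_iff_of_pos_left h2]

theorem integral_hiddenLaw_relu (z z' : EuclideanSpace ℝ (Fin d)) :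
    ∫ h, relu (drawPreact h z) * relu (drawPreact h z') ∂(hiddenLaw d)
      = ((Real.pi - ntkAngle z z') * (inner ℝ z z' + 1)
        + √(‖z - z'‖ ^ 2 + ‖z‖ ^ 2 * ‖z'‖ ^ 2 - (inner ℝ z z') ^ 2)) / (2 * Real.pi) := by
  have hm : Measurable fun p : ℝ × ℝ => relu p.1 * relu p.2 :=
    (continuous_relu.measurable.comp measurable_fst).mul
      (continuous_relu.measurable.comp measurable_snd)
  have h1 : 0 < √(‖z‖ ^ 2 + 1) := Real.sqrt_pos.2 (by positivity)
  have h2 : 0 < √(‖z'‖ ^ 2 + 1) := Real.sqrt_pos.2 (by positivity)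
  rw [integral_hiddenLaw_comp hm]
  simp only [relu_mul_of_pos h1, relu_mul_of_pos h2, mul_mul_mul_comm √(‖z‖ ^ 2 + 1) (relu _)]
  rw [integral_const_mul, integral_gaussian_relu (ψ := ntkAngle z z') (Real.arccos_nonneg _)
    (Real.arccos_le_pi _), ← cos_ntkAngle, ← sin_ntkAngle]
  ring

/-- The contribution of a random neuron to the tangent kernel at initialization. -/
noncomputable def neuronKernel (v : NeuronDraw d) (z z' : EuclideanSpace ℝ (Fin d)) : ℝ :=
  2 * (relu (drawPreact v.2 z) * relu (drawPreact v.2 z'))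
    + 2 * v.1 ^ 2 * ((if 0 < drawPreact v.2 z then (1 : ℝ) else 0) *
        (if 0 < drawPreact v.2 z' then (1 : ℝ) else 0)) * (inner ℝ z z' + 1) + 1

/-- The size of a random neuron. -/
noncomputable def neuronSize (v : NeuronDraw d) : ℝ :=
  1 + |v.1| + ‖WithLp.toLp 2 v.2.1‖ + |v.2.2|

theorem continuous_drawPreact_uncurry :
    Continuous fun p : NeuronDraw d × EuclideanSpace ℝ (Fin d) => drawPreact p.1.2 p.2 := by
  unfold drawPreact
  have : Continuous fun p : NeuronDraw d × EuclideanSpace ℝ (Fin d) =>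
      (WithLp.toLp 2 p.1.2.1 : EuclideanSpace ℝ (Fin d)) :=
    (PiLp.continuous_toLp 2 _).comp (continuous_fst.comp (continuous_snd.comp continuous_fst))
  fun_prop

theorem continuous_neuronSize : Continuous (neuronSize (d := d)) := by
  unfold neuronSize
  have : Continuous fun v : NeuronDraw d => (WithLp.toLp 2 v.2.1 : EuclideanSpace ℝ (Fin d)) :=
    (PiLp.continuous_toLp 2 _).comp (continuous_fst.comp continuous_snd)
  fun_prop

theorem one_le_neuronSize (v : NeuronDraw d) : 1 ≤ neuronSize v := by
  have := abs_nonneg v.1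
  have := abs_nonneg v.2.2
  have := norm_nonneg (WithLp.toLp 2 v.2.1 : EuclideanSpace ℝ (Fin d))
  unfold neuronSize
  linarith

theorem memLp_neuronSize (p : ℝ≥0) : MemLp (neuronSize (d := d)) p (neuronLaw d) := by
  have hid : MemLp (fun x : ℝ => |x|) p (gaussianReal 0 1) := (memLp_id_gaussianReal p).abs
  have hw : MemLp (fun w : Fin d → ℝ => ‖(WithLp.toLp 2 w : EuclideanSpace ℝ (Fin d))‖) p
      (Measure.pi fun _ : Fin d => gaussianReal 0 1) := by
    have hsum : MemLp (fun w : Fin d → ℝ => ∑ j, |w j|) p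
        (Measure.pi fun _ : Fin d => gaussianReal 0 1) :=
      memLp_finsetSum _ fun j _ => hid.comp_measurePreserving (measurePreserving_eval _ j)
    refine hsum.mono' ?_ (Eventually.of_forall fun w => ?_)
    · exact (PiLp.continuous_toLp 2 _).norm.aestronglyMeasurable
    · rw [norm_norm]
      have h : (WithLp.toLp 2 w : EuclideanSpace ℝ (Fin d))
          = ∑ j, w j • EuclideanSpace.single j (1 : ℝ) := by
        ext i
        simp [Finset.sum_apply, Pi.single_apply]
      rw [h]
      refine (norm_sum_le _ _).trans_eq (Finset.sum_congr rfl fun j _ => ?_)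
      rw [norm_smul]
      simp
  have h1 : MemLp (fun _ : NeuronDraw d => (1 : ℝ)) p (neuronLaw d) := memLp_const 1
  have h2 : MemLp (fun v : NeuronDraw d => |v.1|) p (neuronLaw d) := hid.comp_fst (hiddenLaw d)
  have h3 : MemLp (fun v : NeuronDraw d => ‖(WithLp.toLp 2 v.2.1 : EuclideanSpace ℝ (Fin d))‖) p
      (neuronLaw d) := MemLp.comp_snd (μ := gaussianReal 0 1) (hw.comp_fst (gaussianReal 0 1))
  have h4 : MemLp (fun v : NeuronDraw d => |v.2.2|) p (neuronLaw d) :=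
    MemLp.comp_snd (μ := gaussianReal 0 1) (MemLp.comp_snd
      (μ := Measure.pi fun _ : Fin d => gaussianReal 0 1) hid)
  exact ((h1.add h2).add h3).add h4

theorem abs_drawPreact_le (v : NeuronDraw d) {z : EuclideanSpace ℝ (Fin d)} {R : ℝ} (hz : ‖z‖ ≤ R) :
    |drawPreact v.2 z| ≤ (R + 1) * neuronSize v := by
  have h1 := abs_real_inner_le_norm (WithLp.toLp 2 v.2.1 : EuclideanSpace ℝ (Fin d)) z
  have h2 := norm_nonneg (WithLp.toLp 2 v.2.1 : EuclideanSpace ℝ (Fin d))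
  have h3 := abs_nonneg v.1
  have h4 := abs_nonneg v.2.2
  have hR : 0 ≤ R := (norm_nonneg z).trans hz
  have h5 := mul_le_mul_of_nonneg_left hz h2
  unfold drawPreact neuronSize
  refine (abs_add_le _ _).trans ?_
  nlinarith

theorem measurable_ite_pos {α : Type*} [MeasurableSpace α] {f : α → ℝ} (hf : Measurable f) :
    Measurable fun a => if 0 < f a then (1 : ℝ) else 0 :=
  Measurable.ite (measurableSet_lt measurable_const hf) measurable_const measurable_const

theorem measurable_neuronKernel_uncurry (z' : EuclideanSpace ℝ (Fin d)) :
    Measurable fun p : NeuronDraw d × EuclideanSpace ℝ (Fin d) => neuronKernel p.1 p.2 z' := by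
  have h1 : Measurable fun p : NeuronDraw d × EuclideanSpace ℝ (Fin d) => drawPreact p.1.2 p.2 :=
    continuous_drawPreact_uncurry.measurable
  have h2 : Measurable fun p : NeuronDraw d × EuclideanSpace ℝ (Fin d) => drawPreact p.1.2 z' :=
    (continuous_drawPreact_uncurry.comp (continuous_fst.prodMk continuous_const)).measurable
  have h3 : Measurable fun p : NeuronDraw d × EuclideanSpace ℝ (Fin d) => inner ℝ p.2 z' + 1 :=
    Continuous.measurable (by fun_prop)
  have h4 : Measurable fun p : NeuronDraw d × EuclideanSpace ℝ (Fin d) => p.1.1 :=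
    measurable_fst.comp measurable_fst
  unfold neuronKernel
  have h5 := continuous_relu.measurable.comp h1
  have h6 := continuous_relu.measurable.comp h2
  have h7 := measurable_ite_pos h1
  have h8 := measurable_ite_pos h2
  simp only [Function.comp_def] at h5 h6
  fun_prop

theorem measurable_neuronKernel (z z' : EuclideanSpace ℝ (Fin d)) :
    Measurable fun v : NeuronDraw d => neuronKernel v z z' := by
  have h1 : Measurable fun v : NeuronDraw d => (v, z) := measurable_id.prodMk measurable_const
  have h2 := (measurable_neuronKernel_uncurry z').comp h1
  simp only [Function.comp_def] at h2
  exact h2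

theorem abs_neuronKernel_le (v : NeuronDraw d) {z z' : EuclideanSpace ℝ (Fin d)} {R : ℝ}
    (hz : ‖z‖ ≤ R) (hz' : ‖z'‖ ≤ R) :
    |neuronKernel v z z'| ≤ 5 * (R + 1) ^ 2 * neuronSize v ^ 2 := by
  have hR : 0 ≤ R := (norm_nonneg z).trans hz
  have hs := one_le_neuronSize v
  have h1 : |relu (drawPreact v.2 z) * relu (drawPreact v.2 z')|
      ≤ ((R + 1) * neuronSize v) * ((R + 1) * neuronSize v) := by
    rw [abs_mul, abs_of_nonneg (relu_nonneg _), abs_of_nonneg (relu_nonneg _)]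
    exact mul_le_mul ((relu_le_abs _).trans (abs_drawPreact_le v hz))
      ((relu_le_abs _).trans (abs_drawPreact_le v hz')) (relu_nonneg _) (by positivity)
  have h2 : |inner ℝ z z' + 1| ≤ (R + 1) ^ 2 := by
    have := abs_real_inner_le_norm z z'
    have h3 : ‖z‖ * ‖z'‖ ≤ R * R := mul_le_mul hz hz' (norm_nonneg _) hR
    refine (abs_add_le _ _).trans ?_
    rw [abs_one]
    nlinarith
  have h3 : v.1 ^ 2 ≤ neuronSize v ^ 2 := by
    rw [← sq_abs]
    have : |v.1| ≤ neuronSize v := by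
      have := abs_nonneg v.2.2
      have := norm_nonneg (WithLp.toLp 2 v.2.1 : EuclideanSpace ℝ (Fin d))
      unfold neuronSize
      linarith
    gcongr
  have h4 : |2 * v.1 ^ 2 * ((if 0 < drawPreact v.2 z then (1 : ℝ) else 0) *
        (if 0 < drawPreact v.2 z' then (1 : ℝ) else 0)) * (inner ℝ z z' + 1)|
      ≤ 2 * neuronSize v ^ 2 * (R + 1) ^ 2 := by
    rw [abs_mul]
    refine mul_le_mul ?_ h2 (abs_nonneg _) (by positivity)
    rw [abs_of_nonneg (by positivity)]
    split_ifs <;> nlinarith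
  unfold neuronKernel
  calc _ ≤ |2 * (relu (drawPreact v.2 z) * relu (drawPreact v.2 z'))| + _ + |1| := abs_add_three _ _ _
    _ ≤ 2 * (((R + 1) * neuronSize v) * ((R + 1) * neuronSize v))
        + 2 * neuronSize v ^ 2 * (R + 1) ^ 2 + (R + 1) ^ 2 * neuronSize v ^ 2 := by
      rw [abs_mul 2, abs_two, abs_one]
      gcongr
      have h5 : 1 ≤ (R + 1) ^ 2 := by nlinarith
      have h6 : 1 ≤ neuronSize v ^ 2 := by nlinarith
      nlinarith
    _ = _ := by ring

theorem memLp_neuronSize_sq : MemLp (fun v : NeuronDraw d => neuronSize v ^ 2) 2 (neuronLaw d) := by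
  have h : MemLp (neuronSize (d := d)) 4 (neuronLaw d) := memLp_neuronSize 4
  have : ENNReal.HolderTriple 4 4 2 := ⟨by
    rw [← two_mul, show (4 : ℝ≥0∞) = 2 * 2 by norm_num, ENNReal.mul_inv (by simp) (by simp),
      ← mul_assoc, ENNReal.mul_inv_cancel (by simp) (by simp), one_mul]⟩
  have h2 : MemLp (fun v : NeuronDraw d => neuronSize v * neuronSize v) 2 (neuronLaw d) := h.mul' h
  simpa only [sq] using h2

theorem memLp_neuronKernel (z z' : EuclideanSpace ℝ (Fin d)) :
    MemLp (fun v => neuronKernel v z z') 2 (neuronLaw d) := by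
  refine (memLp_neuronSize_sq.const_mul (5 * (max ‖z‖ ‖z'‖ + 1) ^ 2)).mono'
    (measurable_neuronKernel z z').aestronglyMeasurable (Eventually.of_forall fun v => ?_)
  exact abs_neuronKernel_le v (le_max_left _ _) (le_max_right _ _)

/-- The ReLU product contributes half of the angle term and the whole root term. The derivative part
contributes the other half of the angle term, because the outer weight is independent of (w, b) with
second moment 1. -/
theorem integral_neuronKernel (z z' : EuclideanSpace ℝ (Fin d)) :
    ∫ v, neuronKernel v z z' ∂(neuronLaw d) = ntk z z' := by
  have hker := (memLp_neuronKernel z z').integrable one_le_two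
  have hrelu : Integrable (fun v : NeuronDraw d =>
      2 * (relu (drawPreact v.2 z) * relu (drawPreact v.2 z'))) (neuronLaw d) := by
    refine ((memLp_neuronSize_sq.integrable one_le_two).const_mul
      (2 * (max ‖z‖ ‖z'‖ + 1) ^ 2)).mono' ?_ (Eventually.of_forall fun v => ?_)
    · have h1 : ∀ u : EuclideanSpace ℝ (Fin d),
          Measurable fun v : NeuronDraw d => relu (drawPreact v.2 u) := fun u =>
        (continuous_relu.comp (continuous_drawPreact_uncurry.comp
          (continuous_id.prodMk continuous_const))).measurable
      exact (((h1 z).mul (h1 z')).const_mul 2).aestronglyMeasurable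
    · have hs := one_le_neuronSize v
      have hm : 0 ≤ max ‖z‖ ‖z'‖ := (norm_nonneg z).trans (le_max_left _ _)
      rw [Real.norm_eq_abs, abs_of_nonneg (mul_nonneg zero_le_two
        (mul_nonneg (relu_nonneg _) (relu_nonneg _)))]
      have := mul_le_mul ((relu_le_abs _).trans (abs_drawPreact_le v (le_max_left ‖z‖ ‖z'‖)))
        ((relu_le_abs _).trans (abs_drawPreact_le v (le_max_right ‖z‖ ‖z'‖)))
        (relu_nonneg _) (by positivity)
      nlinarith
  have hone : Integrable (fun _ : NeuronDraw d => (1 : ℝ)) (neuronLaw d) := integrable_const 1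
  have hind : Integrable (fun v : NeuronDraw d =>
      2 * v.1 ^ 2 * ((if 0 < drawPreact v.2 z then (1 : ℝ) else 0) *
        (if 0 < drawPreact v.2 z' then (1 : ℝ) else 0)) * (inner ℝ z z' + 1)) (neuronLaw d) := by
    refine ((hker.sub hrelu).sub hone).congr (Eventually.of_forall fun v => ?_)
    simp only [Pi.sub_apply, neuronKernel]
    ring
  unfold neuronKernel
  have hsum := hrelu.add hind
  simp only [Pi.add_def] at hsum
  rw [integral_add hsum hone, integral_add hrelu hind, integral_const_mul,
    integral_mul_const]
  have e1 : ∫ v, relu (drawPreact v.2 z) * relu (drawPreact v.2 z') ∂(neuronLaw d)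
      = ∫ h, relu (drawPreact h z) * relu (drawPreact h z') ∂(hiddenLaw d) := by
    unfold neuronLaw
    rw [integral_fun_snd (fun h => relu (drawPreact h z) * relu (drawPreact h z'))]
    simp
  have e2 : ∫ v : NeuronDraw d, 2 * v.1 ^ 2 * ((if 0 < drawPreact v.2 z then (1 : ℝ) else 0) *
        (if 0 < drawPreact v.2 z' then (1 : ℝ) else 0)) ∂(neuronLaw d)
      = 2 * ∫ h, (if 0 < drawPreact h z then (1 : ℝ) else 0) *
        (if 0 < drawPreact h z' then (1 : ℝ) else 0) ∂(hiddenLaw d) := by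
    unfold neuronLaw
    rw [integral_prod_mul (fun a : ℝ => 2 * a ^ 2) (fun h : HiddenDraw d =>
      (if 0 < drawPreact h z then (1 : ℝ) else 0) * (if 0 < drawPreact h z' then (1 : ℝ) else 0)),
      integral_const_mul]
    have : ∫ a : ℝ, a ^ 2 ∂(gaussianReal 0 1) = 1 := by
      have := variance_id_gaussianReal (μ := 0) (v := 1)
      rw [variance_eq_integral (by fun_prop)] at this
      simpa using this
    rw [this, mul_one]
  rw [e1, e2, integral_hiddenLaw_relu, integral_hiddenLaw_indicator]
  simp only [integral_const, smul_eq_mul, probReal_univ, one_mul, ntk]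
  field_simp
  ring

end Law

/-! ### Continuity and strict positive definiteness of the neural tangent kernel -/

section PosDef

variable {n d : ℕ}

theorem continuous_ntk_uncurry :
    Continuous fun p : EuclideanSpace ℝ (Fin d) × EuclideanSpace ℝ (Fin d) => ntk p.1 p.2 := by
  have h1 : Continuous fun p : EuclideanSpace ℝ (Fin d) × EuclideanSpace ℝ (Fin d) =>
      ntkAngle p.1 p.2 := by
    unfold ntkAngle
    refine Real.continuous_arccos.comp (Continuous.div (by fun_prop) (by fun_prop) fun p => ?_)
    exact (Real.sqrt_pos.2 (by positivity)).ne'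
  unfold ntk
  fun_prop

theorem continuous_ntk_left (x : EuclideanSpace ℝ (Fin d)) : Continuous fun z => ntk z x := by
  have h1 : Continuous fun z : EuclideanSpace ℝ (Fin d) => (z, x) :=
    continuous_id.prodMk continuous_const
  have h2 := continuous_ntk_uncurry.comp h1
  simp only [Function.comp_def] at h2
  exact h2

instance : Measure.IsOpenPosMeasure (gaussianReal 0 1) :=
  (gaussianReal_absolutelyContinuous' 0 one_ne_zero).isOpenPosMeasure

instance : Measure.IsOpenPosMeasure (hiddenLaw d) := by unfold hiddenLaw; infer_instance

instance : Measure.IsOpenPosMeasure (neuronLaw d) := by unfold neuronLaw; infer_instance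

/-- The kernel of one neuron is the Gram kernel of a feature map with ReLU, derivative and constant
components. Its quadratic form is a sum of squares, of which only the ReLU one is retained. -/
theorem sum_mul_sum_neuronKernel_ge (x : Fin n → EuclideanSpace ℝ (Fin d)) (c : Fin n → ℝ)
    (v : NeuronDraw d) :
    2 * (∑ i, c i * relu (drawPreact v.2 (x i))) ^ 2
      ≤ ∑ i, ∑ j, c i * c j * neuronKernel v (x i) (x j) := by
  set p : Fin n → ℝ := fun i => relu (drawPreact v.2 (x i))
  set q : Fin n → ℝ := fun i => if 0 < drawPreact v.2 (x i) then (1 : ℝ) else 0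
  have e1 : ∑ i, ∑ j, c i * c j * neuronKernel v (x i) (x j)
      = 2 * (∑ i, c i * p i) ^ 2 + 2 * v.1 ^ 2 * (∑ i, ∑ j, c i * q i * (c j * q j)
        * inner ℝ (x i) (x j)) + 2 * v.1 ^ 2 * (∑ i, c i * q i) ^ 2 + (∑ i, c i) ^ 2 := by
    have hsq : ∀ f : Fin n → ℝ, (∑ i, f i) ^ 2 = ∑ i, ∑ j, f i * f j := fun f => by
      rw [sq, Finset.sum_mul_sum]
    simp only [hsq, Finset.mul_sum, ← Finset.sum_add_distrib]
    refine Finset.sum_congr rfl fun i _ => Finset.sum_congr rfl fun j _ => ?_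
    simp only [neuronKernel, p, q]
    ring
  have e2 : ∑ i, ∑ j, c i * q i * (c j * q j) * inner ℝ (x i) (x j)
      = ‖∑ i, (c i * q i) • x i‖ ^ 2 := by
    rw [← real_inner_self_eq_norm_sq, sum_inner]
    refine Finset.sum_congr rfl fun i _ => ?_
    rw [inner_sum]
    refine Finset.sum_congr rfl fun j _ => ?_
    rw [real_inner_smul_left, real_inner_smul_right]
    ring
  rw [e1, e2]
  have := sq_nonneg (∑ i, c i)
  have : 0 ≤ 2 * v.1 ^ 2 * ‖∑ i, (c i * q i) • x i‖ ^ 2 := by positivity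
  have : 0 ≤ 2 * v.1 ^ 2 * (∑ i, c i * q i) ^ 2 := by positivity
  linarith

theorem sum_mul_sum_ntk_eq_integral (x : Fin n → EuclideanSpace ℝ (Fin d)) (c : Fin n → ℝ) :
    Integrable (fun v => ∑ i, ∑ j, c i * c j * neuronKernel v (x i) (x j)) (neuronLaw d) ∧
    ∑ i, ∑ j, c i * c j * ntk (x i) (x j)
      = ∫ v, ∑ i, ∑ j, c i * c j * neuronKernel v (x i) (x j) ∂(neuronLaw d) := by
  have h : ∀ i j, Integrable (fun v => c i * c j * neuronKernel v (x i) (x j)) (neuronLaw d) :=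
    fun i j => ((memLp_neuronKernel (x i) (x j)).integrable one_le_two).const_mul _
  refine ⟨integrable_finsetSum _ fun i _ => integrable_finsetSum _ fun j _ => h i j, ?_⟩
  rw [integral_finsetSum _ fun i _ => integrable_finsetSum _ fun j _ => h i j]
  refine Finset.sum_congr rfl fun i _ => ?_
  rw [integral_finsetSum _ fun j _ => h i j]
  refine Finset.sum_congr rfl fun j _ => ?_
  rw [integral_const_mul, integral_neuronKernel]

/-- A real vector space is not a finite union of proper subspaces, here of the hyperplanes
orthogonal to the differences x_j - x_i. -/
theorem exists_inner_sub_ne_zero {x : Fin n → EuclideanSpace ℝ (Fin d)}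
    (hx : Function.Injective x) (i : Fin n) :
    ∃ e : EuclideanSpace ℝ (Fin d), ∀ j, j ≠ i → inner ℝ e (x j - x i) ≠ 0 := by
  classical
  let s : Finset (Submodule ℝ (EuclideanSpace ℝ (Fin d))) :=
    (Finset.univ.filter fun j => j ≠ i).image fun j =>
      LinearMap.ker (innerSL ℝ (x j - x i)).toLinearMap
  have hs : ⊤ ∉ s := by
    intro h
    obtain ⟨j, hj, hk⟩ := Finset.mem_image.1 h
    have hmem : x j - x i ∈ LinearMap.ker (innerSL ℝ (x j - x i)).toLinearMap := by
      rw [hk]; trivial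
    have h0 : inner ℝ (x j - x i) (x j - x i) = 0 := hmem
    rw [inner_self_eq_zero, sub_eq_zero] at h0
    exact (Finset.mem_filter.1 hj).2 (hx h0)
  have hne := Subspace.biUnion_ne_univ_of_top_notMem hs
  obtain ⟨e, he⟩ := (Set.ne_univ_iff_exists_notMem _).1 hne
  refine ⟨e, fun j hj h0 => he ?_⟩
  simp only [Set.mem_iUnion]
  refine ⟨_, Finset.mem_image.2 ⟨j, Finset.mem_filter.2 ⟨Finset.mem_univ j, hj⟩, rfl⟩, ?_⟩
  change inner ℝ (x j - x i) e = 0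
  rwa [real_inner_comm]

theorem relu_second_difference {α ε : ℝ} (hε : 0 < ε) (h : ε < |α|) :
    relu (α + ε) + relu (α - ε) - 2 * relu α = 0 := by
  unfold relu
  rcases lt_abs.1 h with h | h
  · rw [max_eq_left (by linarith), max_eq_left (by linarith), max_eq_left (by linarith)]; ring
  · rw [max_eq_right (by linarith), max_eq_right (by linarith), max_eq_right (by linarith)]; ring

/-- Ridge functions `h ↦ relu (⟨w, x_i⟩ + b)` of distinct points are linearly independent. -/
theorem eq_zero_of_sum_relu_eq_zero {x : Fin n → EuclideanSpace ℝ (Fin d)}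
    (hx : Function.Injective x) {c : Fin n → ℝ}
    (h : ∀ v : HiddenDraw d, ∑ i, c i * relu (drawPreact v (x i)) = 0) : c = 0 := by
  funext i
  obtain ⟨e, he⟩ := exists_inner_sub_ne_zero hx i
  have hev : ∀ᶠ ε : ℝ in 𝓝[>] 0, ∀ j, j ≠ i → ε < |inner ℝ e (x j - x i)| := by
    refine eventually_all.2 fun j => ?_
    by_cases hj : j = i
    · exact Eventually.of_forall fun _ h => absurd hj h
    · have := abs_pos.2 (he j hj)
      filter_upwards [mem_nhdsWithin_of_mem_nhds (gt_mem_nhds this)] with ε hε _ using hε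
  obtain ⟨ε, hε, hpos : 0 < ε⟩ := (hev.and self_mem_nhdsWithin).exists
  -- The neurons with w = `e` and bias τ - ⟨e, x_i⟩ put the kink of the i-th summand at τ = 0, while
  -- all other kinks are farther than ε from 0. The second difference at 0 with step ε then
  -- annihilates every summand but the i-th.
  have hline : ∀ τ : ℝ, ∑ j, c j * relu (inner ℝ e (x j - x i) + τ) = 0 := by
    intro τ
    rw [← h (e.ofLp, τ - inner ℝ e (x i))]
    refine Finset.sum_congr rfl fun j _ => ?_
    simp only [drawPreact, inner_sub_right]
    congr 2
    ring
  have hsum : ∑ j, c j * (relu (inner ℝ e (x j - x i) + ε) + relu (inner ℝ e (x j - x i) - ε)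
      - 2 * relu (inner ℝ e (x j - x i))) = 0 := by
    have h1 := hline ε
    have h2 := hline (-ε)
    have h3 := hline 0
    simp only [add_zero, ← sub_eq_add_neg] at h2 h3
    simp only [mul_sub, mul_add, Finset.sum_sub_distrib, Finset.sum_add_distrib, h1, h2,
      mul_left_comm _ (2 : ℝ), ← Finset.mul_sum, h3]
    ring
  rw [Finset.sum_eq_single i (fun j _ hj => by
    rw [relu_second_difference hpos (hε j hj), mul_zero]) (by simp)] at hsum
  have hi : relu (inner ℝ e (x i - x i) + ε) + relu (inner ℝ e (x i - x i) - ε)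
      - 2 * relu (inner ℝ e (x i - x i)) = ε := by
    simp [relu, hpos.le]
  rw [hi] at hsum
  simpa using (mul_eq_zero.1 hsum).resolve_right hpos.ne'

/-- If the quadratic form vanished, then ∑ c_i relu(⟨w, x_i⟩ + b) would vanish almost surely. By
continuity and the full support of the Gaussian law it would vanish everywhere, contrary to the
linear independence of ridge functions. -/
theorem ntk_strictly_posDef {x : Fin n → EuclideanSpace ℝ (Fin d)} (hx : Function.Injective x)
    {c : Fin n → ℝ} (hc : c ≠ 0) : 0 < ∑ i, ∑ j, c i * c j * ntk (x i) (x j) := by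
  obtain ⟨hint, heq⟩ := sum_mul_sum_ntk_eq_integral x c
  have hge := sum_mul_sum_neuronKernel_ge x c
  have h0 : 0 ≤ fun v => ∑ i, ∑ j, c i * c j * neuronKernel v (x i) (x j) := fun v =>
    (by positivity : (0 : ℝ) ≤ 2 * (∑ i, c i * relu (drawPreact v.2 (x i))) ^ 2).trans (hge v)
  rw [heq]
  refine lt_of_le_of_ne (integral_nonneg h0) fun hzero => hc ?_
  have hae := (integral_eq_zero_iff_of_nonneg h0 hint).1 hzero.symm
  have hcont : Continuous fun v : NeuronDraw d =>
      ∑ i, c i * relu (drawPreact v.2 (x i)) := by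
    refine continuous_finsetSum _ fun i _ => continuous_const.mul (continuous_relu.comp ?_)
    exact continuous_drawPreact_uncurry.comp (continuous_id.prodMk continuous_const)
  have hae2 : (fun v : NeuronDraw d => ∑ i, c i * relu (drawPreact v.2 (x i)))
      =ᵐ[neuronLaw d] fun _ => 0 := by
    filter_upwards [hae] with v hv
    have h1 := hge v
    have h2 : ∑ i, ∑ j, c i * c j * neuronKernel v (x i) (x j) = 0 := hv
    rw [h2] at h1
    exact pow_eq_zero_iff two_ne_zero |>.1 (le_antisymm (by linarith) (sq_nonneg _))
  have hall := (hcont.ae_eq_iff_eq _ continuous_const).1 hae2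
  exact eq_zero_of_sum_relu_eq_zero hx fun v => congrFun hall (0, v)

theorem exists_ntk_coercive {x : Fin n → EuclideanSpace ℝ (Fin d)} (hx : Function.Injective x) :
    ∃ lam : ℝ, 0 < lam ∧ ∀ c : Fin n → ℝ,
      lam * ∑ i, c i ^ 2 ≤ ∑ i, ∑ j, c i * c j * ntk (x i) (x j) := by
  let Q : EuclideanSpace ℝ (Fin n) → ℝ := fun c => ∑ i, ∑ j, c i * c j * ntk (x i) (x j)
  have hQ : Continuous Q := by fun_prop
  have hpos : ∀ c : EuclideanSpace ℝ (Fin n), c ≠ 0 → 0 < Q c := fun c hc =>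
    ntk_strictly_posDef hx (c := c.ofLp) fun h => hc (by ext i; exact congrFun h i)
  have hlam : ∃ lam : ℝ, 0 < lam ∧ ∀ c ∈ Metric.sphere (0 : EuclideanSpace ℝ (Fin n)) 1,
      lam ≤ Q c := by
    -- The sphere is empty exactly when there are no sample points; otherwise the constant is the
    -- minimum of the form on it.
    rcases (Metric.sphere (0 : EuclideanSpace ℝ (Fin n)) 1).eq_empty_or_nonempty with h | h
    · exact ⟨1, one_pos, by simp [h]⟩
    · obtain ⟨c, hc, hmin⟩ := (isCompact_sphere 0 1).exists_isMinOn h hQ.continuousOn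
      refine ⟨Q c, hpos c fun h0 => ?_, fun b hb => hmin hb⟩
      simp [h0] at hc
  obtain ⟨lam, hl, hmin⟩ := hlam
  refine ⟨lam, hl, fun c => ?_⟩
  set b : EuclideanSpace ℝ (Fin n) := WithLp.toLp 2 c
  have hb : ∑ i, c i ^ 2 = ‖b‖ ^ 2 := (EuclideanSpace.real_norm_sq_eq b).symm
  rw [hb]
  by_cases h0 : b = 0
  · have hc : c = 0 := by
      funext i; exact congrFun (congrArg WithLp.ofLp h0) i
    simp [h0, hc]
  · have hn : 0 < ‖b‖ := norm_pos_iff.2 h0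
    have h1 := hmin (‖b‖⁻¹ • b) (by simp [norm_smul, hn.ne'])
    have h2 : Q (‖b‖⁻¹ • b) = ‖b‖⁻¹ ^ 2 * ∑ i, ∑ j, c i * c j * ntk (x i) (x j) := by
      simp only [Q, Finset.mul_sum]
      refine Finset.sum_congr rfl fun i _ => Finset.sum_congr rfl fun j _ => ?_
      simp only [PiLp.smul_apply, smul_eq_mul, b]
      ring
    rw [h2, inv_pow, ← div_eq_inv_mul, le_div_iff₀ (by positivity)] at h1
    exact h1

theorem isUnit_det_ntkGram {x : Fin n → EuclideanSpace ℝ (Fin d)} (hx : Function.Injective x) :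
    IsUnit (ntkGram x).det := by
  rw [isUnit_iff_ne_zero]
  intro h
  obtain ⟨c, hc, h0⟩ := Matrix.exists_mulVec_eq_zero_iff.2 h
  have hpos := ntk_strictly_posDef hx hc
  have : ∑ i, ∑ j, c i * c j * ntk (x i) (x j) = c ⬝ᵥ (ntkGram x *ᵥ c) := by
    simp only [dotProduct, Matrix.mulVec, ntkGram, Matrix.of_apply, Finset.mul_sum]
    exact Finset.sum_congr rfl fun i _ => Finset.sum_congr rfl fun j _ => by ring
  rw [this, h0, dotProduct_zero] at hpos
  exact lt_irrefl _ hpos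

end PosDef

/-! ### Concentration of the tangent kernel at initialization -/

section Concentration

variable {n m d : ℕ}

/-- The neurons of a draw. -/
def drawNeurons (g : InitDraw m d) : Fin m → NeuronDraw d := fun r => (g.1 r, g.2.1 r, g.2.2 r)

/-- Regrouping the three independent arrays by neuron gives independent identically distributed
neurons, the form in which variances of empirical means are computed. -/
theorem measurePreserving_drawNeurons :
    MeasurePreserving (drawNeurons (m := m) (d := d)) (initLaw m d)
      (Measure.pi fun _ => neuronLaw d) := by
  have h1 := (measurePreserving_arrowProdEquivProdArrow (Fin d → ℝ) ℝ (Fin m)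
    (fun _ => Measure.pi fun _ : Fin d => gaussianReal 0 1) (fun _ => gaussianReal 0 1)).symm
  have h2 := (measurePreserving_arrowProdEquivProdArrow ℝ (HiddenDraw d) (Fin m)
    (fun _ => gaussianReal 0 1) (fun _ => hiddenLaw d)).symm
  have h3 := (MeasurePreserving.id (Measure.pi fun _ : Fin m => gaussianReal 0 1)).prod h1
  exact h2.comp h3

/-- The (doubled) weight with which a neuron can contribute to the change of the tangent kernel if
its parameters move by at most `β` times its size. -/
noncomputable def flipWeight (K R β : ℝ) (v : NeuronDraw d) (z z' : EuclideanSpace ℝ (Fin d)) : ℝ :=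
  K * neuronSize v ^ 2 * (β + (if |drawPreact v.2 z| ≤ β * ((R + 1) * neuronSize v) then 1 else 0)
    + (if |drawPreact v.2 z'| ≤ β * ((R + 1) * neuronSize v) then 1 else 0))

/-- A bound for the distance of the tangent kernel to its limit, valid as long as all the
parameters move by at most `β` times the size of their neurons. -/
noncomputable def kernelError (K R β : ℝ) (g : Fin m → NeuronDraw d)
    (z z' : EuclideanSpace ℝ (Fin d)) : ℝ :=
  |1 / (m : ℝ) * ∑ r, neuronKernel (g r) z z' - ntk z z'|
    + 1 / (m : ℝ) * ∑ r, flipWeight K R β (g r) z z'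

theorem flipWeight_nonneg {K R β : ℝ} (hK : 0 ≤ K) (hβ : 0 ≤ β) (v : NeuronDraw d)
    (z z' : EuclideanSpace ℝ (Fin d)) : 0 ≤ flipWeight K R β v z z' := by
  unfold flipWeight
  split_ifs <;> positivity

theorem flipWeight_le {K R β : ℝ} (hK : 0 ≤ K) (hβ1 : β ≤ 1) (v : NeuronDraw d)
    (z z' : EuclideanSpace ℝ (Fin d)) : flipWeight K R β v z z' ≤ 3 * K * neuronSize v ^ 2 := by
  have h : 0 ≤ K * neuronSize v ^ 2 := by positivity
  unfold flipWeight
  split_ifs <;> nlinarith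

theorem measurable_flipWeight_uncurry (K R β : ℝ) (z' : EuclideanSpace ℝ (Fin d)) :
    Measurable fun p : NeuronDraw d × EuclideanSpace ℝ (Fin d) => flipWeight K R β p.1 p.2 z' := by
  have h1 : Measurable fun p : NeuronDraw d × EuclideanSpace ℝ (Fin d) => |drawPreact p.1.2 p.2| :=
    continuous_drawPreact_uncurry.abs.measurable
  have h2 : Measurable fun p : NeuronDraw d × EuclideanSpace ℝ (Fin d) => |drawPreact p.1.2 z'| :=
    (continuous_drawPreact_uncurry.comp (continuous_fst.prodMk continuous_const)).abs.measurable
  have h3 : Measurable fun p : NeuronDraw d × EuclideanSpace ℝ (Fin d) => neuronSize p.1 :=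
    continuous_neuronSize.measurable.comp measurable_fst
  have h4 : Measurable fun p : NeuronDraw d × EuclideanSpace ℝ (Fin d) =>
      if |drawPreact p.1.2 p.2| ≤ β * ((R + 1) * neuronSize p.1) then (1 : ℝ) else 0 :=
    Measurable.ite (measurableSet_le h1 ((h3.const_mul (R + 1)).const_mul β))
      measurable_const measurable_const
  have h5 : Measurable fun p : NeuronDraw d × EuclideanSpace ℝ (Fin d) =>
      if |drawPreact p.1.2 z'| ≤ β * ((R + 1) * neuronSize p.1) then (1 : ℝ) else 0 :=
    Measurable.ite (measurableSet_le h2 ((h3.const_mul (R + 1)).const_mul β))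
      measurable_const measurable_const
  unfold flipWeight
  exact ((h3.pow_const 2).const_mul K).mul ((h4.const_add β).add h5)

theorem measurable_flipWeight (K R β : ℝ) (z z' : EuclideanSpace ℝ (Fin d)) :
    Measurable fun v : NeuronDraw d => flipWeight K R β v z z' := by
  have h1 : Measurable fun v : NeuronDraw d => (v, z) := measurable_id.prodMk measurable_const
  have h2 := (measurable_flipWeight_uncurry K R β z').comp h1
  simp only [Function.comp_def] at h2
  exact h2

theorem measurable_kernelError_uncurry (K R β : ℝ) (z' : EuclideanSpace ℝ (Fin d)) :
    Measurable fun p : (Fin m → NeuronDraw d) × EuclideanSpace ℝ (Fin d) =>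
      kernelError K R β p.1 p.2 z' := by
  have h0 : ∀ r : Fin m, Measurable fun p : (Fin m → NeuronDraw d) × EuclideanSpace ℝ (Fin d) =>
      (p.1 r, p.2) := fun r => ((measurable_pi_apply r).comp measurable_fst).prodMk measurable_snd
  have h1 := fun r : Fin m => (measurable_neuronKernel_uncurry z').comp (h0 r)
  have h2 := fun r : Fin m => (measurable_flipWeight_uncurry K R β z').comp (h0 r)
  have h3 : Measurable fun p : (Fin m → NeuronDraw d) × EuclideanSpace ℝ (Fin d) => ntk p.2 z' :=
    (continuous_ntk_left z').measurable.comp measurable_snd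
  simp only [Function.comp_def] at h1 h2
  unfold kernelError
  have h4 := Finset.measurable_sum Finset.univ fun r _ => h1 r
  have h5 := Finset.measurable_sum Finset.univ fun r _ => h2 r
  exact ((h4.const_mul _).sub h3).abs.add (h5.const_mul _)

theorem memLp_flipWeight {K R β : ℝ} (hK : 0 ≤ K) (hβ : 0 ≤ β) (hβ1 : β ≤ 1)
    (z z' : EuclideanSpace ℝ (Fin d)) :
    MemLp (fun v => flipWeight K R β v z z') 2 (neuronLaw d) := by
  refine (memLp_neuronSize_sq.const_mul (3 * K)).mono'
    (measurable_flipWeight K R β z z').aestronglyMeasurable (Eventually.of_forall fun v => ?_)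
  rw [Real.norm_of_nonneg (flipWeight_nonneg hK hβ v z z')]
  exact flipWeight_le hK hβ1 v z z'

/-- Second moment bound for an empirical mean around its expectation plus an empirical mean of
nonnegative variables. -/
theorem lintegral_sq_empirical_le {Ω : Type*} [MeasurableSpace Ω] {ν : Measure Ω}
    [IsProbabilityMeasure ν] {X Y : Ω → ℝ} (hX : MemLp X 2 ν) (hY : MemLp Y 2 ν) (hm : m ≠ 0) :
    ∫⁻ g, ENNReal.ofReal ((|1 / (m : ℝ) * ∑ r, X (g r) - ∫ v, X v ∂ν|
        + 1 / (m : ℝ) * ∑ r, Y (g r)) ^ 2) ∂(Measure.pi fun _ : Fin m => ν)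
      ≤ ENNReal.ofReal (2 * (Var[X; ν] / m) + 2 * ∫ v, Y v ^ 2 ∂ν) := by
  have hm0 : (0 : ℝ) < m := by exact_mod_cast Nat.pos_of_ne_zero hm
  set P : Measure (Fin m → Ω) := Measure.pi fun _ : Fin m => ν
  have hXr : ∀ r : Fin m, MemLp (fun g : Fin m → Ω => X (g r)) 2 P := fun r =>
    hX.comp_measurePreserving (measurePreserving_eval _ r)
  have hXint : ∀ r : Fin m, ∫ g, X (g r) ∂P = ∫ v, X v ∂ν := fun r =>
    integral_comp_eval (μ := fun _ : Fin m => ν) (i := r) (f := X) hX.aestronglyMeasurable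
  have hYr : ∀ r : Fin m, MemLp (fun g : Fin m → Ω => Y (g r)) 2 P := fun r =>
    hY.comp_measurePreserving (measurePreserving_eval _ r)
  have hS : MemLp (fun g : Fin m → Ω => 1 / (m : ℝ) * ∑ r, X (g r)) 2 P :=
    (memLp_finsetSum _ fun r _ => hXr r).const_mul _
  have hmean : ∫ g, 1 / (m : ℝ) * ∑ r, X (g r) ∂P = ∫ v, X v ∂ν := by
    rw [integral_const_mul, integral_finsetSum _ fun r _ => (hXr r).integrable one_le_two]
    simp only [hXint, Finset.sum_const, Finset.card_univ, Fintype.card_fin, nsmul_eq_mul]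
    field_simp
  have hvar : ∫ g, (1 / (m : ℝ) * ∑ r, X (g r) - ∫ v, X v ∂ν) ^ 2 ∂P = Var[X; ν] / m := by
    have h1 := variance_eq_integral hS.aestronglyMeasurable.aemeasurable
    rw [hmean] at h1
    rw [← h1, variance_const_mul]
    -- Independence of the neurons enters only here: it gives the factor 1/m in the variance of the
    -- mean of `X`.
    have h2 := variance_sum_pi (μ := fun _ : Fin m => ν) (X := fun _ => X) fun _ => hX
    have h3 : (∑ r, fun ω : Fin m → Ω => X (ω r)) = fun g : Fin m → Ω => ∑ r, X (g r) := by
      ext g; simp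
    rw [h3] at h2
    rw [h2, Finset.sum_const, Finset.card_univ, Fintype.card_fin, nsmul_eq_mul]
    field_simp
  have hYsq : ∀ r : Fin m, Integrable (fun g : Fin m → Ω => Y (g r) ^ 2) P := fun r =>
    (hYr r).integrable_sq
  have hYint : ∀ r : Fin m, ∫ g, Y (g r) ^ 2 ∂P = ∫ v, Y v ^ 2 ∂ν := fun r =>
    integral_comp_eval (μ := fun _ : Fin m => ν) (i := r) (f := fun v => Y v ^ 2)
      hY.integrable_sq.aestronglyMeasurable
  have hSsq : Integrable (fun g : Fin m → Ω =>
      (1 / (m : ℝ) * ∑ r, X (g r) - ∫ v, X v ∂ν) ^ 2) P := (hS.sub (memLp_const _)).integrable_sq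
  have hYsum : Integrable (fun g : Fin m → Ω => 1 / (m : ℝ) * ∑ r, Y (g r) ^ 2) P :=
    (integrable_finsetSum _ fun r _ => hYsq r).const_mul _
  have hRHS : ∫ g, (2 * (1 / (m : ℝ) * ∑ r, X (g r) - ∫ v, X v ∂ν) ^ 2
      + 2 * (1 / (m : ℝ) * ∑ r, Y (g r) ^ 2)) ∂P = 2 * (Var[X; ν] / m) + 2 * ∫ v, Y v ^ 2 ∂ν := by
    rw [integral_add (hSsq.const_mul 2) (hYsum.const_mul 2), integral_const_mul, integral_const_mul,
      hvar, integral_const_mul, integral_finsetSum _ fun r _ => hYsq r]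
    simp only [hYint, Finset.sum_const, Finset.card_univ, Fintype.card_fin, nsmul_eq_mul]
    field_simp
  have hnn : ∀ g : Fin m → Ω, 0 ≤ 2 * (1 / (m : ℝ) * ∑ r, X (g r) - ∫ v, X v ∂ν) ^ 2
      + 2 * (1 / (m : ℝ) * ∑ r, Y (g r) ^ 2) := fun g => by
    have : 0 ≤ ∑ r, Y (g r) ^ 2 := Finset.sum_nonneg fun r _ => sq_nonneg _
    positivity
  have hint := (hSsq.const_mul 2).add (hYsum.const_mul 2)
  simp only [Pi.add_def] at hint
  rw [← hRHS, ofReal_integral_eq_lintegral_ofReal hint (Eventually.of_forall hnn)]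
  refine lintegral_mono fun g => ENNReal.ofReal_le_ofReal ?_
  set A := 1 / (m : ℝ) * ∑ r, X (g r) - ∫ v, X v ∂ν
  -- No centring is needed for `Y`, whose second moment will itself tend to zero; Cauchy-Schwarz is
  -- enough.
  have hcs : (1 / (m : ℝ) * ∑ r, Y (g r)) ^ 2 ≤ 1 / (m : ℝ) * ∑ r, Y (g r) ^ 2 := by
    have h := sq_sum_le_card_mul_sum_sq (s := (Finset.univ : Finset (Fin m))) (f := fun r => Y (g r))
    rw [Finset.card_univ, Fintype.card_fin] at h
    rw [mul_pow]
    calc (1 / (m : ℝ)) ^ 2 * (∑ r, Y (g r)) ^ 2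
        ≤ (1 / (m : ℝ)) ^ 2 * (m * ∑ r, Y (g r) ^ 2) := by gcongr
      _ = _ := by field_simp
  have := sq_abs A
  nlinarith [sq_nonneg (|A| - 1 / (m : ℝ) * ∑ r, Y (g r))]

/-- For fixed w the pre-activation vanishes for one value of the bias only, and the Gaussian law of
the bias has no atoms. -/
theorem ae_drawPreact_ne_zero (z : EuclideanSpace ℝ (Fin d)) :
    ∀ᵐ v ∂(neuronLaw d), drawPreact v.2 z ≠ 0 := by
  have h1 : Measurable fun h : HiddenDraw d => drawPreact h z := by
    have h2 : Measurable fun h : HiddenDraw d => (((0 : ℝ), h), z) :=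
      (measurable_const.prodMk measurable_id).prodMk measurable_const
    have h3 := (continuous_drawPreact_uncurry (d := d)).measurable.comp h2
    simp only [Function.comp_def] at h3
    exact h3
  have hms : MeasurableSet {h : HiddenDraw d | drawPreact h z = 0} := h1 (measurableSet_singleton 0)
  have h2 : ∀ᵐ h ∂(hiddenLaw d), drawPreact h z ≠ 0 := by
    rw [ae_iff]
    simp only [not_not]
    unfold hiddenLaw
    rw [Measure.measure_prod_null hms]
    refine Eventually.of_forall fun w => ?_
    have : Prod.mk w ⁻¹' {h : HiddenDraw d | drawPreact h z = 0}
        = {-inner ℝ (WithLp.toLp 2 w : EuclideanSpace ℝ (Fin d)) z} := by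
      ext b
      simp only [Set.mem_preimage, Set.mem_ofPred_eq, Set.mem_singleton_iff, drawPreact]
      constructor <;> intro h <;> linarith
    simp only [this, Pi.zero_apply]
    have := nullSingletonClass_gaussianReal (μ := 0) (v := 1) one_ne_zero
    exact measure_singleton _
  unfold neuronLaw
  exact Measure.quasiMeasurePreserving_snd.ae h2

/-- Dominated convergence: unless an initial pre-activation is exactly zero, both indicators are
eventually zero as β tends to 0. No rate, and no anti-concentration estimate, is needed. -/
theorem tendsto_integral_flipWeight_sq {K R : ℝ} (hK : 0 ≤ K) {β : ℕ → ℝ} (hβ0 : ∀ m, 0 ≤ β m)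
    (hβ : Tendsto β atTop (𝓝 0)) (z z' : EuclideanSpace ℝ (Fin d)) :
    Tendsto (fun m => ∫ v, flipWeight K R (β m) v z z' ^ 2 ∂(neuronLaw d)) atTop (𝓝 0) := by
  have hβ1 : ∀ᶠ m in atTop, β m ≤ 1 :=
    (hβ.eventually_lt_const one_pos).mono fun _ h => h.le
  rw [show (0 : ℝ) = ∫ _ : NeuronDraw d, (0 : ℝ) ∂(neuronLaw d) by simp]
  refine tendsto_integral_filter_of_dominated_convergence
    (fun v => (3 * K * neuronSize v ^ 2) ^ 2) ?_ ?_ ?_ ?_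
  · exact Eventually.of_forall fun m =>
      ((measurable_flipWeight K R (β m) z z').pow_const 2).aestronglyMeasurable
  · filter_upwards [hβ1] with m hm
    refine Eventually.of_forall fun v => ?_
    have h0 := flipWeight_nonneg (R := R) hK (hβ0 m) v z z'
    rw [Real.norm_of_nonneg (by positivity)]
    exact pow_le_pow_left₀ h0 (flipWeight_le hK hm v z z') 2
  · exact (memLp_neuronSize_sq.const_mul (3 * K)).integrable_sq
  · filter_upwards [ae_drawPreact_ne_zero z, ae_drawPreact_ne_zero z'] with v hv hv'
    have hlim : Tendsto (fun m => β m * ((R + 1) * neuronSize v)) atTop (𝓝 0) := by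
      simpa using hβ.mul_const ((R + 1) * neuronSize v)
    have h1 : Tendsto (fun m => (K * neuronSize v ^ 2 * β m) ^ 2) atTop (𝓝 0) := by
      simpa using ((hβ.const_mul (K * neuronSize v ^ 2)).pow 2)
    refine h1.congr' ?_
    filter_upwards [hlim.eventually_lt_const (abs_pos.2 hv),
      hlim.eventually_lt_const (abs_pos.2 hv')] with m hm hm'
    rw [flipWeight, if_neg (not_le.2 hm), if_neg (not_le.2 hm'), add_zero, add_zero]

/-- The total squared error of the tangent kernel between `z` and the sample points. -/
noncomputable def totalKernelError (x : Fin n → EuclideanSpace ℝ (Fin d)) (K R β : ℝ)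
    (g : Fin m → NeuronDraw d) (z : EuclideanSpace ℝ (Fin d)) : ℝ :=
  ∑ i, kernelError K R β g z (x i) ^ 2

theorem measurable_totalKernelError_uncurry (x : Fin n → EuclideanSpace ℝ (Fin d)) (K R β : ℝ) :
    Measurable fun p : (Fin m → NeuronDraw d) × EuclideanSpace ℝ (Fin d) =>
      totalKernelError x K R β p.1 p.2 := by
  unfold totalKernelError
  exact Finset.measurable_sum _ fun i _ => (measurable_kernelError_uncurry K R β (x i)).pow_const 2

/-- The bound for the expectation of the total squared error. -/
noncomputable def kernelErrorBound (x : Fin n → EuclideanSpace ℝ (Fin d)) (K R : ℝ) (β : ℕ → ℝ)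
    (z : EuclideanSpace ℝ (Fin d)) (m : ℕ) : ℝ :=
  ∑ i, (2 * (Var[fun v => neuronKernel v z (x i); neuronLaw d] / m)
    + 2 * ∫ v, flipWeight K R (β m) v z (x i) ^ 2 ∂(neuronLaw d))

theorem lintegral_totalKernelError_le (x : Fin n → EuclideanSpace ℝ (Fin d)) {K R : ℝ} (hK : 0 ≤ K)
    {β : ℕ → ℝ} (hβ : 0 ≤ β m) (hβ1 : β m ≤ 1) (hm : m ≠ 0) (z : EuclideanSpace ℝ (Fin d)) :
    ∫⁻ g, ENNReal.ofReal (totalKernelError x K R (β m) g z) ∂(Measure.pi fun _ : Fin m => neuronLaw d)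
      ≤ ENNReal.ofReal (kernelErrorBound x K R β z m) := by
  unfold totalKernelError kernelErrorBound
  simp only [ENNReal.ofReal_sum_of_nonneg fun (i : Fin n) _ => sq_nonneg (kernelError K R (β m) _ z (x i))]
  have hmeas : ∀ i : Fin n, Measurable fun g : Fin m → NeuronDraw d =>
      ENNReal.ofReal (kernelError K R (β m) g z (x i) ^ 2) := fun i => by
    have h1 : Measurable fun g : Fin m → NeuronDraw d => (g, z) :=
      measurable_id.prodMk measurable_const
    have h2 := ((measurable_kernelError_uncurry K R (β m) (x i)).comp h1).pow_const 2
    simp only [Function.comp_def] at h2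
    exact h2.ennreal_ofReal
  rw [lintegral_finsetSum _ fun i _ => hmeas i, ENNReal.ofReal_sum_of_nonneg]
  · refine Finset.sum_le_sum fun i _ => ?_
    have h := lintegral_sq_empirical_le (memLp_neuronKernel z (x i))
      (memLp_flipWeight (R := R) hK hβ hβ1 z (x i)) hm
    rw [integral_neuronKernel] at h
    exact h
  · intro i _
    have h1 := variance_nonneg (fun v => neuronKernel v z (x i)) (neuronLaw d)
    have h2 : 0 ≤ ∫ v, flipWeight K R (β m) v z (x i) ^ 2 ∂(neuronLaw d) :=
      integral_nonneg fun v => sq_nonneg _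
    positivity

theorem tendsto_kernelErrorBound (x : Fin n → EuclideanSpace ℝ (Fin d)) {K R : ℝ} (hK : 0 ≤ K)
    {β : ℕ → ℝ} (hβ0 : ∀ m, 0 ≤ β m) (hβ : Tendsto β atTop (𝓝 0)) (z : EuclideanSpace ℝ (Fin d)) :
    Tendsto (kernelErrorBound x K R β z) atTop (𝓝 0) := by
  unfold kernelErrorBound
  rw [show (0 : ℝ) = ∑ _i : Fin n, (2 * 0 + 2 * 0) by simp]
  refine tendsto_finsetSum _ fun i _ => Tendsto.add (Tendsto.const_mul 2 ?_) (Tendsto.const_mul 2 ?_)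
  · exact tendsto_const_div_atTop_nhds_zero_nat _
  · exact tendsto_integral_flipWeight_sq hK hβ0 hβ z (x i)

/-- A bound independent of `z` in the ball and of `m`, used as the dominating constant when the
expected error is integrated over `z`. -/
theorem kernelErrorBound_le (x : Fin n → EuclideanSpace ℝ (Fin d)) {K R : ℝ} (hK : 0 ≤ K)
    (hx : ∀ i, ‖x i‖ ≤ R) {β : ℕ → ℝ} (hβ : 0 ≤ β m) (hβ1 : β m ≤ 1) (hm : m ≠ 0)
    {z : EuclideanSpace ℝ (Fin d)} (hz : ‖z‖ ≤ R) :
    kernelErrorBound x K R β z m ≤ n * ((50 * (R + 1) ^ 4 + 18 * K ^ 2)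
      * ∫ v, (neuronSize v ^ 2) ^ 2 ∂(neuronLaw d)) := by
  have hI := (memLp_neuronSize_sq (d := d)).integrable_sq
  have hI0 : 0 ≤ ∫ v, (neuronSize v ^ 2) ^ 2 ∂(neuronLaw d) := integral_nonneg fun v => sq_nonneg _
  unfold kernelErrorBound
  have hterm : ∀ i ∈ (Finset.univ : Finset (Fin n)),
      (2 * (Var[fun v => neuronKernel v z (x i); neuronLaw d] / m)
        + 2 * ∫ v, flipWeight K R (β m) v z (x i) ^ 2 ∂(neuronLaw d))
      ≤ (50 * (R + 1) ^ 4 + 18 * K ^ 2) * ∫ v, (neuronSize v ^ 2) ^ 2 ∂(neuronLaw d) := by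
    intro i _
    have h1 : Var[fun v => neuronKernel v z (x i); neuronLaw d]
        ≤ 25 * (R + 1) ^ 4 * ∫ v, (neuronSize v ^ 2) ^ 2 ∂(neuronLaw d) := by
      refine (variance_le_expectation_sq
        (measurable_neuronKernel z (x i)).aestronglyMeasurable).trans ?_
      rw [← integral_const_mul]
      refine integral_mono (memLp_neuronKernel z (x i)).integrable_sq (hI.const_mul _) fun v => ?_
      have h2 := abs_neuronKernel_le v hz (hx i)
      simp only [Pi.pow_apply]
      rw [← sq_abs]
      calc |neuronKernel v z (x i)| ^ 2 ≤ (5 * (R + 1) ^ 2 * neuronSize v ^ 2) ^ 2 := by gcongr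
        _ = _ := by ring
    have h2 : ∫ v, flipWeight K R (β m) v z (x i) ^ 2 ∂(neuronLaw d)
        ≤ 9 * K ^ 2 * ∫ v, (neuronSize v ^ 2) ^ 2 ∂(neuronLaw d) := by
      rw [← integral_const_mul]
      refine integral_mono (memLp_flipWeight hK hβ hβ1 z (x i)).integrable_sq (hI.const_mul _)
        fun v => ?_
      have h3 := flipWeight_nonneg (R := R) hK hβ v z (x i)
      calc flipWeight K R (β m) v z (x i) ^ 2 ≤ (3 * K * neuronSize v ^ 2) ^ 2 :=
            pow_le_pow_left₀ h3 (flipWeight_le hK hβ1 v z (x i)) 2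
        _ = _ := by ring
    have h3 : Var[fun v => neuronKernel v z (x i); neuronLaw d] / m
        ≤ Var[fun v => neuronKernel v z (x i); neuronLaw d] :=
      div_le_self (variance_nonneg _ _) (by exact_mod_cast Nat.one_le_iff_ne_zero.2 hm)
    linarith
  refine (Finset.sum_le_card_nsmul _ _ _ hterm).trans_eq ?_
  rw [Finset.card_univ, Fintype.card_fin, nsmul_eq_mul]

/-- The tangent kernel at initialization and everything that it can become during training are close
to the limit kernel in mean square, with probability tending to one. -/
theorem tendsto_initLaw_totalKernelError (x : Fin n → EuclideanSpace ℝ (Fin d)) {K R : ℝ}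
    (hK : 0 ≤ K) (hx : ∀ i, ‖x i‖ ≤ R) {β : ℕ → ℝ} (hβ0 : ∀ m, 0 ≤ β m)
    (hβ : Tendsto β atTop (𝓝 0)) (μ : Measure (EuclideanSpace ℝ (Fin d))) [IsFiniteMeasure μ]
    (hμ : ∀ᵐ z ∂μ, ‖z‖ ≤ R) {κ : ℝ≥0∞} (hκ : κ ≠ 0) (hκ' : κ ≠ ∞) :
    Tendsto (fun m => initLaw m d {g | κ ≤ ∫⁻ z, ENNReal.ofReal
      (totalKernelError x K R (β m) (drawNeurons g) z) ∂μ}) atTop (𝓝 0) := by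
  have hβ1 : ∀ᶠ m in atTop, β m ≤ 1 :=
    (hβ.eventually_lt_const one_pos).mono fun _ h => h.le
  set P : ∀ m : ℕ, Measure (Fin m → NeuronDraw d) := fun m => Measure.pi fun _ => neuronLaw d with hP
  have hjoint : ∀ m, Measurable fun p : (Fin m → NeuronDraw d) × EuclideanSpace ℝ (Fin d) =>
      ENNReal.ofReal (totalKernelError x K R (β m) p.1 p.2) := fun m =>
    (measurable_totalKernelError_uncurry x K R (β m)).ennreal_ofReal
  have hmeasg : ∀ m, Measurable fun g : Fin m → NeuronDraw d =>
      ∫⁻ z, ENNReal.ofReal (totalKernelError x K R (β m) g z) ∂μ := fun m =>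
    (hjoint m).lintegral_prod_right'
  -- The expected error tends to zero for each fixed `z` and is bounded uniformly on the ball that
  -- carries `μ`, so dominated convergence applies in `z`.
  have hlim : Tendsto (fun m => ∫⁻ z, ∫⁻ g, ENNReal.ofReal (totalKernelError x K R (β m) g z) ∂(P m) ∂μ)
      atTop (𝓝 0) := by
    rw [show (0 : ℝ≥0∞) = ∫⁻ _, 0 ∂μ by simp]
    refine tendsto_lintegral_filter_of_dominated_convergence (fun _ => ENNReal.ofReal
      (n * ((50 * (R + 1) ^ 4 + 18 * K ^ 2) * ∫ v, (neuronSize v ^ 2) ^ 2 ∂(neuronLaw d)))) ?_ ?_ ?_ ?_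
    · exact Eventually.of_forall fun m => (hjoint m).lintegral_prod_left'
    · filter_upwards [hβ1, eventually_ne_atTop 0] with m hm hm0
      filter_upwards [hμ] with z hz
      exact (lintegral_totalKernelError_le x hK (hβ0 m) hm hm0 z).trans
        (ENNReal.ofReal_le_ofReal (kernelErrorBound_le x hK hx (hβ0 m) hm hm0 hz))
    · rw [lintegral_const]
      exact ENNReal.mul_ne_top ENNReal.ofReal_ne_top (measure_ne_top μ _)
    · refine Eventually.of_forall fun z => ?_
      have h1 := ENNReal.tendsto_ofReal (tendsto_kernelErrorBound x (R := R) hK hβ0 hβ z)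
      rw [ENNReal.ofReal_zero] at h1
      refine tendsto_of_tendsto_of_tendsto_of_le_of_le' tendsto_const_nhds h1
        (Eventually.of_forall fun _ => zero_le) ?_
      filter_upwards [hβ1, eventually_ne_atTop 0] with m hm hm0
      exact lintegral_totalKernelError_le x hK (hβ0 m) hm hm0 z
  have hbound : ∀ m, initLaw m d {g | κ ≤ ∫⁻ z, ENNReal.ofReal
      (totalKernelError x K R (β m) (drawNeurons g) z) ∂μ}
      ≤ (∫⁻ z, ∫⁻ g, ENNReal.ofReal (totalKernelError x K R (β m) g z) ∂(P m) ∂μ) / κ := by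
    intro m
    have h1 := (measurePreserving_drawNeurons (m := m) (d := d)).measure_preimage
      (measurableSet_le measurable_const (hmeasg m)).nullMeasurableSet (s := {g | κ ≤ ∫⁻ z,
        ENNReal.ofReal (totalKernelError x K R (β m) g z) ∂μ})
    change initLaw m d (drawNeurons ⁻¹' {g | κ ≤ ∫⁻ z,
        ENNReal.ofReal (totalKernelError x K R (β m) g z) ∂μ}) ≤ _
    -- Tonelli exchanges the average over `z` with the expectation, and Markov's inequality follows.
    rw [h1, lintegral_lintegral_swap (hjoint m).aemeasurable.prod_swap]
    exact meas_ge_le_lintegral_div (hmeasg m).aemeasurable hκ hκ'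
  have h0 := ENNReal.Tendsto.div_const hlim (Or.inr hκ)
  rw [ENNReal.zero_div] at h0
  exact tendsto_of_tendsto_of_tendsto_of_le_of_le tendsto_const_nhds h0
    (fun _ => zero_le) hbound

end Concentration

/-! ### Stability of the tangent kernel under small movements of the parameters -/

section KernelStability

variable {n m d : ℕ}

theorem paramInner_networkGradient {M : ℕ} (θ : Params M d) (z z' : EuclideanSpace ℝ (Fin d))
    (s s' : Fin M → ℝ) :
    paramInner (networkGradient θ z s) (networkGradient θ z' s')
      = 2 / (M : ℝ) * ∑ r, (relu (preact θ r z) * relu (preact θ r z')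
          + θ.1 r ^ 2 * (s r * s' r) * (inner ℝ z z' + 1)) + 1 := by
  have hsq : √(2 / (M : ℝ)) * √(2 / (M : ℝ)) = 2 / (M : ℝ) := Real.mul_self_sqrt (by positivity)
  rw [← hsq]
  simp only [paramInner, networkGradient, real_inner_smul_left, real_inner_smul_right,
    ← Finset.sum_add_distrib, mul_one]
  congr 1
  rw [Finset.mul_sum]
  refine Finset.sum_congr rfl fun r _ => ?_
  ring

theorem abs_relu_sub_relu_le (p q : ℝ) : |relu p - relu q| ≤ |p - q| := by
  simpa [Real.dist_eq] using lipschitzWith_relu.dist_le_mul p q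

theorem reluSubdiff_eq_of_abs_sub_lt {p q s : ℝ} (hs : s ∈ reluSubdiff p) (h : |p - q| < |q|) :
    s = if 0 < q then 1 else 0 := by
  obtain ⟨_, _, h1, h2⟩ := hs
  rcases lt_or_ge 0 q with hq | hq
  · rw [abs_of_pos hq] at h
    rw [if_pos hq]
    exact h2 (by linarith [(abs_lt.1 h).1])
  · rw [abs_of_nonpos hq] at h
    rw [if_neg (not_lt.2 hq)]
    exact h1 (by linarith [(abs_lt.1 h).2])

/-- The change of the contribution of one neuron to the tangent kernel. -/
theorem abs_neuron_sub_le {ρ L β a a₀ p p₀ p' p₀' s s' c : ℝ} (hβ0 : 0 ≤ β) (hβ1 : β ≤ 1)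
    (hL : 0 ≤ L) (hρ : 0 ≤ ρ) (ha₀ : |a₀| ≤ ρ) (hp₀ : |p₀| ≤ L * ρ) (ha : |a - a₀| ≤ β * ρ)
    (hp : |p - p₀| ≤ β * (L * ρ)) (hp' : |p' - p₀'| ≤ β * (L * ρ)) (hp₀' : |p₀'| ≤ L * ρ)
    (hs : s ∈ reluSubdiff p) (hs' : s' ∈ reluSubdiff p') (hc : |c| ≤ L ^ 2) :
    |(relu p * relu p' + a ^ 2 * (s * s') * c) - (relu p₀ * relu p₀'
        + a₀ ^ 2 * ((if 0 < p₀ then 1 else 0) * (if 0 < p₀' then 1 else 0)) * c)|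
      ≤ 6 * L ^ 2 * ρ ^ 2 * (β + (if |p₀| ≤ β * (L * ρ) then 1 else 0)
          + (if |p₀'| ≤ β * (L * ρ) then 1 else 0)) := by
  have hLρ : 0 ≤ L * ρ := by positivity
  have hβρ : β * ρ ≤ ρ := mul_le_of_le_one_left hρ hβ1
  have hβL : β * (L * ρ) ≤ L * ρ := mul_le_of_le_one_left hLρ hβ1
  have h1 : |relu p * relu p' - relu p₀ * relu p₀'| ≤ 3 * L ^ 2 * ρ ^ 2 * β := by
    have e : relu p * relu p' - relu p₀ * relu p₀'
        = (relu p - relu p₀) * relu p' + relu p₀ * (relu p' - relu p₀') := by ring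
    have e1 : |relu p - relu p₀| ≤ β * (L * ρ) := (abs_relu_sub_relu_le _ _).trans hp
    have e2 : |relu p' - relu p₀'| ≤ β * (L * ρ) := (abs_relu_sub_relu_le _ _).trans hp'
    have e3 : |relu p'| ≤ 2 * (L * ρ) := by
      rw [abs_of_nonneg (relu_nonneg _)]
      refine (relu_le_abs _).trans ?_
      have := abs_sub_abs_le_abs_sub p' p₀'
      linarith
    have e4 : |relu p₀| ≤ L * ρ := by
      rw [abs_of_nonneg (relu_nonneg _)]
      exact (relu_le_abs _).trans hp₀
    rw [e]
    refine (abs_add_le _ _).trans ?_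
    rw [abs_mul, abs_mul]
    have e5 := mul_le_mul e1 e3 (abs_nonneg _) (by positivity)
    have e6 := mul_le_mul e4 e2 (abs_nonneg _) (by positivity)
    linarith
  have h2 : |a ^ 2 - a₀ ^ 2| ≤ 3 * ρ ^ 2 * β := by
    have e : a ^ 2 - a₀ ^ 2 = (a - a₀) * (a - a₀ + 2 * a₀) := by ring
    have e1 : |a - a₀ + 2 * a₀| ≤ 3 * ρ := by
      refine (abs_add_le _ _).trans ?_
      rw [abs_mul, abs_two]
      linarith
    rw [e, abs_mul]
    have := mul_le_mul ha e1 (abs_nonneg _) (by positivity)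
    linarith
  have hsplit : ∀ X Y : ℝ, |(relu p * relu p' + X * c) - (relu p₀ * relu p₀' + Y * c)|
      ≤ 3 * L ^ 2 * ρ ^ 2 * β + |X - Y| * L ^ 2 := by
    intro X Y
    have e : (relu p * relu p' + X * c) - (relu p₀ * relu p₀' + Y * c)
        = (relu p * relu p' - relu p₀ * relu p₀') + (X - Y) * c := by ring
    rw [e]
    refine (abs_add_le _ _).trans (add_le_add h1 ?_)
    rw [abs_mul]
    exact mul_le_mul_of_nonneg_left hc (abs_nonneg _)
  refine (hsplit _ _).trans ?_
  have hLρ2 : 0 ≤ L ^ 2 * ρ ^ 2 := by positivity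
  -- If an initial pre-activation may cross the kink, the derivative terms differ by at most 4ρ²,
  -- and 3β + 4 ≤ 6(β + 1). Otherwise `s` and `s'` equal the initial indicators, only `a²` changes,
  -- and the total is 3β + 3β.
  by_cases hflip : |p₀| ≤ β * (L * ρ) ∨ |p₀'| ≤ β * (L * ρ)
  · have hone : (1 : ℝ) ≤ (if |p₀| ≤ β * (L * ρ) then 1 else 0)
        + (if |p₀'| ≤ β * (L * ρ) then 1 else 0) := by
      rcases hflip with h | h
      · rw [if_pos h]; split_ifs <;> norm_num
      · rw [if_pos h]; split_ifs <;> norm_num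
    have ha2 : a ^ 2 ≤ 4 * ρ ^ 2 := by
      have h3 : |a| ≤ 2 * ρ := by
        have := abs_sub_abs_le_abs_sub a a₀
        linarith
      rw [← sq_abs]
      nlinarith [abs_nonneg a]
    have ha02 : a₀ ^ 2 ≤ 4 * ρ ^ 2 := by
      rw [← sq_abs]
      nlinarith [abs_nonneg a₀]
    have hss0 : 0 ≤ s * s' := mul_nonneg hs.1 hs'.1
    have hss1 : s * s' ≤ 1 := mul_le_one₀ hs.2.1 hs'.1 hs'.2.1
    have hii : ∀ u v : ℝ, u ∈ Set.Icc (0 : ℝ) 1 → 0 ≤ v → v ≤ 4 * ρ ^ 2 →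
        0 ≤ v * u ∧ v * u ≤ 4 * ρ ^ 2 := fun u v hu h0 h1 =>
      ⟨mul_nonneg h0 hu.1, (mul_le_of_le_one_right h0 hu.2).trans h1⟩
    have hX := hii _ _ ⟨hss0, hss1⟩ (sq_nonneg a) ha2
    have hY := hii ((if 0 < p₀ then 1 else 0) * (if 0 < p₀' then 1 else 0)) _
      (by split_ifs <;> norm_num) (sq_nonneg a₀) ha02
    have hd : |a ^ 2 * (s * s') - a₀ ^ 2 * ((if 0 < p₀ then 1 else 0) * (if 0 < p₀' then 1 else 0))|
        ≤ 4 * ρ ^ 2 := abs_le.2 ⟨by linarith [hX.1, hY.2], by linarith [hX.2, hY.1]⟩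
    have hd' := mul_le_mul_of_nonneg_right hd (sq_nonneg L)
    have h6 : 6 * L ^ 2 * ρ ^ 2 * (β + 1) ≤ 6 * L ^ 2 * ρ ^ 2 *
        (β + (if |p₀| ≤ β * (L * ρ) then 1 else 0) + (if |p₀'| ≤ β * (L * ρ) then 1 else 0)) := by
      refine mul_le_mul_of_nonneg_left ?_ (by positivity)
      linarith
    refine le_trans ?_ h6
    nlinarith [mul_nonneg hLρ2 hβ0]
  · rw [not_or, not_le, not_le] at hflip
    rw [if_neg (not_le.2 hflip.1), if_neg (not_le.2 hflip.2), add_zero, add_zero,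
      reluSubdiff_eq_of_abs_sub_lt hs (hp.trans_lt hflip.1),
      reluSubdiff_eq_of_abs_sub_lt hs' (hp'.trans_lt hflip.2), ← sub_mul, abs_mul]
    have hi : |(if 0 < p₀ then (1 : ℝ) else 0) * (if 0 < p₀' then 1 else 0)| ≤ 1 := by
      split_ifs <;> norm_num
    have h3 := mul_le_mul h2 hi (abs_nonneg _) (by positivity)
    have h4 := mul_le_mul_of_nonneg_right h3 (sq_nonneg L)
    linarith

/-- The size at initialization of the neurons of the network of width `2 m`. -/
noncomputable def initSize (g : InitDraw m d) (r : Fin (m + m)) : ℝ :=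
  Fin.append (fun r => neuronSize (drawNeurons g r)) (fun r => neuronSize (drawNeurons g r)) r

/-- All the neurons stay within `β` times their sizes of the initialization, as far as the outer
weights and the pre-activations on the ball of radius `R` are concerned. -/
def IsCloseToInit (R β : ℝ) (g : InitDraw m d) (θ : Params (m + m) d) : Prop :=
  ∀ r, |θ.1 r - (initParams g).1 r| ≤ β * initSize g r ∧
    ∀ z : EuclideanSpace ℝ (Fin d), ‖z‖ ≤ R →
      |preact θ r z - preact (initParams g) r z| ≤ β * ((R + 1) * initSize g r)

theorem preact_initParams_castAdd (g : InitDraw m d) (r : Fin m) (z : EuclideanSpace ℝ (Fin d)) :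
    preact (initParams g) (Fin.castAdd m r) z = drawPreact (drawNeurons g r).2 z := by
  simp [preact, initParams, drawPreact, drawNeurons]

theorem preact_initParams_natAdd (g : InitDraw m d) (r : Fin m) (z : EuclideanSpace ℝ (Fin d)) :
    preact (initParams g) (Fin.natAdd m r) z = drawPreact (drawNeurons g r).2 z := by
  simp only [preact, initParams, drawPreact, drawNeurons, Fin.append_right]

theorem network_initParams (g : InitDraw m d) (z : EuclideanSpace ℝ (Fin d)) :
    network (initParams g) z = 0 := by
  have h1 : ∀ r, (initParams g).1 (Fin.castAdd m r) = g.1 r := fun r => by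
    simp only [initParams, Fin.append_left]
  have h2 : ∀ r, (initParams g).1 (Fin.natAdd m r) = -g.1 r := fun r => by
    simp only [initParams, Fin.append_right]
  have h3 : (initParams g).2.2.2 = 0 := rfl
  unfold network
  rw [Fin.sum_univ_add]
  simp only [preact_initParams_castAdd, preact_initParams_natAdd, h1, h2, h3, ← Finset.sum_add_distrib,
    neg_mul, add_neg_cancel, Finset.sum_const_zero, mul_zero, add_zero]

theorem abs_outer_le_neuronSize (v : NeuronDraw d) : |v.1| ≤ neuronSize v := by
  have := abs_nonneg v.2.2
  have := norm_nonneg (WithLp.toLp 2 v.2.1 : EuclideanSpace ℝ (Fin d))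
  unfold neuronSize
  linarith

theorem abs_inner_add_one_le {R : ℝ} {z z' : EuclideanSpace ℝ (Fin d)} (hz : ‖z‖ ≤ R)
    (hz' : ‖z'‖ ≤ R) : |inner ℝ z z' + 1| ≤ (R + 1) ^ 2 := by
  have hR : 0 ≤ R := (norm_nonneg z).trans hz
  have := abs_real_inner_le_norm z z'
  have h3 : ‖z‖ * ‖z'‖ ≤ R * R := mul_le_mul hz hz' (norm_nonneg _) hR
  refine (abs_add_le _ _).trans ?_
  rw [abs_one]
  nlinarith

/-- The error splits into the fluctuation of the initial kernel and the movement of the neurons.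
Only the square of the outer weight enters, so a neuron and its antisymmetric copy have the same
initial contribution, although they may move differently. -/
theorem abs_paramInner_sub_ntk_le {R β : ℝ} (hβ0 : 0 ≤ β) (hβ1 : β ≤ 1) (hm : m ≠ 0)
    {g : InitDraw m d} {θ : Params (m + m) d} (hθ : IsCloseToInit R β g θ)
    {z z' : EuclideanSpace ℝ (Fin d)} (hz : ‖z‖ ≤ R) (hz' : ‖z'‖ ≤ R)
    {s s' : Fin (m + m) → ℝ} (hs : ∀ r, s r ∈ reluSubdiff (preact θ r z))
    (hs' : ∀ r, s' r ∈ reluSubdiff (preact θ r z')) :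
    |paramInner (networkGradient θ z s) (networkGradient θ z' s') - ntk z z'|
      ≤ kernelError (12 * (R + 1) ^ 2) R β (drawNeurons g) z z' := by
  have hm0 : (0 : ℝ) < m := by exact_mod_cast Nat.pos_of_ne_zero hm
  have hR : 0 ≤ R := (norm_nonneg z).trans hz
  set c : ℝ := inner ℝ z z' + 1 with hc
  have hcL : |c| ≤ (R + 1) ^ 2 := abs_inner_add_one_le hz hz'
  set k : Fin (m + m) → ℝ := fun r => relu (preact θ r z) * relu (preact θ r z')
    + θ.1 r ^ 2 * (s r * s' r) * c with hk
  set k0 : Fin m → ℝ := fun r => relu (drawPreact (drawNeurons g r).2 z)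
      * relu (drawPreact (drawNeurons g r).2 z') + (drawNeurons g r).1 ^ 2 *
      ((if 0 < drawPreact (drawNeurons g r).2 z then 1 else 0) *
        (if 0 < drawPreact (drawNeurons g r).2 z' then 1 else 0)) * c with hk0
  have hsize : ∀ r, 0 ≤ neuronSize (drawNeurons g r) := fun r =>
    zero_le_one.trans (one_le_neuronSize _)
  have hL : 0 ≤ R + 1 := by linarith
  -- The constant 12 in `flipWeight` is twice the 6 of `abs_neuron_sub_le`: each of the two copies
  -- may then use half of the weight.
  have h1 : ∀ r : Fin m, 2 * |k (Fin.castAdd m r) - k0 r|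
      ≤ flipWeight (12 * (R + 1) ^ 2) R β (drawNeurons g r) z z' := by
    intro r
    have hr := hθ (Fin.castAdd m r)
    have hz1 := hr.2 z hz
    have hz2 := hr.2 z' hz'
    rw [preact_initParams_castAdd] at hz1 hz2
    simp only [initSize, Fin.append_left] at hr hz1 hz2
    have := abs_neuron_sub_le hβ0 hβ1 hL (hsize r) (a₀ := (drawNeurons g r).1)
      (abs_outer_le_neuronSize _) (abs_drawPreact_le _ hz) (by simpa [initParams, drawNeurons] using hr.1)
      hz1 hz2 (abs_drawPreact_le _ hz') (hs _) (hs' _) hcL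
    rw [flipWeight]
    linarith
  have h2 : ∀ r : Fin m, 2 * |k (Fin.natAdd m r) - k0 r|
      ≤ flipWeight (12 * (R + 1) ^ 2) R β (drawNeurons g r) z z' := by
    intro r
    have hr := hθ (Fin.natAdd m r)
    have hz1 := hr.2 z hz
    have hz2 := hr.2 z' hz'
    rw [preact_initParams_natAdd] at hz1 hz2
    simp only [initSize, Fin.append_right] at hr hz1 hz2
    have hr1 : |θ.1 (Fin.natAdd m r) - -(drawNeurons g r).1|
        ≤ β * neuronSize (drawNeurons g r) := by
      have hr1 := hr.1
      simp only [initParams, Fin.append_right] at hr1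
      exact hr1
    have := abs_neuron_sub_le hβ0 hβ1 hL (hsize r) (a₀ := -(drawNeurons g r).1)
      (by rw [abs_neg]; exact abs_outer_le_neuronSize _) (abs_drawPreact_le _ hz)
      hr1
      hz1 hz2 (abs_drawPreact_le _ hz') (hs _) (hs' _) hcL
    rw [neg_sq] at this
    rw [flipWeight]
    linarith
  have e1 : paramInner (networkGradient θ z s) (networkGradient θ z' s')
      = 1 / (m : ℝ) * ∑ r : Fin m, (k (Fin.castAdd m r) + k (Fin.natAdd m r)) + 1 := by
    rw [paramInner_networkGradient, Fin.sum_univ_add, ← Finset.sum_add_distrib]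
    congr 2
    push_cast
    field_simp
    norm_num
  have e2 : 1 / (m : ℝ) * ∑ r, neuronKernel (drawNeurons g r) z z'
      = 1 / (m : ℝ) * ∑ r : Fin m, (k0 r + k0 r) + 1 := by
    have : ∀ r : Fin m, neuronKernel (drawNeurons g r) z z' = (k0 r + k0 r) + 1 := fun r => by
      simp only [neuronKernel, hk0, hc]; ring
    simp only [this, Finset.sum_add_distrib, Finset.sum_const, Finset.card_univ, Fintype.card_fin,
      nsmul_eq_mul, mul_one]
    field_simp
  have e3 : paramInner (networkGradient θ z s) (networkGradient θ z' s') - ntk z z'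
      = (1 / (m : ℝ) * ∑ r, neuronKernel (drawNeurons g r) z z' - ntk z z')
        + 1 / (m : ℝ) * ∑ r : Fin m,
          ((k (Fin.castAdd m r) - k0 r) + (k (Fin.natAdd m r) - k0 r)) := by
    rw [e1, e2]
    simp only [Finset.sum_add_distrib, Finset.sum_sub_distrib]
    ring
  rw [e3, kernelError]
  refine (abs_add_le _ _).trans (add_le_add le_rfl ?_)
  rw [abs_mul, abs_of_nonneg (by positivity)]
  refine mul_le_mul_of_nonneg_left ?_ (by positivity)
  refine (Finset.abs_sum_le_sum_abs _ _).trans (Finset.sum_le_sum fun r _ => ?_)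
  refine (abs_add_le _ _).trans ?_
  linarith [h1 r, h2 r]

end KernelStability

/-! ### Movement of the parameters along a gradient flow -/

section Movement

variable {n M d : ℕ}

/-- The residual `f_θ(x_i) - y_i` at the `i`-th sample point. -/
noncomputable def fitError (x : Fin n → EuclideanSpace ℝ (Fin d)) (y : Fin n → ℝ) (θ : Params M d)
    (i : Fin n) : ℝ := network θ (x i) - y i

/-- The total size of the parameters of the `r`-th neuron. -/
noncomputable def paramSize (θ : Params M d) (r : Fin M) : ℝ :=
  |θ.1 r| + ‖θ.2.1 r‖ + |θ.2.2.1 r|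

theorem paramSize_nonneg (θ : Params M d) (r : Fin M) : 0 ≤ paramSize θ r := by
  unfold paramSize; positivity

theorem continuous_paramSize (r : Fin M) : Continuous fun θ : Params M d => paramSize θ r := by
  unfold paramSize; fun_prop

theorem abs_preact_le {R : ℝ} (θ : Params M d) (r : Fin M) {z : EuclideanSpace ℝ (Fin d)}
    (hz : ‖z‖ ≤ R) : |preact θ r z| ≤ R * ‖θ.2.1 r‖ + |θ.2.2.1 r| := by
  unfold preact
  refine (abs_add_le _ _).trans (add_le_add ((abs_real_inner_le_norm _ _).trans ?_) le_rfl)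
  rw [mul_comm]
  exact mul_le_mul_of_nonneg_right hz (norm_nonneg _)

variable (x : Fin n → EuclideanSpace ℝ (Fin d)) (y : Fin n → ℝ) (θ : Params M d)
  (s : Fin n → Fin M → ℝ) (r : Fin M)

theorem lossGradient_outer : (lossGradient x y θ s).1 r
    = 1 / (n : ℝ) * ∑ i, fitError x y θ i * (√(2 / (M : ℝ)) * relu (preact θ r (x i))) := by
  simp [lossGradient, networkGradient, fitError, Prod.fst_sum, Finset.sum_apply]

theorem inner_lossGradient_weight (v : EuclideanSpace ℝ (Fin d)) :
    inner ℝ ((lossGradient x y θ s).2.1 r) v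
      = 1 / (n : ℝ) * ∑ i, fitError x y θ i * (√(2 / (M : ℝ)) * θ.1 r * s i r * inner ℝ (x i) v) := by
  simp [lossGradient, networkGradient, fitError, Prod.fst_sum, Prod.snd_sum, Finset.sum_apply,
    real_inner_smul_left, sum_inner]

theorem lossGradient_bias : (lossGradient x y θ s).2.2.1 r
    = 1 / (n : ℝ) * ∑ i, fitError x y θ i * (√(2 / (M : ℝ)) * θ.1 r * s i r) := by
  simp [lossGradient, networkGradient, fitError, Prod.fst_sum, Prod.snd_sum, Finset.sum_apply]

theorem abs_mean_residual_mul_le {c : Fin n → ℝ} {B : ℝ} (hc : ∀ i, |c i| ≤ B) :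
    |1 / (n : ℝ) * ∑ i, fitError x y θ i * c i|
      ≤ 1 / (n : ℝ) * B * ∑ i, |fitError x y θ i| := by
  rw [abs_mul, abs_of_nonneg (by positivity : (0 : ℝ) ≤ 1 / n), mul_assoc]
  refine mul_le_mul_of_nonneg_left ?_ (by positivity)
  rw [Finset.mul_sum]
  refine (Finset.abs_sum_le_sum_abs _ _).trans (Finset.sum_le_sum fun i _ => ?_)
  rw [abs_mul, mul_comm]
  exact mul_le_mul_of_nonneg_right (hc i) (abs_nonneg _)

variable {x y θ s r} {R S : ℝ}

theorem abs_lossGradient_outer_le (hx : ∀ i, ‖x i‖ ≤ R) (hR : 0 ≤ R) (hS : paramSize θ r ≤ S) :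
    |(lossGradient x y θ s).1 r|
      ≤ 1 / (n : ℝ) * (√(2 / (M : ℝ)) * ((R + 1) * S)) * ∑ i, |fitError x y θ i| := by
  rw [lossGradient_outer]
  refine abs_mean_residual_mul_le x y θ fun i => ?_
  rw [abs_mul, abs_of_nonneg (Real.sqrt_nonneg _), abs_of_nonneg (relu_nonneg _)]
  refine mul_le_mul_of_nonneg_left ((relu_le_abs _).trans ((abs_preact_le θ r (hx i)).trans ?_))
    (Real.sqrt_nonneg _)
  unfold paramSize at hS
  have := mul_le_mul_of_nonneg_left hS hR
  nlinarith [abs_nonneg (θ.1 r), norm_nonneg (θ.2.1 r), abs_nonneg (θ.2.2.1 r)]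

theorem abs_outer_mul_le (hs : ∀ i, s i r ∈ reluSubdiff (preact θ r (x i)))
    (hS : paramSize θ r ≤ S) (i : Fin n) :
    |√(2 / (M : ℝ)) * θ.1 r * s i r| ≤ √(2 / (M : ℝ)) * S := by
  rw [abs_mul, abs_mul, abs_of_nonneg (Real.sqrt_nonneg _), abs_of_nonneg (hs i).1, mul_assoc]
  refine mul_le_mul_of_nonneg_left ?_ (Real.sqrt_nonneg _)
  refine (mul_le_of_le_one_right (abs_nonneg _) (hs i).2.1).trans (le_trans ?_ hS)
  unfold paramSize
  linarith [norm_nonneg (θ.2.1 r), abs_nonneg (θ.2.2.1 r)]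

theorem abs_inner_lossGradient_weight_le (hx : ∀ i, ‖x i‖ ≤ R)
    (hs : ∀ i, s i r ∈ reluSubdiff (preact θ r (x i))) (hS : paramSize θ r ≤ S)
    (v : EuclideanSpace ℝ (Fin d)) :
    |inner ℝ ((lossGradient x y θ s).2.1 r) v|
      ≤ 1 / (n : ℝ) * (√(2 / (M : ℝ)) * S * (R * ‖v‖)) * ∑ i, |fitError x y θ i| := by
  rw [inner_lossGradient_weight]
  refine abs_mean_residual_mul_le x y θ fun i => ?_
  rw [abs_mul]
  have h0 : 0 ≤ S := (paramSize_nonneg θ r).trans hS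
  refine mul_le_mul (abs_outer_mul_le hs hS i) ((abs_real_inner_le_norm _ _).trans ?_)
    (abs_nonneg _) (by positivity)
  exact mul_le_mul_of_nonneg_right (hx i) (norm_nonneg _)

theorem abs_lossGradient_bias_le (hs : ∀ i, s i r ∈ reluSubdiff (preact θ r (x i)))
    (hS : paramSize θ r ≤ S) :
    |(lossGradient x y θ s).2.2.1 r|
      ≤ 1 / (n : ℝ) * (√(2 / (M : ℝ)) * S) * ∑ i, |fitError x y θ i| := by
  rw [lossGradient_bias]
  exact abs_mean_residual_mul_le x y θ fun i => abs_outer_mul_le hs hS i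

end Movement

/-! ### Integrated speed bounds and closeness to initialization -/

section FlowMovement

variable {n M d : ℕ} {x : Fin n → EuclideanSpace ℝ (Fin d)} {y : Fin n → ℝ} {θ : ℝ → Params M d}
  {t R S Q : ℝ} {r : Fin M}

theorem IsGradientFlow.continuousOn (hθ : IsGradientFlow x y θ) (ht : 0 ≤ t) :
    ContinuousOn θ (Set.Icc 0 t) := by
  have := (hθ.1 t ht).continuousOn
  rwa [Set.uIcc_of_le ht] at this

theorem IsGradientFlow.ae_hasDerivAt (hθ : IsGradientFlow x y θ) :
    ∀ᵐ τ, 0 ≤ τ → ∃ s : Fin n → Fin M → ℝ,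
      (∀ i r, s i r ∈ reluSubdiff (preact (θ τ) r (x i))) ∧
        HasDerivAt θ (-lossGradient x y (θ τ) s) τ := by
  have := hθ.2
  rwa [ae_restrict_iff' measurableSet_Ici] at this

theorem IsGradientFlow.continuousOn_residual (hθ : IsGradientFlow x y θ) (ht : 0 ≤ t) (i : Fin n) :
    ContinuousOn (fun τ => fitError x y (θ τ) i) (Set.Icc 0 t) :=
  ((continuous_network (x i)).comp_continuousOn (hθ.continuousOn ht)).sub continuousOn_const

theorem IsGradientFlow.continuousOn_sum_abs_residual (hθ : IsGradientFlow x y θ) (ht : 0 ≤ t) :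
    ContinuousOn (fun τ => ∑ i, |fitError x y (θ τ) i|) (Set.Icc 0 t) :=
  continuousOn_finsetSum _ fun i _ => (hθ.continuousOn_residual ht i).abs

theorem IsGradientFlow.integral_sum_abs_residual_mono (hθ : IsGradientFlow x y θ) {τ : ℝ}
    (h0 : 0 ≤ τ) (hτ : τ ≤ t) :
    ∫ w in (0 : ℝ)..τ, ∑ i, |fitError x y (θ w) i|
      ≤ ∫ w in (0 : ℝ)..t, ∑ i, |fitError x y (θ w) i| := by
  have h1 := (hθ.continuousOn_sum_abs_residual (h0.trans hτ)).intervalIntegrable_of_Icc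
    (μ := volume) (h0.trans hτ)
  exact intervalIntegral.integral_mono_interval le_rfl h0 hτ
    (Eventually.of_forall fun w => Finset.sum_nonneg fun i _ => abs_nonneg _) h1

/-- Along a gradient flow, a real function of the parameters moves by at most a bound of its speed
relative to the total residual, times the total residual integrated over time. -/
theorem IsGradientFlow.abs_sub_le_of_speed (hθ : IsGradientFlow x y θ)
    (hQ : ∫ w in (0 : ℝ)..t, ∑ i, |fitError x y (θ w) i| ≤ Q) {f : ℝ → ℝ} {C : ℝ} (hC : 0 ≤ C)
    (hf : ∀ τ ∈ Set.Icc 0 t, AbsolutelyContinuousOnInterval f 0 τ)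
    (h : ∀ᵐ τ, τ ∈ Set.Icc 0 t → ∃ f', HasDerivAt f f' τ ∧
      |f'| ≤ C * ∑ i, |fitError x y (θ τ) i|) {τ : ℝ} (hτ : τ ∈ Set.Icc 0 t) :
    |f τ - f 0| ≤ C * Q := by
  have h1 := (hf τ hτ).abs_sub_le_integral hτ.1
    (g := fun τ => C * ∑ i, |fitError x y (θ τ) i|)
    (continuousOn_const.mul (hθ.continuousOn_sum_abs_residual hτ.1)) (by
      filter_upwards [h] with w hw hwm using hw ⟨hwm.1, hwm.2.trans hτ.2⟩)
  refine h1.trans ?_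
  rw [intervalIntegral.integral_const_mul]
  exact mul_le_mul_of_nonneg_left ((hθ.integral_sum_abs_residual_mono hτ.1 hτ.2).trans hQ) hC

/-- The speed of a neuron's parameters is proportional to the size of that same neuron and to
√(2/M). So movement relative to size is controlled, without a bound on the largest of the Gaussian
weights. -/
theorem IsGradientFlow.movement_le (hθ : IsGradientFlow x y θ) (ht : 0 ≤ t)
    (hQ : ∫ w in (0 : ℝ)..t, ∑ i, |fitError x y (θ w) i| ≤ Q)
    (hx : ∀ i, ‖x i‖ ≤ R) (hR : 0 ≤ R) (hS : ∀ τ ∈ Set.Icc 0 t, paramSize (θ τ) r ≤ S)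
    {τ : ℝ} (hτ : τ ∈ Set.Icc 0 t) :
    |(θ τ).1 r - (θ 0).1 r| ≤ 1 / (n : ℝ) * √(2 / (M : ℝ)) * Q * ((R + 1) * S) ∧
      ‖(θ τ).2.1 r - (θ 0).2.1 r‖ ≤ 1 / (n : ℝ) * √(2 / (M : ℝ)) * Q * (R * S) ∧
      |(θ τ).2.2.1 r - (θ 0).2.2.1 r| ≤ 1 / (n : ℝ) * √(2 / (M : ℝ)) * Q * S := by
  have hS0 : 0 ≤ S := (paramSize_nonneg _ _).trans (hS τ hτ)
  have hσ := Real.sqrt_nonneg (2 / (M : ℝ))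
  have hae := hθ.ae_hasDerivAt
  have hn : (0 : ℝ) ≤ 1 / n := by positivity
  have hQ0 : 0 ≤ Q := by
    refine le_trans ?_ hQ
    exact intervalIntegral.integral_nonneg ht fun w _ => Finset.sum_nonneg fun i _ => abs_nonneg _
  refine ⟨?_, ?_, ?_⟩
  · have := hθ.abs_sub_le_of_speed hQ (f := fun τ => (θ τ).1 r)
      (C := 1 / (n : ℝ) * (√(2 / (M : ℝ)) * ((R + 1) * S))) (by positivity)
      (fun τ hτ => (hθ.1 τ hτ.1).outer r) (by
        filter_upwards [hae] with w hw hwm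
        obtain ⟨s, hs, hd⟩ := hw hwm.1
        refine ⟨_, hasDerivAt_outer hd r, ?_⟩
        simp only [Prod.fst_neg, Pi.neg_apply, abs_neg]
        exact abs_lossGradient_outer_le hx hR (hS w hwm)) hτ
    refine this.trans (le_of_eq ?_)
    ring
  -- The displacement of the weight vector is tested against itself: the scalar function ⟨w(τ), v⟩
  -- moves by ‖v‖², which is bounded by a constant times ‖v‖.
  · set v := (θ τ).2.1 r - (θ 0).2.1 r with hv
    have := hθ.abs_sub_le_of_speed hQ (f := fun τ => inner ℝ ((θ τ).2.1 r) v)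
      (C := 1 / (n : ℝ) * (√(2 / (M : ℝ)) * S * (R * ‖v‖))) (by positivity)
      (fun τ hτ => (hθ.1 τ hτ.1).inner_weight r v) (by
        filter_upwards [hae] with w hw hwm
        obtain ⟨s, hs, hd⟩ := hw hwm.1
        refine ⟨_, hasDerivAt_inner_weight hd r v, ?_⟩
        simp only [Prod.fst_neg, Prod.snd_neg, Pi.neg_apply, inner_neg_left, abs_neg]
        exact abs_inner_lossGradient_weight_le hx (fun i => hs i r) (hS w hwm) v) hτ
    rw [← inner_sub_left, ← hv, real_inner_self_eq_norm_sq, abs_of_nonneg (sq_nonneg _)] at this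
    rcases (norm_nonneg v).eq_or_lt with h0 | h0
    · rw [← h0]; positivity
    · refine le_of_mul_le_mul_right (le_of_eq_of_le (sq _).symm (this.trans (le_of_eq ?_))) h0
      ring
  · have := hθ.abs_sub_le_of_speed hQ (f := fun τ => (θ τ).2.2.1 r)
      (C := 1 / (n : ℝ) * (√(2 / (M : ℝ)) * S)) (by positivity)
      (fun τ hτ => (hθ.1 τ hτ.1).bias r) (by
        filter_upwards [hae] with w hw hwm
        obtain ⟨s, hs, hd⟩ := hw hwm.1
        refine ⟨_, hasDerivAt_bias hd r, ?_⟩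
        simp only [Prod.fst_neg, Prod.snd_neg, Pi.neg_apply, abs_neg]
        exact abs_lossGradient_bias_le (fun i => hs i r) (hS w hwm)) hτ
    refine this.trans (le_of_eq ?_)
    ring

theorem paramSize_initParams_le {m : ℕ} (g : InitDraw m d) (r : Fin (m + m)) :
    paramSize (initParams g) r ≤ initSize g r := by
  have key : ∀ r : Fin m, |g.1 r| + ‖(WithLp.toLp 2 (g.2.1 r) : EuclideanSpace ℝ (Fin d))‖
      + |g.2.2 r| ≤ neuronSize (drawNeurons g r) := fun r => by
    simp only [neuronSize, drawNeurons]
    linarith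
  refine Fin.addCases (fun r => ?_) (fun r => ?_) r
  · simp only [paramSize, initParams, initSize, Fin.append_left]
    exact key r
  · simp only [paramSize, initParams, initSize, Fin.append_right, abs_neg]
    exact key r

/-- As long as the integrated residual is at most `Q`, the parameters of a gradient flow stay close
to the initialization. -/
theorem IsGradientFlow.isCloseToInit {m : ℕ} {θ : ℝ → Params (m + m) d} {g : InitDraw m d}
    (hθ : IsGradientFlow x y θ) (hθ0 : θ 0 = initParams g) (ht : 0 ≤ t)
    (hQ : ∫ w in (0 : ℝ)..t, ∑ i, |fitError x y (θ w) i| ≤ Q)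
    (hx : ∀ i, ‖x i‖ ≤ R) (hR : 0 ≤ R)
    (hβ : 2 * (1 / (n : ℝ) * √(2 / ((m + m : ℕ) : ℝ)) * Q) * (R + 1) ≤ 1 / 2) {τ : ℝ}
    (hτ : τ ∈ Set.Icc 0 t) :
    IsCloseToInit R (2 * (1 / (n : ℝ) * √(2 / ((m + m : ℕ) : ℝ)) * Q) * (R + 1)) g (θ τ) := by
  intro r
  have hQ0 : 0 ≤ Q := by
    refine le_trans ?_ hQ
    exact intervalIntegral.integral_nonneg ht fun w _ => Finset.sum_nonneg fun i _ => abs_nonneg _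
  -- Let S be the largest size of the neuron on [0, t]. The movement bound gives S ≤ S(0) + S/2, so
  -- S is at most twice the initial size; this is the factor 2 in the conclusion.
  obtain ⟨τ₁, hτ₁, hmax⟩ := isCompact_Icc.exists_isMaxOn (Set.nonempty_Icc.2 ht)
    ((continuous_paramSize r).comp_continuousOn (hθ.continuousOn ht))
  set S := paramSize (θ τ₁) r with hS
  have hSmax : ∀ τ ∈ Set.Icc 0 t, paramSize (θ τ) r ≤ S := fun τ hτ => hmax hτ
  have hmove := fun τ (hτ : τ ∈ Set.Icc 0 t) => hθ.movement_le ht hQ hx hR hSmax hτ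
  set c := 1 / (n : ℝ) * √(2 / ((m + m : ℕ) : ℝ)) * Q with hc
  have hc0 : 0 ≤ c := by positivity
  have hS0 : 0 ≤ S := paramSize_nonneg _ _
  have hS2 : S ≤ 2 * initSize g r := by
    obtain ⟨h1, h2, h3⟩ := hmove τ₁ hτ₁
    have h4 : S ≤ paramSize (θ 0) r + 2 * c * (R + 1) * S := by
      rw [hS]
      unfold paramSize
      have e1 := abs_sub_abs_le_abs_sub ((θ τ₁).1 r) ((θ 0).1 r)
      have e2 := norm_sub_norm_le ((θ τ₁).2.1 r) ((θ 0).2.1 r)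
      have e3 := abs_sub_abs_le_abs_sub ((θ τ₁).2.2.1 r) ((θ 0).2.2.1 r)
      change _ ≤ _ + 2 * c * (R + 1) * S
      linarith
    have h5 : 2 * c * (R + 1) * S ≤ 1 / 2 * S := mul_le_mul_of_nonneg_right hβ hS0
    have h6 := paramSize_initParams_le g r
    rw [hθ0] at h4
    linarith
  obtain ⟨h1, h2, h3⟩ := hmove τ hτ
  rw [hθ0] at h1 h2 h3
  have hcR : c * (R + 1) * S ≤ c * (R + 1) * (2 * initSize g r) :=
    mul_le_mul_of_nonneg_left hS2 (by positivity)
  refine ⟨by linarith, fun z hz => ?_⟩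
  have e : preact (θ τ) r z - preact (initParams g) r z
      = inner ℝ ((θ τ).2.1 r - (initParams g).2.1 r) z
        + ((θ τ).2.2.1 r - (initParams g).2.2.1 r) := by
    unfold preact
    rw [inner_sub_left]
    ring
  rw [e]
  have e1 := (abs_real_inner_le_norm ((θ τ).2.1 r - (initParams g).2.1 r) z).trans
    (mul_le_mul h2 hz (norm_nonneg _) (by positivity))
  refine (abs_add_le _ _).trans ((add_le_add e1 h3).trans ?_)
  have e2 : c * (R * S) * R + c * S ≤ (R + 1) * (c * (R + 1) * S) := by
    have := mul_nonneg (mul_nonneg hc0 hS0) hR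
    nlinarith
  have e3 := mul_le_mul_of_nonneg_left hcR (by linarith : 0 ≤ R + 1)
  linarith

/-- Along a gradient flow, the network function at a point is driven by the residuals through the
tangent kernel, up to the kernel error. -/
theorem IsGradientFlow.ae_hasDerivAt_network {m : ℕ} {θ : ℝ → Params (m + m) d} {g : InitDraw m d}
    {β : ℝ} (hθ : IsGradientFlow x y θ) (ht : 0 ≤ t) (hm : m ≠ 0) (hβ0 : 0 ≤ β) (hβ1 : β ≤ 1)
    (hclose : ∀ τ ∈ Set.Icc 0 t, IsCloseToInit R β g (θ τ)) (hx : ∀ i, ‖x i‖ ≤ R)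
    {z : EuclideanSpace ℝ (Fin d)} (hz : ‖z‖ ≤ R) :
    ∀ᵐ τ, τ ∈ Set.Icc 0 t → ∃ k : Fin n → ℝ,
      (∀ j, |k j - ntk z (x j)| ≤ kernelError (12 * (R + 1) ^ 2) R β (drawNeurons g) z (x j)) ∧
      HasDerivAt (fun τ => network (θ τ) z)
        (-(1 / (n : ℝ)) * ∑ j, fitError x y (θ τ) j * k j) τ := by
  filter_upwards [hθ.ae_hasDerivAt, _root_.ae_hasDerivAt_network (hθ.1 t ht) z] with τ h1 h2 hτ
  obtain ⟨s, hs, hd⟩ := h1 hτ.1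
  rw [Set.uIcc_of_le ht] at h2
  -- The flow prescribes derivatives only at the sample points. At `z` the chain rule holds for
  -- every admissible choice, so the indicator may be used.
  have h3 := h2 hτ _ hd (fun r => if 0 < preact (θ τ) r z then 1 else 0)
    fun r => indicator_mem_reluSubdiff _
  rw [paramInner_neg_lossGradient] at h3
  exact ⟨_, fun j => abs_paramInner_sub_ntk_le hβ0 hβ1 hm (hclose τ hτ) hz (hx j)
    (fun r => indicator_mem_reluSubdiff _) (hs j), h3⟩

end FlowMovement

/-! ### Perturbations of a linear flow -/

section PerturbedFlow

variable {n : ℕ}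

/-- On `[0, t]`, the curve `u` solves a perturbation of the linear flow `u' = - γ K u` in which the
entries of the matrix may vary by `κ`. -/
def IsPerturbedFlow (K : Fin n → Fin n → ℝ) (γ κ : ℝ) (u : Fin n → ℝ → ℝ) (t : ℝ) : Prop :=
  (∀ i, AbsolutelyContinuousOnInterval (u i) 0 t) ∧
    ∀ᵐ τ, τ ∈ Set.Icc 0 t → ∀ i, ∃ k : Fin n → ℝ, (∀ j, |k j - K i j| ≤ κ) ∧
      HasDerivAt (u i) (-γ * ∑ j, u j τ * k j) τ

variable {K : Fin n → Fin n → ℝ} {γ κ lam t : ℝ} {u v : Fin n → ℝ → ℝ}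

theorem IsPerturbedFlow.mono (h : IsPerturbedFlow K γ κ u t) {τ : ℝ} (h0 : 0 ≤ τ) (hτ : τ ≤ t) :
    IsPerturbedFlow K γ κ u τ := by
  refine ⟨fun i => (h.1 i).mono ?_, ?_⟩
  · rw [Set.uIcc_of_le h0, Set.uIcc_of_le (h0.trans hτ)]
    exact Set.Icc_subset_Icc le_rfl hτ
  · filter_upwards [h.2] with w hw hwm using hw ⟨hwm.1, hwm.2.trans hτ⟩

theorem IsPerturbedFlow.continuousOn (h : IsPerturbedFlow K γ κ u t) (ht : 0 ≤ t) (i : Fin n) :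
    ContinuousOn (u i) (Set.Icc 0 t) := by
  have := (h.1 i).continuousOn
  rwa [Set.uIcc_of_le ht] at this

theorem IsPerturbedFlow.continuousOn_sum_abs (h : IsPerturbedFlow K γ κ u t) (ht : 0 ≤ t) :
    ContinuousOn (fun τ => ∑ i, |u i τ|) (Set.Icc 0 t) :=
  continuousOn_finsetSum _ fun i _ => (h.continuousOn ht i).abs

theorem abs_sum_mul_sum_mul_sub_le {k : Fin n → Fin n → ℝ} (hk : ∀ i j, |k i j - K i j| ≤ κ)
    (a b : Fin n → ℝ) :
    |∑ i, a i * ∑ j, b j * (k i j - K i j)| ≤ κ * (∑ i, |a i|) * ∑ j, |b j| := by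
  have e : κ * (∑ i, |a i|) * ∑ j, |b j| = ∑ i, |a i| * ∑ j, |b j| * κ := by
    rw [← Finset.sum_mul, ← Finset.sum_mul]
    ring
  rw [e]
  refine (Finset.abs_sum_le_sum_abs _ _).trans (Finset.sum_le_sum fun i _ => ?_)
  rw [abs_mul]
  refine mul_le_mul_of_nonneg_left ?_ (abs_nonneg _)
  refine (Finset.abs_sum_le_sum_abs _ _).trans (Finset.sum_le_sum fun j _ => ?_)
  rw [abs_mul]
  exact mul_le_mul_of_nonneg_left (hk i j) (abs_nonneg _)

theorem sq_sum_abs_le (a : Fin n → ℝ) : (∑ i, |a i|) ^ 2 ≤ n * ∑ i, a i ^ 2 := by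
  have := sq_sum_le_card_mul_sum_sq (s := Finset.univ) (f := fun i => |a i|)
  simpa using this

theorem AbsolutelyContinuousOnInterval.sum_sq {a b : ℝ}
    (hu : ∀ i, AbsolutelyContinuousOnInterval (u i) a b) :
    AbsolutelyContinuousOnInterval (fun τ => ∑ i, u i τ ^ 2) a b := by
  simp only [sq]
  exact finset_sum Finset.univ fun i _ => (hu i).fun_mul (hu i)

/-- Exponential decay along a perturbation of a coercive linear flow. -/
theorem IsPerturbedFlow.sum_sq_le (h : IsPerturbedFlow K γ κ u t) (ht : 0 ≤ t) (hγ : 0 ≤ γ)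
    (hK : ∀ c : Fin n → ℝ, lam * ∑ i, c i ^ 2 ≤ ∑ i, ∑ j, c i * c j * K i j) (hκ0 : 0 ≤ κ)
    (hκ : κ * n ≤ lam / 2) :
    ∑ i, u i t ^ 2 ≤ Real.exp (-(γ * lam * t)) * ∑ i, u i 0 ^ 2 := by
  have hexp : AbsolutelyContinuousOnInterval (fun τ => Real.exp (γ * lam * τ)) 0 t :=
    (by fun_prop : ContDiff ℝ 1 fun τ => Real.exp (γ * lam * τ)).contDiffOn.absolutelyContinuousOnInterval
  -- The function exp(γ lam τ) ∑ u_i² is nonincreasing. Coercivity gives the rate 2 γ lam, and the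
  -- perturbation costs at most half of it because (∑|u_i|)² ≤ n ∑ u_i² and κ n ≤ lam/2.
  have hdec := (hexp.fun_mul (AbsolutelyContinuousOnInterval.sum_sq h.1)).le_of_deriv_nonpos ht (by
    filter_upwards [h.2] with τ hτ hτm
    choose k hk hd using hτ hτm
    have h1 : HasDerivAt (fun τ => Real.exp (γ * lam * τ))
        (Real.exp (γ * lam * τ) * (γ * lam)) τ := by
      simpa using ((hasDerivAt_id τ).const_mul (γ * lam)).exp
    have h2 := h1.mul (HasDerivAt.fun_sum (u := Finset.univ) fun i _ => (hd i).pow 2)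
    refine ⟨_, h2, ?_⟩
    have h3 := abs_sum_mul_sum_mul_sub_le hk (fun i => u i τ) (fun i => u i τ)
    have h4 := hK fun i => u i τ
    have h5 := sq_sum_abs_le fun i => u i τ
    have hE : 0 ≤ ∑ i, u i τ ^ 2 := Finset.sum_nonneg fun i _ => sq_nonneg _
    have h6 : κ * (∑ i, |u i τ|) ^ 2 ≤ lam / 2 * ∑ i, u i τ ^ 2 :=
      (mul_le_mul_of_nonneg_left h5 hκ0).trans (by
        rw [← mul_assoc]; exact mul_le_mul_of_nonneg_right hκ hE)
    have e1 : ∑ i, u i τ * ∑ j, u j τ * (k i j - K i j)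
        = ∑ i, u i τ * ∑ j, u j τ * k i j - ∑ i, ∑ j, u i τ * u j τ * K i j := by
      simp only [mul_sub, Finset.sum_sub_distrib, Finset.mul_sum, mul_assoc]
    have h7 : lam / 2 * ∑ i, u i τ ^ 2 ≤ ∑ i, u i τ * ∑ j, u j τ * k i j := by
      rw [e1] at h3
      have := (abs_le.1 h3).1
      nlinarith
    have e2 : ∑ i, ((2 : ℕ) : ℝ) * u i τ ^ (2 - 1) * (-γ * ∑ j, u j τ * k i j)
        = -(2 * γ) * ∑ i, u i τ * ∑ j, u j τ * k i j := by
      rw [Finset.mul_sum]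
      refine Finset.sum_congr rfl fun i _ => ?_
      norm_num
      ring
    rw [e2]
    have h8 := mul_le_mul_of_nonneg_left h7 (mul_nonneg hγ (Real.exp_pos (γ * lam * τ)).le)
    simp only [Pi.pow_apply]
    linarith)
  simp only [mul_zero, Real.exp_zero, one_mul] at hdec
  rw [Real.exp_neg, ← div_eq_inv_mul, le_div_iff₀ (Real.exp_pos _), mul_comm]
  exact hdec

theorem integral_exp_neg_le {c : ℝ} (hc : 0 < c) (t : ℝ) :
    ∫ τ in (0 : ℝ)..t, Real.exp (-(c * τ)) ≤ 1 / c := by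
  have h : ∀ τ ∈ Set.uIcc 0 t, HasDerivAt (fun τ => -(1 / c) * Real.exp (-(c * τ)))
      (Real.exp (-(c * τ))) τ := fun τ _ => by
    have h1 := ((((hasDerivAt_id τ).const_mul c).neg).exp).const_mul (-(1 / c))
    refine h1.congr_deriv ?_
    simp only [id, Pi.neg_apply]
    field_simp
  rw [intervalIntegral.integral_eq_sub_of_hasDerivAt h
    (Continuous.intervalIntegrable (by fun_prop) _ _)]
  have := Real.exp_pos (-(c * t))
  have : 0 ≤ 1 / c * Real.exp (-(c * t)) := by positivity
  simp only [mul_zero, neg_zero, Real.exp_zero]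
  linarith

theorem IsPerturbedFlow.sum_abs_le (h : IsPerturbedFlow K γ κ u t) (hγ : 0 ≤ γ)
    (hK : ∀ c : Fin n → ℝ, lam * ∑ i, c i ^ 2 ≤ ∑ i, ∑ j, c i * c j * K i j) (hκ0 : 0 ≤ κ)
    (hκ : κ * n ≤ lam / 2) {τ : ℝ} (hτ : τ ∈ Set.Icc 0 t) :
    ∑ i, |u i τ| ≤ √(n * ∑ i, u i 0 ^ 2) * Real.exp (-(γ * lam / 2 * τ)) := by
  have h1 := (h.mono hτ.1 hτ.2).sum_sq_le hτ.1 hγ hK hκ0 hκ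
  have hE : 0 ≤ ∑ i, u i 0 ^ 2 := Finset.sum_nonneg fun i _ => sq_nonneg _
  refine (le_abs_self _).trans (abs_le_of_sq_le_sq ?_ (by positivity))
  rw [mul_pow, Real.sq_sqrt (by positivity), ← Real.exp_nat_mul]
  refine (sq_sum_abs_le _).trans ((mul_le_mul_of_nonneg_left h1 (Nat.cast_nonneg n)).trans
    (le_of_eq ?_))
  rw [show ((2 : ℕ) : ℝ) * -(γ * lam / 2 * τ) = -(γ * lam * τ) by push_cast; ring]
  ring

theorem IsPerturbedFlow.sum_abs_le_sqrt (h : IsPerturbedFlow K γ κ u t) (hγ : 0 ≤ γ)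
    (hlam : 0 ≤ lam)
    (hK : ∀ c : Fin n → ℝ, lam * ∑ i, c i ^ 2 ≤ ∑ i, ∑ j, c i * c j * K i j) (hκ0 : 0 ≤ κ)
    (hκ : κ * n ≤ lam / 2) {τ : ℝ} (hτ : τ ∈ Set.Icc 0 t) :
    ∑ i, |u i τ| ≤ √(n * ∑ i, u i 0 ^ 2) := by
  refine (h.sum_abs_le hγ hK hκ0 hκ hτ).trans (mul_le_of_le_one_right (Real.sqrt_nonneg _) ?_)
  have : 0 ≤ γ * lam / 2 * τ := mul_nonneg (by positivity) hτ.1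
  exact Real.exp_le_one_iff.2 (by linarith)

theorem IsPerturbedFlow.integral_sum_abs_le (h : IsPerturbedFlow K γ κ u t) (ht : 0 ≤ t)
    (hγ : 0 < γ) (hlam : 0 < lam)
    (hK : ∀ c : Fin n → ℝ, lam * ∑ i, c i ^ 2 ≤ ∑ i, ∑ j, c i * c j * K i j) (hκ0 : 0 ≤ κ)
    (hκ : κ * n ≤ lam / 2) :
    ∫ τ in (0 : ℝ)..t, ∑ i, |u i τ| ≤ √(n * ∑ i, u i 0 ^ 2) * (1 / (γ * lam / 2)) := by
  have h1 : ∫ τ in (0 : ℝ)..t, ∑ i, |u i τ|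
      ≤ ∫ τ in (0 : ℝ)..t, √(n * ∑ i, u i 0 ^ 2) * Real.exp (-(γ * lam / 2 * τ)) :=
    intervalIntegral.integral_mono_on ht ((h.continuousOn_sum_abs ht).intervalIntegrable_of_Icc ht)
      (Continuous.intervalIntegrable (by fun_prop) _ _)
      fun τ hτ => h.sum_abs_le hγ.le hK hκ0 hκ hτ
  refine h1.trans ?_
  rw [intervalIntegral.integral_const_mul]
  exact mul_le_mul_of_nonneg_left (integral_exp_neg_le (by positivity) t) (Real.sqrt_nonneg _)

/-- A perturbation of a coercive linear flow stays close to the flow itself. -/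
theorem IsPerturbedFlow.sum_sq_sub_le (h : IsPerturbedFlow K γ κ u t)
    (hv : IsPerturbedFlow K γ 0 v t) (huv : ∀ i, u i 0 = v i 0) (ht : 0 ≤ t) (hγ : 0 ≤ γ)
    (hlam : 0 ≤ lam)
    (hK : ∀ c : Fin n → ℝ, lam * ∑ i, c i ^ 2 ≤ ∑ i, ∑ j, c i * c j * K i j) (hκ0 : 0 ≤ κ)
    (hκ : κ * n ≤ lam / 2) {Q : ℝ} (hQ : ∫ τ in (0 : ℝ)..t, ∑ i, |u i τ| ≤ Q) :
    ∑ i, (u i t - v i t) ^ 2 ≤ 4 * γ * κ * √(n * ∑ i, u i 0 ^ 2) * Q := by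
  set Y := √(n * ∑ i, u i 0 ^ 2) with hY
  have hvY : √(n * ∑ i, v i 0 ^ 2) = Y := by
    rw [hY]; simp only [huv]
  have hY0 : 0 ≤ Y := Real.sqrt_nonneg _
  have hD := (AbsolutelyContinuousOnInterval.sum_sq (u := fun i τ => u i τ - v i τ)
    fun i => (h.1 i).fun_sub (hv.1 i)).sub_le_integral ht
    (g := fun τ => 4 * γ * κ * Y * ∑ i, |u i τ|)
    (continuousOn_const.mul (h.continuousOn_sum_abs ht)) (by
      filter_upwards [h.2, hv.2] with τ h1 h2 hτ
      choose k hk hd using h1 hτ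
      choose l hl hdv using h2 hτ
      have hl' : ∀ i j, l i j = K i j := fun i j =>
        sub_eq_zero.1 (abs_nonpos_iff.1 (hl i j))
      simp only [hl'] at hdv
      refine ⟨_, HasDerivAt.fun_sum (u := Finset.univ) fun i _ => ((hd i).sub (hdv i)).pow 2, ?_⟩
      set D : Fin n → ℝ := fun i => u i τ - v i τ with hDdef
      have e : ∑ i, ((2 : ℕ) : ℝ) * (u i - v i) τ ^ (2 - 1) *
          (-γ * ∑ j, u j τ * k i j - -γ * ∑ j, v j τ * K i j)
          = -(2 * γ) * (∑ i, ∑ j, D i * D j * K i j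
            + ∑ i, D i * ∑ j, u j τ * (k i j - K i j)) := by
        rw [← Finset.sum_add_distrib, Finset.mul_sum]
        refine Finset.sum_congr rfl fun i _ => ?_
        have e1 : ∑ j, D i * D j * K i j + D i * ∑ j, u j τ * (k i j - K i j)
            = D i * (∑ j, u j τ * k i j - ∑ j, v j τ * K i j) := by
          rw [← Finset.sum_sub_distrib, Finset.mul_sum, Finset.mul_sum, ← Finset.sum_add_distrib]
          refine Finset.sum_congr rfl fun j _ => ?_
          simp only [hDdef]
          ring
        rw [e1]
        simp only [hDdef, Pi.sub_apply]
        norm_num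
        ring
      -- The exact part of the flow only contracts the difference, so its sign suffices. What
      -- remains is the perturbation, bounded by κ (∑|D_i|)(∑|u_j|), which is integrable in time
      -- uniformly in `t`.
      have h3 : 0 ≤ ∑ i, ∑ j, D i * D j * K i j :=
        (mul_nonneg hlam (Finset.sum_nonneg fun i _ => sq_nonneg (D i))).trans (hK D)
      have h4 := (abs_le.1 (abs_sum_mul_sum_mul_sub_le hk D fun i => u i τ)).1
      have hnlam : (0 : ℝ) * n ≤ lam / 2 := by linarith
      have h5 : ∑ i, |D i| ≤ 2 * Y := by
        have e1 := h.sum_abs_le_sqrt hγ hlam hK hκ0 hκ hτ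
        have e2 := hv.sum_abs_le_sqrt hγ hlam hK le_rfl hnlam hτ
        rw [hvY] at e2
        have e3 : ∑ i, |D i| ≤ ∑ i, |u i τ| + ∑ i, |v i τ| := by
          rw [← Finset.sum_add_distrib]
          exact Finset.sum_le_sum fun i _ => abs_sub _ _
        linarith
      have hU : 0 ≤ ∑ i, |u i τ| := Finset.sum_nonneg fun i _ => abs_nonneg _
      have h6 := mul_le_mul_of_nonneg_right (mul_le_mul_of_nonneg_left h5 hκ0) hU
      refine (le_of_eq e).trans ?_
      have h7 := mul_le_mul_of_nonneg_left (neg_le.1 h4) hγ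
      have h8 := mul_le_mul_of_nonneg_left h6 hγ
      have h9 := mul_nonneg hγ h3
      nlinarith)
  simp only [huv, sub_self, ne_eq, OfNat.ofNat_ne_zero, not_false_eq_true, zero_pow,
    Finset.sum_const_zero, sub_zero] at hD
  rw [intervalIntegral.integral_const_mul] at hD
  exact hD.trans (mul_le_mul_of_nonneg_left hQ (by positivity))

end PerturbedFlow

/-! ### Comparison of the network with the regression function of the tangent kernel -/

section MatrixExponential

variable {n : ℕ}

attribute [local instance] Matrix.linftyOpNormedRing Matrix.linftyOpNormedAlgebra

/-- The local algebra norm on matrices serves to differentiate the exponential; applying to `y` and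
taking a coordinate is linear in the matrix. -/
theorem hasDerivAt_exp_neg_div_smul_mulVec (A : Matrix (Fin n) (Fin n) ℝ) (y : Fin n → ℝ) (c τ : ℝ)
    (i : Fin n) :
    HasDerivAt (fun τ : ℝ => (NormedSpace.exp (-(τ / c) • A) *ᵥ y) i)
      (-(1 / c) * (A *ᵥ (NormedSpace.exp (-(τ / c) • A) *ᵥ y)) i) τ := by
  have h1 : HasDerivAt (fun τ : ℝ => -(τ / c)) (-(1 / c)) τ := ((hasDerivAt_id τ).div_const c).neg
  have h2 := (hasDerivAt_exp_smul_const' (𝕂 := ℝ) A (-(τ / c))).scomp τ h1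
  let L : Matrix (Fin n) (Fin n) ℝ →ₗ[ℝ] ℝ :=
    { toFun := fun B => (B *ᵥ y) i
      map_add' := fun B C => by rw [Matrix.add_mulVec]; rfl
      map_smul' := fun a B => by rw [Matrix.smul_mulVec]; rfl }
  have h3 := (LinearMap.toContinuousLinearMap L).hasFDerivAt.comp_hasDerivAt τ h2
  refine h3.congr_deriv ?_
  change ((-(1 / c) • (A * NormedSpace.exp (-(τ / c) • A))) *ᵥ y) i = _
  rw [Matrix.smul_mulVec, Matrix.mulVec_mulVec]
  rfl

end MatrixExponential

section Comparison

variable {n d : ℕ} (x : Fin n → EuclideanSpace ℝ (Fin d)) (y : Fin n → ℝ)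

/-- The residuals of the gradient flow of kernel regression with the tangent kernel. -/
noncomputable def ntkResidual (i : Fin n) (t : ℝ) : ℝ :=
  -(NormedSpace.exp (-(t / (n : ℝ)) • ntkGram x) *ᵥ y) i

theorem ntkResidual_zero (i : Fin n) : ntkResidual x y i 0 = -y i := by
  simp [ntkResidual]

theorem hasDerivAt_ntkResidual (i : Fin n) (τ : ℝ) : HasDerivAt (ntkResidual x y i)
    (-(1 / (n : ℝ)) * ∑ j, ntkResidual x y j τ * ntk (x i) (x j)) τ := by
  refine (hasDerivAt_exp_neg_div_smul_mulVec (ntkGram x) y n τ i).neg.congr_deriv ?_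
  rw [Matrix.mulVec, dotProduct, ← mul_neg, ← Finset.sum_neg_distrib]
  congr 1
  refine Finset.sum_congr rfl fun j _ => ?_
  simp only [ntkResidual, ntkGram, Matrix.of_apply]
  ring

theorem isPerturbedFlow_ntkResidual (t : ℝ) :
    IsPerturbedFlow (fun i j => ntk (x i) (x j)) (1 / (n : ℝ)) 0 (ntkResidual x y) t := by
  refine ⟨fun i => ContDiffOn.absolutelyContinuousOnInterval (ContDiff.contDiffOn ?_),
    Eventually.of_forall fun τ _ i => ⟨fun j => ntk (x i) (x j), fun j => by simp,
      hasDerivAt_ntkResidual x y i τ⟩⟩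
  have hcont : ∀ j, Continuous (ntkResidual x y j) := fun j =>
    continuous_iff_continuousAt.2 fun τ => (hasDerivAt_ntkResidual x y j τ).continuousAt
  rw [contDiff_one_iff_deriv]
  refine ⟨fun τ => (hasDerivAt_ntkResidual x y i τ).differentiableAt, ?_⟩
  rw [funext fun τ => (hasDerivAt_ntkResidual x y i τ).deriv]
  fun_prop

/-- The coefficients `K(z, X) K(X, X)⁻¹` of kernel interpolation at the point `z`. -/
noncomputable def interpolationCoeff (z : EuclideanSpace ℝ (Fin d)) : Fin n → ℝ :=
  (fun i => ntk z (x i)) ᵥ* (ntkGram x)⁻¹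

variable {x}

theorem sum_interpolationCoeff_mul_ntk (hx : Function.Injective x) (z : EuclideanSpace ℝ (Fin d))
    (l : Fin n) : ∑ j, interpolationCoeff x z j * ntk (x j) (x l) = ntk z (x l) := by
  have h : interpolationCoeff x z ᵥ* ntkGram x = fun i => ntk z (x i) := by
    rw [interpolationCoeff, Matrix.vecMul_vecMul, Matrix.nonsing_inv_mul _ (isUnit_det_ntkGram hx),
      Matrix.vecMul_one]
  exact congrFun h l

/-- At every time the regression function is the kernel interpolant of its own values at the sample,
which are residual plus label. -/
theorem ntkRegression_eq_sum (t : ℝ) (z : EuclideanSpace ℝ (Fin d)) :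
    ntkRegression x y t z = ∑ j, interpolationCoeff x z j * (ntkResidual x y j t + y j) := by
  rw [ntkRegression, ← Matrix.mulVec_mulVec, Matrix.dotProduct_mulVec, Matrix.sub_mulVec,
    Matrix.one_mulVec, dotProduct]
  refine Finset.sum_congr rfl fun j _ => ?_
  rw [interpolationCoeff, ntkResidual, Pi.sub_apply]
  ring

theorem continuous_interpolationCoeff (j : Fin n) :
    Continuous fun z => interpolationCoeff x z j := by
  simp only [interpolationCoeff, Matrix.vecMul, dotProduct]
  exact continuous_finsetSum _ fun i _ => (continuous_ntk_left (x i)).mul continuous_const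

variable {y}

/-- A bound for the total residual, integrated over time, along a perturbation of the flow of kernel
regression when the kernel is coercive with constant `lam`. -/
noncomputable def residualBudget (lam : ℝ) (y : Fin n → ℝ) : ℝ :=
  √(n * ∑ i, y i ^ 2) * (1 / (1 / (n : ℝ) * lam / 2)) + 1

theorem one_le_residualBudget {lam : ℝ} (hlam : 0 ≤ lam) : 1 ≤ residualBudget lam y := by
  unfold residualBudget
  have : 0 ≤ √(n * ∑ i, y i ^ 2) * (1 / (1 / (n : ℝ) * lam / 2)) := by positivity
  linarith

/-- The relative distance that the parameters of a network of width `2 m` may move. -/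
noncomputable def movementBound (lam R : ℝ) (y : Fin n → ℝ) (m : ℕ) : ℝ :=
  2 * (1 / (n : ℝ) * √(2 / ((m + m : ℕ) : ℝ)) * residualBudget lam y) * (R + 1)

theorem movementBound_nonneg {lam R : ℝ} (hlam : 0 ≤ lam) (hR : 0 ≤ R) (y : Fin n → ℝ) (m : ℕ) :
    0 ≤ movementBound lam R y m := by
  have := zero_le_one.trans (one_le_residualBudget (y := y) hlam)
  unfold movementBound
  positivity

theorem tendsto_movementBound (lam R : ℝ) (y : Fin n → ℝ) :
    Tendsto (movementBound lam R y) atTop (𝓝 0) := by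
  have h1 : Tendsto (fun m : ℕ => (2 : ℝ) / ((m + m : ℕ) : ℝ)) atTop (𝓝 0) :=
    (tendsto_const_div_atTop_nhds_zero_nat 2).comp
      (tendsto_atTop_mono (fun m => Nat.le_add_right m m) tendsto_id)
  have h2 := h1.sqrt
  rw [Real.sqrt_zero] at h2
  have h3 := (((h2.const_mul (1 / (n : ℝ))).mul_const (residualBudget lam y)).const_mul 2).mul_const
    (R + 1)
  simp only [mul_zero, zero_mul] at h3
  exact h3

/-! ### The bootstrap and the comparison along a training trajectory -/

section Flow

variable {m : ℕ} {θ : ℝ → Params (m + m) d} {g : InitDraw m d} {R lam κ t : ℝ}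

theorem fitError_initParams (g : InitDraw m d) (i : Fin n) :
    fitError x y (initParams g) i = -y i := by
  rw [fitError, network_initParams, zero_sub]

theorem sum_sq_fitError_initParams (hθ0 : θ 0 = initParams g) :
    ∑ i, fitError x y (θ 0) i ^ 2 = ∑ i, y i ^ 2 := by
  simp only [hθ0, fitError_initParams, neg_sq]

/-- The assumptions under which the training dynamics are compared with kernel regression: `lam` is
a coercivity constant of the kernel, and the kernel errors at the sample points are at most `κ`. -/
structure IsGoodDraw (x : Fin n → EuclideanSpace ℝ (Fin d)) (y : Fin n → ℝ) (R lam κ : ℝ)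
    (g : InitDraw m d) : Prop where
  width_ne_zero : m ≠ 0
  movement_le : movementBound lam R y m ≤ 1 / 2
  kernelError_le : ∀ i j, kernelError (12 * (R + 1) ^ 2) R (movementBound lam R y m) (drawNeurons g)
    (x i) (x j) ≤ κ

theorem IsGradientFlow.ae_hasDerivAt_network_of_isGoodDraw (hθ : IsGradientFlow x y θ)
    (hθ0 : θ 0 = initParams g) (hg : IsGoodDraw x y R lam κ g) (hx : ∀ i, ‖x i‖ ≤ R) (hR : 0 ≤ R)
    (hlam : 0 < lam) (ht : 0 ≤ t)
    (hQ : ∫ w in (0 : ℝ)..t, ∑ i, |fitError x y (θ w) i| ≤ residualBudget lam y)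
    {z : EuclideanSpace ℝ (Fin d)} (hz : ‖z‖ ≤ R) :
    ∀ᵐ τ, τ ∈ Set.Icc 0 t → ∃ k : Fin n → ℝ,
      (∀ j, |k j - ntk z (x j)| ≤ kernelError (12 * (R + 1) ^ 2) R (movementBound lam R y m)
        (drawNeurons g) z (x j)) ∧
      HasDerivAt (fun τ => network (θ τ) z)
        (-(1 / (n : ℝ)) * ∑ j, fitError x y (θ τ) j * k j) τ :=
  hθ.ae_hasDerivAt_network ht hg.width_ne_zero (movementBound_nonneg hlam.le hR y m)
    (hg.movement_le.trans (by norm_num))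
    (fun _ hτ => hθ.isCloseToInit hθ0 ht hQ hx hR hg.movement_le hτ) hx hz

theorem IsGradientFlow.isPerturbedFlow (hθ : IsGradientFlow x y θ)
    (hθ0 : θ 0 = initParams g) (hg : IsGoodDraw x y R lam κ g) (hx : ∀ i, ‖x i‖ ≤ R) (hR : 0 ≤ R)
    (hlam : 0 < lam) (ht : 0 ≤ t)
    (hQ : ∫ w in (0 : ℝ)..t, ∑ i, |fitError x y (θ w) i| ≤ residualBudget lam y) :
    IsPerturbedFlow (fun i j => ntk (x i) (x j)) (1 / (n : ℝ)) κ
      (fun i τ => fitError x y (θ τ) i) t := by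
  refine ⟨fun i => ((hθ.1 t ht).network (x i)).fun_sub (AbsolutelyContinuousOnInterval.const _ _ _), ?_⟩
  filter_upwards [ae_all_iff.2 fun i =>
    hθ.ae_hasDerivAt_network_of_isGoodDraw hθ0 hg hx hR hlam ht hQ (hx i)] with τ h hτ i
  obtain ⟨k, hk, hd⟩ := h i hτ
  exact ⟨k, fun j => (hk j).trans (hg.kernelError_le i j), hd.sub_const _⟩

/-- The improvement step of the bootstrap: within the budget the parameters stay close to
initialization, hence the residuals decay exponentially and their integral is bounded by the budget
without its slack of 1. -/
theorem IsGradientFlow.integral_fitError_le_sub_one (hθ : IsGradientFlow x y θ)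
    (hθ0 : θ 0 = initParams g) (hg : IsGoodDraw x y R lam κ g) (hx : ∀ i, ‖x i‖ ≤ R) (hR : 0 ≤ R)
    (hlam : 0 < lam)
    (hK : ∀ c : Fin n → ℝ, lam * ∑ i, c i ^ 2 ≤ ∑ i, ∑ j, c i * c j * ntk (x i) (x j))
    (hκ0 : 0 ≤ κ) (hκ : κ * n ≤ lam / 2) (ht : 0 ≤ t)
    (hQ : ∫ w in (0 : ℝ)..t, ∑ i, |fitError x y (θ w) i| ≤ residualBudget lam y) :
    ∫ w in (0 : ℝ)..t, ∑ i, |fitError x y (θ w) i| ≤ residualBudget lam y - 1 := by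
  -- For n = 0 the factor 1/n is zero and gives no decay, but there are no residuals either.
  rcases Nat.eq_zero_or_pos n with hn | hn
  · subst hn
    simp [residualBudget]
  · have := (hθ.isPerturbedFlow hθ0 hg hx hR hlam ht hQ).integral_sum_abs_le ht
      (by positivity) hlam hK hκ0 hκ
    rw [sum_sq_fitError_initParams hθ0] at this
    rw [residualBudget, add_sub_cancel_right]
    exact this

theorem IsGradientFlow.integral_fitError_le (hθ : IsGradientFlow x y θ)
    (hθ0 : θ 0 = initParams g) (hg : IsGoodDraw x y R lam κ g) (hx : ∀ i, ‖x i‖ ≤ R) (hR : 0 ≤ R)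
    (hlam : 0 < lam)
    (hK : ∀ c : Fin n → ℝ, lam * ∑ i, c i ^ 2 ≤ ∑ i, ∑ j, c i * c j * ntk (x i) (x j))
    (hκ0 : 0 ≤ κ) (hκ : κ * n ≤ lam / 2) (ht : 0 ≤ t) :
    ∫ w in (0 : ℝ)..t, ∑ i, |fitError x y (θ w) i| ≤ residualBudget lam y := by
  by_contra! hlt
  have hcont : ContinuousOn (fun τ => ∫ w in (0 : ℝ)..τ, ∑ i, |fitError x y (θ w) i|)
      (Set.Icc 0 t) := by
    have := intervalIntegral.continuousOn_primitive_interval (μ := volume) (a := 0) (b := t)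
      (f := fun w => ∑ i, |fitError x y (θ w) i|) (by
        rw [Set.uIcc_of_le ht]
        exact (hθ.continuousOn_sum_abs_residual ht).integrableOn_Icc)
    rwa [Set.uIcc_of_le ht] at this
  -- If the budget were exceeded, the continuous integral would equal it at some time, whereas the
  -- improvement step puts it at least 1 below at that time.
  obtain ⟨τ, hτ, heq⟩ := intermediate_value_Icc ht hcont
    ⟨by simpa using zero_le_one.trans (one_le_residualBudget (y := y) hlam.le), hlt.le⟩
  have := hθ.integral_fitError_le_sub_one hθ0 hg hx hR hlam hK hκ0 hκ hτ.1 heq.le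
  simp only at heq
  linarith

/-- For a good draw, the trained network is close to kernel regression at all times. -/
theorem IsGradientFlow.abs_network_sub_ntkRegression_le (hθ : IsGradientFlow x y θ)
    (hθ0 : θ 0 = initParams g) (hg : IsGoodDraw x y R lam κ g) (hinj : Function.Injective x)
    (hx : ∀ i, ‖x i‖ ≤ R) (hR : 0 ≤ R) (hlam : 0 < lam)
    (hK : ∀ c : Fin n → ℝ, lam * ∑ i, c i ^ 2 ≤ ∑ i, ∑ j, c i * c j * ntk (x i) (x j))
    (hκ0 : 0 ≤ κ) (hκ : κ * n ≤ lam / 2) (ht : 0 ≤ t) {z : EuclideanSpace ℝ (Fin d)} (hz : ‖z‖ ≤ R)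
    {A a : ℝ} (hA0 : 0 ≤ A) (hA : ∀ j, kernelError (12 * (R + 1) ^ 2) R (movementBound lam R y m)
      (drawNeurons g) z (x j) ≤ A) (ha : ∑ j, |interpolationCoeff x z j| ≤ a) :
    |network (θ t) z - ntkRegression x y t z|
      ≤ 1 / (n : ℝ) * residualBudget lam y * A
        + a * (1 / (n : ℝ) * residualBudget lam y * κ
          + √(4 * (1 / (n : ℝ)) * κ * √(n * ∑ i, y i ^ 2) * residualBudget lam y)) := by
  have hQ := hθ.integral_fitError_le hθ0 hg hx hR hlam hK hκ0 hκ ht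
  have hQ0 := zero_le_one.trans (one_le_residualBudget (y := y) hlam.le)
  set Q := residualBudget lam y with hQdef
  have hflow := hθ.isPerturbedFlow hθ0 hg hx hR hlam ht hQ
  have ha0 : 0 ≤ a := (Finset.sum_nonneg fun j _ => abs_nonneg _).trans ha
  set α := interpolationCoeff x z with hα
  have hD := hflow.sum_sq_sub_le (isPerturbedFlow_ntkResidual x y t)
    (fun i => by rw [ntkResidual_zero, hθ0, fitError_initParams]) ht (by positivity) hlam.le hK hκ0 hκ hQ
  rw [sum_sq_fitError_initParams hθ0] at hD
  set P := 4 * (1 / (n : ℝ)) * κ * √(n * ∑ i, y i ^ 2) * Q with hP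
  have hdiff : ∀ j, |fitError x y (θ t) j - ntkResidual x y j t| ≤ √P := fun j =>
    Real.abs_le_sqrt ((Finset.single_le_sum
      (f := fun i => (fitError x y (θ t) i - ntkResidual x y i t) ^ 2)
      (fun i _ => sq_nonneg _) (Finset.mem_univ j)).trans hD)
  -- Subtracting the interpolated residuals removes the limit kernel from the derivative, because α
  -- K_d(X, X) = K_d(z, X). Its speed is therefore bounded by kernel errors times the total
  -- residual.
  have hspeed := hθ.abs_sub_le_of_speed hQ
    (f := fun τ => network (θ τ) z - ∑ j, α j * fitError x y (θ τ) j)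
    (C := 1 / (n : ℝ) * (A + a * κ)) (by positivity)
    (fun τ hτ => ((hθ.1 τ hτ.1).network z).fun_sub
      (AbsolutelyContinuousOnInterval.finset_sum Finset.univ fun j _ =>
        ((hflow.mono hτ.1 hτ.2).1 j).const_mul (α j))) (by
      filter_upwards [hflow.2, hθ.ae_hasDerivAt_network_of_isGoodDraw hθ0 hg hx hR hlam ht hQ hz]
        with τ h1 h2 hτ
      choose k hk hd using h1 hτ
      obtain ⟨l, hl, hdl⟩ := h2 hτ
      refine ⟨_, hdl.sub (HasDerivAt.fun_sum (u := Finset.univ) fun j _ => (hd j).const_mul (α j)), ?_⟩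
      set u := fun j => fitError x y (θ τ) j with hu
      have e : -(1 / (n : ℝ)) * ∑ j, u j * l j - ∑ j, α j * (-(1 / (n : ℝ)) * ∑ i, u i * k j i)
          = -(1 / (n : ℝ)) * ∑ i, u i * ((l i - ntk z (x i))
            - ∑ j, α j * (k j i - ntk (x j) (x i))) := by
        have e1 : ∀ i, ∑ j, α j * (k j i - ntk (x j) (x i)) = ∑ j, α j * k j i - ntk z (x i) := by
          intro i
          simp only [mul_sub, Finset.sum_sub_distrib]
          rw [hα, sum_interpolationCoeff_mul_ntk hinj]
        have e2 : ∑ j, α j * (-(1 / (n : ℝ)) * ∑ i, u i * k j i)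
            = -(1 / (n : ℝ)) * ∑ i, u i * ∑ j, α j * k j i := by
          simp only [Finset.mul_sum]
          rw [Finset.sum_comm]
          exact Finset.sum_congr rfl fun i _ => Finset.sum_congr rfl fun j _ => by ring
        rw [e2, ← mul_sub, ← Finset.sum_sub_distrib]
        congr 1
        refine Finset.sum_congr rfl fun i _ => ?_
        rw [e1]
        ring
      rw [e, abs_mul, abs_neg, abs_of_nonneg (by positivity : (0 : ℝ) ≤ 1 / n), mul_assoc]
      refine mul_le_mul_of_nonneg_left ?_ (by positivity)
      rw [Finset.mul_sum]
      refine (Finset.abs_sum_le_sum_abs _ _).trans (Finset.sum_le_sum fun i _ => ?_)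
      rw [abs_mul, mul_comm]
      refine mul_le_mul_of_nonneg_right ?_ (abs_nonneg _)
      refine (abs_sub _ _).trans (add_le_add ((hl i).trans (hA i)) ?_)
      refine (Finset.abs_sum_le_sum_abs _ _).trans ?_
      refine le_trans ?_ (mul_le_mul_of_nonneg_right ha hκ0)
      rw [Finset.sum_mul]
      refine Finset.sum_le_sum fun j _ => ?_
      rw [abs_mul]
      exact mul_le_mul_of_nonneg_left (hk j i) (abs_nonneg _)) (Set.right_mem_Icc.2 ht)
  have hstart : network (θ 0) z - ∑ j, α j * fitError x y (θ 0) j = ∑ j, α j * y j := by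
    simp only [hθ0, network_initParams, fitError_initParams, mul_neg, Finset.sum_neg_distrib]
    ring
  rw [hstart] at hspeed
  have e : network (θ t) z - ntkRegression x y t z
      = (network (θ t) z - ∑ j, α j * fitError x y (θ t) j - ∑ j, α j * y j)
        + ∑ j, α j * (fitError x y (θ t) j - ntkResidual x y j t) := by
    rw [ntkRegression_eq_sum]
    simp only [mul_add, mul_sub, Finset.sum_add_distrib, Finset.sum_sub_distrib, ← hα]
    ring
  have h2 : |∑ j, α j * (fitError x y (θ t) j - ntkResidual x y j t)| ≤ a * √P := by
    refine (Finset.abs_sum_le_sum_abs _ _).trans ?_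
    refine le_trans ?_ (mul_le_mul_of_nonneg_right ha (Real.sqrt_nonneg _))
    rw [Finset.sum_mul]
    refine Finset.sum_le_sum fun j _ => ?_
    rw [abs_mul]
    exact mul_le_mul_of_nonneg_left (hdiff j) (abs_nonneg _)
  rw [e]
  refine (abs_add_le _ _).trans ((add_le_add hspeed h2).trans (le_of_eq ?_))
  ring

end Flow

/-- The kernel residuals form an unperturbed flow, so they never exceed their initial bound. Adding
the labels gives the factor 2, uniformly in time. -/
theorem abs_ntkRegression_le {lam t a : ℝ} (hlam : 0 ≤ lam)
    (hK : ∀ c : Fin n → ℝ, lam * ∑ i, c i ^ 2 ≤ ∑ i, ∑ j, c i * c j * ntk (x i) (x j))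
    (ht : 0 ≤ t) {z : EuclideanSpace ℝ (Fin d)} (ha : ∑ j, |interpolationCoeff x z j| ≤ a) :
    |ntkRegression x y t z| ≤ 2 * (a * √(n * ∑ i, y i ^ 2)) := by
  have hn : (0 : ℝ) * n ≤ lam / 2 := by linarith
  have h1 := fun τ (hτ : τ ∈ Set.Icc 0 t) => (isPerturbedFlow_ntkResidual x y t).sum_abs_le_sqrt
    (by positivity) hlam hK le_rfl hn hτ
  simp only [ntkResidual_zero, neg_sq] at h1
  set Y := √(n * ∑ i, y i ^ 2) with hY
  have h2 := h1 t (Set.right_mem_Icc.2 ht)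
  have h3 := h1 0 (Set.left_mem_Icc.2 ht)
  simp only [ntkResidual_zero, abs_neg] at h3
  have hj : ∀ j, |ntkResidual x y j t + y j| ≤ 2 * Y := fun j => by
    have e1 := (Finset.single_le_sum (f := fun i => |ntkResidual x y i t|)
      (fun i _ => abs_nonneg _) (Finset.mem_univ j)).trans h2
    have e2 := (Finset.single_le_sum (f := fun i => |y i|)
      (fun i _ => abs_nonneg _) (Finset.mem_univ j)).trans h3
    refine (abs_add_le _ _).trans ?_
    linarith
  rw [ntkRegression_eq_sum]
  refine (Finset.abs_sum_le_sum_abs _ _).trans ?_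
  have : ∑ j, |interpolationCoeff x z j| * (2 * Y) ≤ a * (2 * Y) := by
    rw [← Finset.sum_mul]
    exact mul_le_mul_of_nonneg_right ha (by positivity)
  refine le_trans (Finset.sum_le_sum fun j _ => ?_) (this.trans (le_of_eq (by ring)))
  rw [abs_mul]
  exact mul_le_mul_of_nonneg_left (hj j) (abs_nonneg _)

theorem continuous_ntkRegression (t : ℝ) : Continuous (ntkRegression x y t) := by
  rw [show ntkRegression x y t = _ from funext fun z => ntkRegression_eq_sum y t z]
  exact continuous_finsetSum _ fun j _ => (continuous_interpolationCoeff j).mul continuous_const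

end Comparison

/-! ### Comparison of the risks, and the choice of the exceptional probabilities -/

/-- Exceptional probabilities that tend to zero for every accuracy are dominated by a single null
sequence. -/
theorem exists_tendsto_zero_forall_eventually_le (P : ℝ → ℕ → ℝ≥0∞)
    (hanti : ∀ ε ε' m, ε ≤ ε' → P ε' m ≤ P ε m)
    (hP : ∀ ε, 0 < ε → Tendsto (P ε) atTop (𝓝 0)) :
    ∃ δ : ℕ → ℝ≥0∞, Tendsto δ atTop (𝓝 0) ∧ ∀ ε, 0 < ε → ∀ᶠ m in atTop, P ε m ≤ δ m := by
  have hev : ∀ ε, 0 < ε → ∀ᶠ m in atTop, P ε m ≤ ENNReal.ofReal ε := fun ε hε =>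
    ((hP ε hε).eventually_lt_const (ENNReal.ofReal_pos.2 hε)).mono fun m hm => hm.le
  -- Accuracy and probability are optimized together. The infimum tends to zero, since for fixed `e`
  -- the maximum is eventually `e`. It dominates `P ε` eventually: for e ≤ ε by monotonicity, for e
  -- ≥ ε because `P ε m ≤ ε` eventually.
  refine ⟨fun m => ⨅ (e : ℝ) (_ : 0 < e), max (P e m) (ENNReal.ofReal e), ?_, fun ε hε => ?_⟩
  · rw [ENNReal.tendsto_nhds_zero]
    intro η hη
    rcases eq_or_ne η ∞ with rfl | hη'
    · exact Eventually.of_forall fun m => le_top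
    have hpos := ENNReal.toReal_pos hη.ne' hη'
    filter_upwards [hev _ hpos] with m hm
    refine (iInf₂_le η.toReal hpos).trans ?_
    rw [ENNReal.ofReal_toReal hη'] at hm ⊢
    exact max_le hm le_rfl
  · filter_upwards [hev ε hε] with m hm
    refine le_iInf₂ fun e he => ?_
    rcases le_total e ε with h | h
    · exact (hanti e ε m h).trans (le_max_left _ _)
    · exact (hm.trans (ENNReal.ofReal_le_ofReal h)).trans (le_max_right _ _)

section Risk

variable {n d : ℕ} {𝒳 : Set (EuclideanSpace ℝ (Fin d))} {μ : Measure (EuclideanSpace ℝ (Fin d))}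
  {fstar : EuclideanSpace ℝ (Fin d) → ℝ}

theorem continuous_network_input {M : ℕ} (θ : Params M d) : Continuous (network θ) := by
  unfold network preact
  have := continuous_relu
  fun_prop

/-- A bound for the difference of the risks of two functions with distance `c₁ √T + c₂`, if the
integral of `T` is at most `κ ^ 2`. -/
noncomputable def riskBound (c₁ c₂ B V κ : ℝ) : ℝ :=
  (2 * c₁ ^ 2 + 2 * B * (c₁ / κ)) * κ ^ 2 + (2 * c₂ ^ 2 + 2 * B * (c₁ * κ + c₂)) * V

/-- The difference of the squares is (f - g)((f - g) + 2(g - f⋆)), so besides the square of f - g it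
contains a term linear in √T. The inequality √T ≤ T/κ + κ reduces this to the integral of `T`, with
weights matched to the bound κ². -/
theorem abs_excessRisk_sub_le [IsFiniteMeasure μ] (h𝒳 : IsCompact 𝒳) (hfstar : ContinuousOn fstar 𝒳)
    {f g T : EuclideanSpace ℝ (Fin d) → ℝ} (hf : Continuous f) (hg : Continuous g)
    (hT : Integrable T (μ.restrict 𝒳)) (hT0 : ∀ z, 0 ≤ T z) {c₁ c₂ B κ : ℝ} (hc₁ : 0 ≤ c₁)
    (hc₂ : 0 ≤ c₂) (hB0 : 0 ≤ B) (hκ : 0 < κ) (hfg : ∀ z ∈ 𝒳, |f z - g z| ≤ c₁ * √(T z) + c₂)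
    (hB : ∀ z ∈ 𝒳, |g z - fstar z| ≤ B) (hTκ : ∫ z in 𝒳, T z ∂μ ≤ κ ^ 2) :
    |excessRisk 𝒳 μ fstar f - excessRisk 𝒳 μ fstar g| ≤ riskBound c₁ c₂ B (μ.real 𝒳) κ := by
  have hint : ∀ {h : EuclideanSpace ℝ (Fin d) → ℝ}, Continuous h →
      Integrable (fun z => (h z - fstar z) ^ 2) (μ.restrict 𝒳) := fun hh =>
    ((hh.continuousOn.sub hfstar).pow 2).integrableOn_compact h𝒳
  set W : EuclideanSpace ℝ (Fin d) → ℝ := fun z => (2 * c₁ ^ 2 + 2 * B * (c₁ / κ)) * T z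
    + (2 * c₂ ^ 2 + 2 * B * (c₁ * κ + c₂)) with hW
  have hpt : ∀ z ∈ 𝒳, |(f z - fstar z) ^ 2 - (g z - fstar z) ^ 2| ≤ W z := by
    intro z hz
    have hs0 := Real.sqrt_nonneg (T z)
    have hs2 := Real.sq_sqrt (hT0 z)
    set σ := √(T z) with hσ
    have e : (f z - fstar z) ^ 2 - (g z - fstar z) ^ 2
        = (f z - g z) * ((f z - g z) + 2 * (g z - fstar z)) := by ring
    have h1 := hfg z hz
    have h2 : |(f z - g z) + 2 * (g z - fstar z)| ≤ (c₁ * σ + c₂) + 2 * B := by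
      refine (abs_add_le _ _).trans (add_le_add h1 ?_)
      rw [abs_mul, abs_two]
      linarith [hB z hz]
    have h3 : σ ≤ T z / κ + κ := by
      rw [← hs2, div_add' _ _ _ hκ.ne', le_div_iff₀ hκ]
      nlinarith [sq_nonneg (σ - κ)]
    rw [e, abs_mul]
    refine (mul_le_mul h1 h2 (abs_nonneg _) (by positivity)).trans ?_
    have h4 : 2 * B * c₁ * σ ≤ 2 * B * c₁ * (T z / κ + κ) :=
      mul_le_mul_of_nonneg_left h3 (by positivity)
    have h5 : (c₁ * σ + c₂) ^ 2 ≤ 2 * c₁ ^ 2 * T z + 2 * c₂ ^ 2 := by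
      rw [← hs2]
      nlinarith [sq_nonneg (c₁ * σ - c₂)]
    calc (c₁ * σ + c₂) * (c₁ * σ + c₂ + 2 * B)
        = (c₁ * σ + c₂) ^ 2 + 2 * B * c₁ * σ + 2 * B * c₂ := by ring
      _ ≤ (2 * c₁ ^ 2 * T z + 2 * c₂ ^ 2) + 2 * B * c₁ * (T z / κ + κ) + 2 * B * c₂ := by linarith
      _ = W z := by rw [hW]; ring
  have hWint : Integrable W (μ.restrict 𝒳) := (hT.const_mul _).add (integrable_const _)
  unfold excessRisk
  rw [← integral_sub (hint hf) (hint hg)]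
  refine (abs_integral_le_integral_abs).trans ?_
  have hmono : ∫ z in 𝒳, |(f z - fstar z) ^ 2 - (g z - fstar z) ^ 2| ∂μ ≤ ∫ z in 𝒳, W z ∂μ :=
    setIntegral_mono_on ((hint hf).sub (hint hg)).abs hWint h𝒳.measurableSet hpt
  refine hmono.trans ?_
  rw [hW, integral_add (hT.const_mul _) (integrable_const _), integral_const_mul,
    setIntegral_const, smul_eq_mul, riskBound, mul_comm (μ.real 𝒳)]
  have : 0 ≤ 2 * c₁ ^ 2 + 2 * B * (c₁ / κ) := by positivity
  linarith [mul_le_mul_of_nonneg_left hTκ this]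

theorem tendsto_riskBound (c₁ B V : ℝ) {c₂ : ℝ → ℝ} (hc₂ : Tendsto c₂ (𝓝[>] 0) (𝓝 0)) :
    Tendsto (fun κ => riskBound c₁ (c₂ κ) B V κ) (𝓝[>] 0) (𝓝 0) := by
  have hid : Tendsto (fun κ : ℝ => κ) (𝓝[>] 0) (𝓝 0) := tendsto_nhdsWithin_of_tendsto_nhds tendsto_id
  have h1 : Tendsto (fun κ : ℝ => 2 * c₁ ^ 2 * κ ^ 2 + 2 * B * c₁ * κ
      + (2 * c₂ κ ^ 2 + 2 * B * (c₁ * κ + c₂ κ)) * V) (𝓝[>] 0) (𝓝 0) := by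
    have := (((hid.pow 2).const_mul (2 * c₁ ^ 2)).add (hid.const_mul (2 * B * c₁))).add
      ((((hc₂.pow 2).const_mul 2).add (((hid.const_mul c₁).add hc₂).const_mul (2 * B))).mul_const V)
    simpa using this
  refine h1.congr' ?_
  filter_upwards [self_mem_nhdsWithin] with κ hκ
  have hκ0 : κ ≠ 0 := (Set.mem_Ioi.1 hκ).ne'
  unfold riskBound
  field_simp

theorem totalKernelError_nonneg {m : ℕ} (x : Fin n → EuclideanSpace ℝ (Fin d)) (K R β : ℝ)
    (g : Fin m → NeuronDraw d) (z : EuclideanSpace ℝ (Fin d)) : 0 ≤ totalKernelError x K R β g z :=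
  Finset.sum_nonneg fun _ _ => sq_nonneg _

theorem kernelError_le_sqrt_totalKernelError {m : ℕ} (x : Fin n → EuclideanSpace ℝ (Fin d))
    (K R β : ℝ) (g : Fin m → NeuronDraw d) (z : EuclideanSpace ℝ (Fin d)) (j : Fin n) :
    kernelError K R β g z (x j) ≤ √(totalKernelError x K R β g z) :=
  Real.le_sqrt_of_sq_le (Finset.single_le_sum (f := fun j => kernelError K R β g z (x j) ^ 2)
    (fun _ _ => sq_nonneg _) (Finset.mem_univ j))

theorem measurable_totalKernelError {m : ℕ} (x : Fin n → EuclideanSpace ℝ (Fin d)) (K R β : ℝ)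
    (g : Fin m → NeuronDraw d) : Measurable (totalKernelError x K R β g) := by
  have h1 : Measurable fun z : EuclideanSpace ℝ (Fin d) => (g, z) :=
    measurable_const.prodMk measurable_id
  have h2 := (measurable_totalKernelError_uncurry (m := m) x K R β).comp h1
  simp only [Function.comp_def] at h2
  exact h2

/-- If the total kernel error is small on average over the domain and at the sample points, every
gradient flow has nearly the risk of kernel regression at all times. -/
theorem abs_excessRisk_network_sub_ntkRegression_le [IsFiniteMeasure μ] (h𝒳 : IsCompact 𝒳)
    (hfstar : ContinuousOn fstar 𝒳) {x : Fin n → EuclideanSpace ℝ (Fin d)} {y : Fin n → ℝ}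
    (hx : ∀ i, x i ∈ 𝒳) (hinj : Function.Injective x) {R lam κ a b : ℝ} (hR : 0 ≤ R)
    (h𝒳R : ∀ z ∈ 𝒳, ‖z‖ ≤ R) (hlam : 0 < lam)
    (hK : ∀ c : Fin n → ℝ, lam * ∑ i, c i ^ 2 ≤ ∑ i, ∑ j, c i * c j * ntk (x i) (x j))
    (hκ0 : 0 < κ) (hκ : κ * n ≤ lam / 2) (ha0 : 0 ≤ a)
    (ha : ∀ z ∈ 𝒳, ∑ j, |interpolationCoeff x z j| ≤ a) (hb0 : 0 ≤ b)
    (hb : ∀ z ∈ 𝒳, |fstar z| ≤ b)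
    {m : ℕ} (hm : m ≠ 0) (hmove : movementBound lam R y m ≤ 1 / 2) {g : InitDraw m d}
    (hg : ∫⁻ z, ENNReal.ofReal (totalKernelError x (12 * (R + 1) ^ 2) R (movementBound lam R y m)
      (drawNeurons g) z) ∂(μ.restrict 𝒳 + ∑ j, Measure.dirac (x j)) ≤ ENNReal.ofReal (κ ^ 2))
    {θ : ℝ → Params (m + m) d} (hθ0 : θ 0 = initParams g) (hθ : IsGradientFlow x y θ) {t : ℝ}
    (ht : 0 ≤ t) :
    |excessRisk 𝒳 μ fstar (network (θ t)) - excessRisk 𝒳 μ fstar (ntkRegression x y t)|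
      ≤ riskBound (1 / (n : ℝ) * residualBudget lam y)
        (a * (1 / (n : ℝ) * residualBudget lam y * κ
          + √(4 * (1 / (n : ℝ)) * κ * √(n * ∑ i, y i ^ 2) * residualBudget lam y)))
        (2 * (a * √(n * ∑ i, y i ^ 2)) + b) (μ.real 𝒳) κ := by
  set T := totalKernelError x (12 * (R + 1) ^ 2) R (movementBound lam R y m) (drawNeurons g) with hT
  have hTm : Measurable T := measurable_totalKernelError _ _ _ _ _
  have hT0 : ∀ z, 0 ≤ T z := totalKernelError_nonneg _ _ _ _ _
  have hQ0 := zero_le_one.trans (one_le_residualBudget (y := y) hlam.le)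
  rw [lintegral_add_measure, lintegral_finsetSum_measure] at hg
  have hdom : ∫⁻ z in 𝒳, ENNReal.ofReal (T z) ∂μ ≤ ENNReal.ofReal (κ ^ 2) := le_self_add.trans hg
  -- The Dirac masses in the measure turn the integral bound into pointwise bounds at the sample
  -- points, which the dynamics of the residuals require.
  have hsample : ∀ i, T (x i) ≤ κ ^ 2 := by
    intro i
    have h1 : ∫⁻ z, ENNReal.ofReal (T z) ∂(Measure.dirac (x i)) ≤ ENNReal.ofReal (κ ^ 2) :=
      (Finset.single_le_sum (f := fun i => ∫⁻ z, ENNReal.ofReal (T z) ∂(Measure.dirac (x i)))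
        (fun _ _ => zero_le) (Finset.mem_univ i)).trans (le_add_self.trans hg)
    rw [lintegral_dirac' _ hTm.ennreal_ofReal] at h1
    exact (ENNReal.ofReal_le_ofReal_iff (sq_nonneg κ)).1 h1
  have hTint : Integrable T (μ.restrict 𝒳) := by
    refine ⟨hTm.aestronglyMeasurable, ?_⟩
    rw [hasFiniteIntegral_iff_ofReal (Eventually.of_forall hT0)]
    exact hdom.trans_lt ENNReal.ofReal_lt_top
  have hTκ : ∫ z in 𝒳, T z ∂μ ≤ κ ^ 2 := by
    rw [integral_eq_lintegral_of_nonneg_ae (Eventually.of_forall hT0) hTm.aestronglyMeasurable]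
    exact ENNReal.toReal_le_of_le_ofReal (sq_nonneg κ) hdom
  have hgood : IsGoodDraw x y R lam κ g := ⟨hm, hmove, fun i j =>
    (kernelError_le_sqrt_totalKernelError _ _ _ _ _ _ _).trans
      ((Real.sqrt_le_sqrt (hsample i)).trans (Real.sqrt_sq hκ0.le).le)⟩
  refine abs_excessRisk_sub_le h𝒳 hfstar (continuous_network_input _) (continuous_ntkRegression _)
    hTint hT0 (by positivity) (by positivity) (by positivity) hκ0 (fun z hz => ?_) (fun z hz => ?_) hTκ
  · exact hθ.abs_network_sub_ntkRegression_le hθ0 hgood hinj (fun i => h𝒳R _ (hx i)) hR hlam hK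
      hκ0.le hκ ht (h𝒳R z hz) (Real.sqrt_nonneg _)
      (fun j => kernelError_le_sqrt_totalKernelError _ _ _ _ _ _ _) (ha z hz)
  · exact (abs_sub _ _).trans (add_le_add (abs_ntkRegression_le hlam.le hK ht (ha z hz)) (hb z hz))

theorem IsCompact.exists_nonneg_forall_abs_le {X : Type*} [TopologicalSpace X] {s : Set X}
    (hs : IsCompact s) {f : X → ℝ} (hf : ContinuousOn f s) : ∃ C, 0 ≤ C ∧ ∀ z ∈ s, |f z| ≤ C := by
  obtain ⟨C, hC⟩ := hs.exists_bound_of_continuousOn hf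
  exact ⟨max C 0, le_max_right _ _, fun z hz => (hC z hz).trans (le_max_left _ _)⟩

/-- For every accuracy, the probability that the risks differ by more than this accuracy at some
time tends to zero as the width grows. -/
theorem tendsto_initLaw_excessRisk [IsFiniteMeasure μ] (h𝒳 : IsCompact 𝒳)
    (hfstar : ContinuousOn fstar 𝒳) {x : Fin n → EuclideanSpace ℝ (Fin d)} (y : Fin n → ℝ)
    (hx : ∀ i, x i ∈ 𝒳) (hinj : Function.Injective x) {ε : ℝ} (hε : 0 < ε) :
    Tendsto (fun m : ℕ => initLaw m d {g : InitDraw m d | ¬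
      ((∃ θ : ℝ → Params (m + m) d, θ 0 = initParams g ∧ IsGradientFlow x y θ) ∧
        ∀ θ : ℝ → Params (m + m) d, θ 0 = initParams g → IsGradientFlow x y θ →
          ∀ t : ℝ, 0 ≤ t →
            |excessRisk 𝒳 μ fstar (network (θ t))
              - excessRisk 𝒳 μ fstar (ntkRegression x y t)| ≤ ε)}) atTop (𝓝 0) := by
  obtain ⟨R, hR, h𝒳R⟩ := h𝒳.exists_nonneg_forall_abs_le (f := fun z => ‖z‖) continuous_norm.continuousOn
  simp only [abs_norm] at h𝒳R
  obtain ⟨lam, hlam, hK⟩ := exists_ntk_coercive hinj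
  obtain ⟨a, ha0, ha⟩ := h𝒳.exists_nonneg_forall_abs_le
    (f := fun z => ∑ j, |interpolationCoeff x z j|)
    (continuous_finsetSum _ fun j _ => (continuous_interpolationCoeff j).abs).continuousOn
  obtain ⟨b, hb0, hb⟩ := h𝒳.exists_nonneg_forall_abs_le hfstar
  set Q := residualBudget lam y with hQ
  set Y := √(n * ∑ i, y i ^ 2) with hY
  have hc₂ : Tendsto (fun κ : ℝ => a * (1 / (n : ℝ) * Q * κ + √(4 * (1 / (n : ℝ)) * κ * Y * Q)))
      (𝓝[>] 0) (𝓝 0) := by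
    refine tendsto_nhdsWithin_of_tendsto_nhds ?_
    have : Continuous fun κ : ℝ => a * (1 / (n : ℝ) * Q * κ + √(4 * (1 / (n : ℝ)) * κ * Y * Q)) := by
      fun_prop
    simpa using this.tendsto 0
  have hn : Tendsto (fun κ : ℝ => κ * n) (𝓝[>] 0) (𝓝 0) := by
    refine tendsto_nhdsWithin_of_tendsto_nhds ?_
    have : Continuous fun κ : ℝ => κ * n := by fun_prop
    simpa using this.tendsto 0
  -- The kernel accuracy `κ` depends on `ε` but not on the width. It is small enough both for the
  -- final risk bound and for half of the coercivity to survive.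
  obtain ⟨κ, ⟨hκε, hκn⟩, hκ0⟩ := (((tendsto_riskBound (1 / (n : ℝ) * Q) (2 * (a * Y) + b) (μ.real 𝒳)
    hc₂).eventually_lt_const hε).and
      (hn.eventually_lt_const (by positivity : 0 < lam / 2))).and self_mem_nhdsWithin |>.exists
  have hκ0' : 0 < κ := hκ0
  have hbad := tendsto_initLaw_totalKernelError x (K := 12 * (R + 1) ^ 2) (R := R) (by positivity)
    (fun i => h𝒳R _ (hx i)) (fun m => movementBound_nonneg hlam.le hR y m)
    (tendsto_movementBound lam R y) (μ.restrict 𝒳 + ∑ j, Measure.dirac (x j))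
    (by
      rw [ae_add_measure_iff]
      refine ⟨(ae_restrict_mem h𝒳.measurableSet).mono h𝒳R, ?_⟩
      have hmeas : MeasurableSet {z : EuclideanSpace ℝ (Fin d) | ‖z‖ ≤ R} :=
        measurableSet_le measurable_norm measurable_const
      rw [ae_iff]
      simp only [Measure.coe_finsetSum, Finset.sum_apply, Finset.sum_eq_zero_iff, Finset.mem_univ, true_imp_iff]
      intro j
      have h1 := (ae_dirac_iff (a := x j) hmeas).2 (h𝒳R _ (hx j))
      rwa [ae_iff] at h1)
    (κ := ENNReal.ofReal (κ ^ 2)) (by simpa using hκ0'.ne') ENNReal.ofReal_ne_top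
  refine tendsto_of_tendsto_of_tendsto_of_le_of_le' tendsto_const_nhds hbad
    (Eventually.of_forall fun m => zero_le) ?_
  filter_upwards [eventually_ne_atTop 0,
    (tendsto_movementBound lam R y).eventually_lt_const (by norm_num : (0 : ℝ) < 1 / 2)] with m hm hmove
  refine measure_mono fun g hg => ?_
  by_contra hlt
  rw [Set.mem_ofPred_eq, not_le] at hlt
  refine hg ⟨exists_isGradientFlow x y _, fun θ hθ0 hθ t ht => ?_⟩
  exact (abs_excessRisk_network_sub_ntkRegression_le h𝒳 hfstar hx hinj hR h𝒳R hlam hK hκ0' hκn.le ha0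
    (fun z hz => (le_abs_self _).trans (ha z hz)) hb0 hb hm hmove.le hlt.le hθ0 hθ ht).trans hκε.le

end Risk

/-- The measure of a possibly nonmeasurable set is its outer measure, so the bad event has a
measurable superset of the same measure, and the complement of that superset is a measurable good
event. With M = 2m neurons the scaling √(2/M) is 1/√m. -/
theorem theorem2 {d n : ℕ}
    (𝒳 : Set (EuclideanSpace ℝ (Fin d))) (h𝒳 : IsCompact 𝒳)
    (μ : Measure (EuclideanSpace ℝ (Fin d))) [IsFiniteMeasure μ]
    (fstar : EuclideanSpace ℝ (Fin d) → ℝ) (hfstar : ContinuousOn fstar 𝒳)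
    (x : Fin n → EuclideanSpace ℝ (Fin d)) (hx : ∀ i, x i ∈ 𝒳) (hinj : Function.Injective x)
    (y : Fin n → ℝ) :
    ∃ δ : ℕ → ℝ≥0∞, Tendsto δ atTop (𝓝 0) ∧
      ∀ ε : ℝ, 0 < ε → ∀ᶠ m : ℕ in atTop,
        initLaw m d {g : InitDraw m d | ¬
          ((∃ θ : ℝ → Params (m + m) d, θ 0 = initParams g ∧ IsGradientFlow x y θ) ∧
            ∀ θ : ℝ → Params (m + m) d, θ 0 = initParams g → IsGradientFlow x y θ →
              ∀ t : ℝ, 0 ≤ t →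
                |excessRisk 𝒳 μ fstar (network (θ t))
                  - excessRisk 𝒳 μ fstar (ntkRegression x y t)| ≤ ε)} ≤ δ m := by
  refine exists_tendsto_zero_forall_eventually_le (fun ε m => initLaw m d {g : InitDraw m d | ¬
    ((∃ θ : ℝ → Params (m + m) d, θ 0 = initParams g ∧ IsGradientFlow x y θ) ∧
      ∀ θ : ℝ → Params (m + m) d, θ 0 = initParams g → IsGradientFlow x y θ →
        ∀ t : ℝ, 0 ≤ t →
          |excessRisk 𝒳 μ fstar (network (θ t))
            - excessRisk 𝒳 μ fstar (ntkRegression x y t)| ≤ ε)}) (fun ε ε' m h => ?_)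
    fun ε hε => tendsto_initLaw_excessRisk h𝒳 hfstar y hx hinj hε
  -- The exceptional event shrinks as `ε` grows, which is the monotonicity needed for a single
  -- sequence `δ` to serve all accuracies.
  exact measure_mono fun g hg hgood => hg ⟨hgood.1, fun θ hθ0 hθ t ht => (hgood.2 θ hθ0 hθ t ht).trans h⟩
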